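/- **Setting.** Let $n\ge 1$ and let $\langle x,y\rangle=x_1y_1+\dots+x_{2n}y_{2n}-x_{2n+1}y_{2n+1}$ on $\mathbb R^{2n,1}=\mathbb R^{2n+1}$, extended complex bilinearly to $\mathbb C^{2n+1}$; write $\|v\|^2=\langle v,\bar v\rangle$, $\upsilon=\operatorname{diag}(1,\dots,1,-1)$, and let $e_1,\dots,e_{2n+1}$ be the standard basis. Let $S^{2n}_1=\{x\in\mathbb R^{2n,1}:\langle x,x\rangle=1\}$, let $SO(2n,1)$ be the group of real matrices $g$ with $g^t\upsilon g=\upsilon$, $\det g=1$, and let $T=\operatorname{diag}(1,SO(2),\dots,SO(2),SO(1,1))$. The map $gT\mapsto ge_1$ projects $SO(2n,1)/T$ to $S^{2n}_1$, and a lift of $f:\mathbb C\to S^{2n}_1$ is a $\psi:\mathbb C\to SO(2n,1)/T$ that projects to $f$. A smooth $f:\mathbb C\to S_1^{2n}$ is harmonic if the tangential part $\Delta f-\langle\Delta f,f\rangle f$ of its Laplacian vanishes. *Superconformal.* $f$ is superconformal if $\langle\partial_z^af,\partial_z^bf\rangle\equiv0$ for all $a,b\ge0$ with $1\le a+b\le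 2n-1$, and $\langle\partial_z^nf,\partial_z^nf\rangle\not\equiv0$. *Harmonic sequence.* The entries $f_1,\dots,f_n$ of the harmonic sequence of $f$ are defined everywhere if there are smooth maps $f_0=f,f_1,\dots,f_n:\mathbb C\to\mathbb C^{2n+1}$ such that for each $0\le j<n$ the set $\{\|f_j\|^2\ne0\}$ is dense, on it $$f_{j+1}=\partial_zf_j-\frac{\langle\partial_zf_j,\bar f_j\rangle}{\|f_j\|^2}f_j ,$$ and $f_j=0$ at all other points. (Thus the sequence never meets a non-zero null value, and at the zeros of $f_j$ the entry $f_{j+1}$ is the smooth extension; the $f_j$ are then uniquely determined.) *Root vectors.* For $j<k$ let $[j,k]=E_{kj}-E_{jk}$ if $k\neq 2n+1$ and $[j,k]=E_{kj}+E_{jk}$ if $k=2n+1$. For $n\ge2$ put $$R_{\alpha_1}=[1,2]+i[1,3],\qquad R_{\alpha_k}=[2k-2,2k]+i[2k-2,2k+1]-i[2k-1,2k]+[2k-1,2k+1]\quad(1<k<n),$$ $$R_{\alpha_n}=[2n-2,2n]-[2n-2,2n+1]-i[2n-1,2n]+i[2n-1,2n+1],$$ $$R_{\alpha_0}=[2n-2,2n]+[2n-2,2n+1]-i[2n-1,2n]-i[2n-1,2n+1],$$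 and for $n=1$ put $R_{\alpha_1}=[1,2]+[1,3]$, $R_{\alpha_0}=[1,2]-[1,3]$. These span the root spaces of the simple roots and of the lowest root of $\mathfrak{so}(2n,1,\mathbb C)$. Let $\sigma$ be the Coxeter automorphism of $\mathfrak{so}(2n,1,\mathbb C)$, of order $2n$, given by conjugation by the block diagonal matrix with first entry $1$ and $l$-th $2\times2$ block $\begin{pmatrix}\cos\theta_l&\sin\theta_l\\-\sin\theta_l&\cos\theta_l\end{pmatrix}$, $\theta_l=l\pi/n$, $1\le l\le n$; let $\mathfrak g_j^\sigma$ be its eigenspace for $e^{2\pi ij/(2n)}$. Then $\mathfrak g_0^\sigma=\mathfrak t^{\mathbb C}$ and $\mathfrak g_1^\sigma=\bigoplus_{k=0}^n\mathbb C R_{\alpha_k}$ . *Cyclic primitive.* A smooth $F:\mathbb C\to SO(2n,1)$ is a primitive frame if $F^{-1}F_z$ takes values in $\mathfrak g_0^\sigma\oplus\mathfrak g_1^\sigma$ and, when $n=1$ (where this is no condition), $Fe_1$ is harmonic. Its root vector coefficients $c_0,\dots,c_n:\mathbb C\to\mathbb C$ are given by: the $\mathfrak g_1^\sigma$-component of $F^{-1}F_z$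 is $\sum_{k=0}^nc_kR_{\alpha_k}$. The frame $F$ is cyclic primitive if moreover at some point of $\mathbb C$ all of $c_0,\dots,c_n$ are non-zero. A map $\psi:\mathbb C\to SO(2n,1)/T$ is cyclic primitive if it has a smooth lift $F:\mathbb C\to SO(2n,1)$ that is a cyclic primitive frame. $F$ is a frame of $f$ if $Fe_1=f$. **Theorem.** A harmonic map $f:\mathbb C\to S^{2n}_1$ has a cyclic primitive lift $\psi:\mathbb C\to SO(2n,1)/T$ if and only if it is superconformal and the entries $f_1,\dots,f_n$ of its harmonic sequence are defined everywhere. Furthermore, under these conditions, for each $1\le j\le n-1$ the zeros of $f_j$ are isolated and $f_j$ is spacelike, $\|f_j\|^2>0$, away from them, and for any cyclic primitive frame $F$ of $f$, with root vector coefficients $c_0,\dots,c_n$, $$f_j=2^{j-1}c_1\cdots c_j\,F(e_{2j}+ie_{2j+1})\quad\text{for each }1\le j\le n-1,$$ $$\langle\partial_z^nf,\partial_z^nf\rangle=2^{2n}c_1^2\cdots c_{n-1}^2\,c_n\,c_0 .$$ -/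

import Mathlib

open scoped ContDiff

noncomputable section

namespace DeSitter

/-! Coordinates on `ℝ^{2n,1}` are indexed by `Fin (2 * n + 1)`; the last one is timelike.
The vectors called `e_1, …, e_{2n+1}` in the usual 1-based numbering are `stdVec n R k`. -/

/-! ### Minkowski space and de Sitter space -/

/-- The Gram matrix `diag(1, …, 1, -1)`. -/
def upsilon (n : ℕ) (R : Type*) [CommRing R] :
    Matrix (Fin (2 * n + 1)) (Fin (2 * n + 1)) R :=
  Matrix.diagonal fun i => if i = Fin.last (2 * n) then -1 else 1

/-- The bilinear Minkowski product `x_1 y_1 + ⋯ + x_{2n} y_{2n} - x_{2n+1} y_{2n+1}`. -/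
def form {n : ℕ} {R : Type*} [CommRing R] (x y : Fin (2 * n + 1) → R) : R :=
  dotProduct x ((upsilon n R).mulVec y)

/-- `‖v‖² = ⟨v, v̄⟩` for a complex vector `v`; the product `⟨v, v̄⟩` is a real number. -/
def hnorm {n : ℕ} (v : Fin (2 * n + 1) → ℂ) : ℝ := (form v (star v)).re

/-- De Sitter space `S^{2n}_1`. -/
def sphere (n : ℕ) : Set (Fin (2 * n + 1) → ℝ) := {x | form x x = 1}

/-- The standard basis vector `e_k`, `1 ≤ k ≤ 2n+1`. -/
def stdVec (n : ℕ) (R : Type*) [CommRing R] (k : ℕ) : Fin (2 * n + 1) → R :=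
  fun a => if a.val + 1 = k then 1 else 0

/-! ### Complex derivatives, harmonic maps, isotropy order, harmonic sequence -/

/-- `∂_z = (∂_x - i ∂_y) / 2` of a complex valued function on the plane. -/
def dz (g : ℂ → ℂ) (z : ℂ) : ℂ :=
  (1 / 2) * (fderiv ℝ g z 1 - Complex.I * fderiv ℝ g z Complex.I)

/-- `∂_z` of a vector valued function, coordinate by coordinate. -/
def dzVec {ι : Type*} (g : ℂ → ι → ℂ) : ℂ → ι → ℂ :=
  fun z i => dz (fun w => g w i) z

/-- A real vector valued map regarded as a complex vector valued one. -/
def complexify {ι : Type*} (f : ℂ → ι → ℝ) : ℂ → ι → ℂ := fun z i => (f z i : ℂ)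

open Laplacian InnerProductSpace in
/-- The tension field of a map of the plane into de Sitter space: the tangential part
`Δf - ⟨Δf, f⟩ f` of its Laplacian. -/
def tension {n : ℕ} (f : ℂ → Fin (2 * n + 1) → ℝ) (z : ℂ) : Fin (2 * n + 1) → ℝ :=
  Δ f z - form (Δ f z) (f z) • f z

/-- Harmonic maps of the plane into `S^{2n}_1`. -/
structure IsHarmonicMap {n : ℕ} (f : ℂ → Fin (2 * n + 1) → ℝ) : Prop where
  mem_sphere : ∀ z, f z ∈ sphere n
  smooth : ContDiff ℝ ∞ f
  tension_eq_zero : ∀ z, tension f z = 0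

/-- `f` has isotropy order `r`. -/
def HasIsotropyOrder {n : ℕ} (f : ℂ → Fin (2 * n + 1) → ℝ) (r : ℕ) : Prop :=
  (∀ a b : ℕ, 1 ≤ a + b → a + b ≤ 2 * r + 1 →
    ∀ z, form (dzVec^[a] (complexify f) z) (dzVec^[b] (complexify f) z) = 0) ∧
  ∃ z, form (dzVec^[r + 1] (complexify f) z) (dzVec^[r + 1] (complexify f) z) ≠ 0

/-- Superconformal: the isotropy order is `n - 1`. -/
def IsSuperconformal {n : ℕ} (f : ℂ → Fin (2 * n + 1) → ℝ) : Prop :=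
  HasIsotropyOrder f (n - 1)

/-- `s 0, …, s m` are the entries `f_0, …, f_m` of the harmonic sequence of `f`, and they are
defined on the whole plane: wherever `‖f_j‖² ≠ 0` the next entry is given by the Gram-Schmidt
formula, the only other points are zeros of `f_j`, and `f_{j+1}` is extended to those from the
(dense) set where the formula makes sense, as a smooth map. -/
structure IsHarmonicSequence {n : ℕ} (f : ℂ → Fin (2 * n + 1) → ℝ) (m : ℕ)
    (s : ℕ → ℂ → Fin (2 * n + 1) → ℂ) : Prop where
  zero : s 0 = complexify f
  smooth : ∀ j ≤ m, ContDiff ℝ ∞ (s j)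
  succ : ∀ j < m, ∀ z, hnorm (s j z) ≠ 0 →
    s (j + 1) z = dzVec (s j) z -
      (form (dzVec (s j) z) (star (s j z)) / (hnorm (s j z) : ℂ)) • s j z
  eq_zero_of_null : ∀ j < m, ∀ z, hnorm (s j z) = 0 → s j z = 0
  dense : ∀ j < m, Dense {z | hnorm (s j z) ≠ 0}

/-! ### The groups `SO(2n,1)` and `T`, and the homogeneous space `SO(2n,1)/T` -/

/-- The group `SO(2n,1)`. -/
def SO (n : ℕ) : Subgroup (Matrix.SpecialLinearGroup (Fin (2 * n + 1)) ℝ) where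
  carrier := {g | (g : Matrix (Fin (2 * n + 1)) (Fin (2 * n + 1)) ℝ).transpose * upsilon n ℝ *
    (g : Matrix (Fin (2 * n + 1)) (Fin (2 * n + 1)) ℝ) = upsilon n ℝ}
  one_mem' := by simp
  mul_mem' := by
    intro g h hg hh
    simp only [Set.mem_ofPred_eq, Matrix.SpecialLinearGroup.coe_mul, Matrix.transpose_mul] at *
    calc _ = (h : Matrix _ _ ℝ).transpose * ((g : Matrix _ _ ℝ).transpose * upsilon n ℝ *
          (g : Matrix _ _ ℝ)) * (h : Matrix _ _ ℝ) := by simp only [Matrix.mul_assoc]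
      _ = _ := by rw [hg, hh]
  inv_mem' := by
    intro g hg
    simp only [Set.mem_ofPred_eq] at *
    have h1 : g.val * (g⁻¹).val = 1 := by
      rw [← Matrix.SpecialLinearGroup.coe_mul, mul_inv_cancel, Matrix.SpecialLinearGroup.coe_one]
    have h2 : (g⁻¹).val.transpose * g.val.transpose = 1 := by
      rw [← Matrix.transpose_mul, h1, Matrix.transpose_one]
    generalize (g⁻¹).val = k at *
    calc k.transpose * upsilon n ℝ * k
        = k.transpose * (g.val.transpose * upsilon n ℝ * g.val) * k := by rw [hg]
      _ = (k.transpose * g.val.transpose) * upsilon n ℝ * (g.val * k) := by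
          simp only [Matrix.mul_assoc]
      _ = _ := by rw [h1, h2, Matrix.one_mul, Matrix.mul_one]

/-- The matrix of an element of `SO(2n,1)`. -/
def mat {n : ℕ} (g : SO n) : Matrix (Fin (2 * n + 1)) (Fin (2 * n + 1)) ℝ :=
  (g : Matrix.SpecialLinearGroup (Fin (2 * n + 1)) ℝ)

/-- The complexified matrix of an element of `SO(2n,1)`. -/
def cmat {n : ℕ} (g : SO n) : Matrix (Fin (2 * n + 1)) (Fin (2 * n + 1)) ℂ :=
  (mat g).map Complex.ofReal

theorem mat_one {n : ℕ} : mat (1 : SO n) = 1 := rfl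

theorem mat_mul {n : ℕ} (g h : SO n) : mat (g * h) = mat g * mat h := rfl

theorem mat_inv_mul {n : ℕ} (g : SO n) : mat g⁻¹ * mat g = 1 := by
  rw [← mat_mul, inv_mul_cancel, mat_one]

theorem mat_mul_inv {n : ℕ} (g : SO n) : mat g * mat g⁻¹ = 1 := by
  rw [← mat_mul, mul_inv_cancel, mat_one]

/-- The elementary matrix `E_{jk}`, with 1-based indices. -/
def elemMat (n : ℕ) (R : Type*) [CommRing R] (j k : ℕ) :
    Matrix (Fin (2 * n + 1)) (Fin (2 * n + 1)) R :=
  fun a b => if a.val + 1 = j ∧ b.val + 1 = k then 1 else 0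

/-- The element `[j,k]` of `𝔰𝔬(2n,1)`, for `1 ≤ j < k ≤ 2n+1`: it is `E_{kj} - E_{jk}` if
`k ≠ 2n+1` and `E_{kj} + E_{jk}` if `k = 2n+1`. -/
def br (n : ℕ) (R : Type*) [CommRing R] (j k : ℕ) :
    Matrix (Fin (2 * n + 1)) (Fin (2 * n + 1)) R :=
  if k = 2 * n + 1 then elemMat n R k j + elemMat n R j k
  else elemMat n R k j - elemMat n R j k

/-- The Cartan subgroup `T = diag(1, SO(2), …, SO(2), SO(1,1))` of `SO(2n,1)`: the elements
that fix `e_1` and commute with the generators `[2l, 2l+1]`, `1 ≤ l ≤ n`, of its Lie algebra. -/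
def T (n : ℕ) : Subgroup (SO n) where
  carrier := {g | (mat g).mulVec (stdVec n ℝ 1) = stdVec n ℝ 1 ∧
    ∀ l, 1 ≤ l → l ≤ n →
      mat g * br n ℝ (2 * l) (2 * l + 1) = br n ℝ (2 * l) (2 * l + 1) * mat g}
  one_mem' := by simp [mat_one]
  mul_mem' := by
    rintro g h ⟨hg, hg'⟩ ⟨hh, hh'⟩
    refine ⟨?_, fun l h1 h2 => ?_⟩
    · rw [mat_mul, ← Matrix.mulVec_mulVec, hh, hg]
    · rw [mat_mul, Matrix.mul_assoc, hh' l h1 h2, ← Matrix.mul_assoc, hg' l h1 h2,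
        Matrix.mul_assoc]
  inv_mem' := by
    rintro g ⟨hg, hg'⟩
    refine ⟨?_, fun l h1 h2 => ?_⟩
    · conv_lhs => rw [← hg]
      rw [Matrix.mulVec_mulVec, mat_inv_mul, Matrix.one_mulVec]
    · have h := hg' l h1 h2
      calc mat g⁻¹ * br n ℝ (2 * l) (2 * l + 1)
          = mat g⁻¹ * (br n ℝ (2 * l) (2 * l + 1) * mat g) * mat g⁻¹ := by
            rw [Matrix.mul_assoc, Matrix.mul_assoc, mat_mul_inv, Matrix.mul_one]
        _ = br n ℝ (2 * l) (2 * l + 1) * mat g⁻¹ := by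
            rw [← h, ← Matrix.mul_assoc, mat_inv_mul, Matrix.one_mul]

/-- The projection `SO(2n,1)/T → S^{2n}_1`, `gT ↦ g e_1`. -/
def proj (n : ℕ) : SO n ⧸ T n → Fin (2 * n + 1) → ℝ :=
  Quotient.lift (fun g : SO n => (mat g).mulVec (stdVec n ℝ 1)) (by
    intro g h hgh
    have hm : g⁻¹ * h ∈ T n := QuotientGroup.leftRel_apply.mp hgh
    have h1 := hm.1
    have h2 : h = g * (g⁻¹ * h) := by group
    show (mat g).mulVec _ = (mat h).mulVec _
    rw [h2, mat_mul, ← Matrix.mulVec_mulVec, h1])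

/-! ### The automorphism `σ`, its eigenspaces, and the root vectors -/

/-- The number of the diagonal block (`0` for `e_1`, and `l` for `e_{2l}, e_{2l+1}`). -/
def block {n : ℕ} (a : Fin (2 * n + 1)) : ℕ := (a.val + 1) / 2

/-- The block diagonal matrix `exp ((π i / n) ∑_j η_j)`, where `η_1, …, η_n` is the dual basis of
the simple roots. Its entry at `e_1` is `1`, and its `l`-th two by two block, `1 ≤ l ≤ n`, is
`(cos θ, sin θ; -sin θ, cos θ)` with `θ = lπ/n`; in particular the last block is `-I_2`. -/
def coxeterMat (n : ℕ) : Matrix (Fin (2 * n + 1)) (Fin (2 * n + 1)) ℂ :=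
  fun a b =>
    if block a = block b then
      if a = b then (Real.cos (block a * Real.pi / n) : ℂ)
      else if a < b then (Real.sin (block a * Real.pi / n) : ℂ)
      else -(Real.sin (block a * Real.pi / n) : ℂ)
    else 0

/-- The Coxeter automorphism `σ`, conjugation by `coxeterMat n`. It has order `2n`. -/
def sigma (n : ℕ) (A : Matrix (Fin (2 * n + 1)) (Fin (2 * n + 1)) ℂ) :
    Matrix (Fin (2 * n + 1)) (Fin (2 * n + 1)) ℂ :=
  coxeterMat n * A * (coxeterMat n)⁻¹

/-- `A` lies in `𝔤_j^σ`, the eigenspace of `σ` on `𝔤^ℂ = 𝔰𝔬(2n,1,ℂ)` for `e^{2πij/(2n)}`. -/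
def InGraded (n j : ℕ) (A : Matrix (Fin (2 * n + 1)) (Fin (2 * n + 1)) ℂ) : Prop :=
  A.transpose * upsilon n ℂ + upsilon n ℂ * A = 0 ∧
  sigma n A = Complex.exp (2 * Real.pi * Complex.I * j / (2 * n)) • A

/-- The root vectors `R_{α_k}` for the simple roots `α_1, …, α_n` and the lowest root `α_0` of
`𝔰𝔬(2n,1,ℂ)`. They span the root spaces of these roots. -/
def rootVec (n k : ℕ) : Matrix (Fin (2 * n + 1)) (Fin (2 * n + 1)) ℂ :=
  if n = 1 then
    if k = 0 then br n ℂ 1 2 - br n ℂ 1 3 else br n ℂ 1 2 + br n ℂ 1 3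
  else if k = 0 then
    br n ℂ (2 * n - 2) (2 * n) + br n ℂ (2 * n - 2) (2 * n + 1)
      - Complex.I • br n ℂ (2 * n - 1) (2 * n) - Complex.I • br n ℂ (2 * n - 1) (2 * n + 1)
  else if k = 1 then
    br n ℂ 1 2 + Complex.I • br n ℂ 1 3
  else if k = n then
    br n ℂ (2 * n - 2) (2 * n) - br n ℂ (2 * n - 2) (2 * n + 1)
      - Complex.I • br n ℂ (2 * n - 1) (2 * n) + Complex.I • br n ℂ (2 * n - 1) (2 * n + 1)
  else
    br n ℂ (2 * k - 2) (2 * k) + Complex.I • br n ℂ (2 * k - 2) (2 * k + 1)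
      - Complex.I • br n ℂ (2 * k - 1) (2 * k) + br n ℂ (2 * k - 1) (2 * k + 1)

/-- An element of `⨁_{k=0}^n 𝒢^{α_k}` is cyclic if all its components are nonzero. -/
def IsCyclicElement (n : ℕ) (A : Matrix (Fin (2 * n + 1)) (Fin (2 * n + 1)) ℂ) : Prop :=
  ∃ c : ℕ → ℂ, (∀ k ≤ n, c k ≠ 0) ∧ A = ∑ k ∈ Finset.range (n + 1), c k • rootVec n k

/-! ### Frames and cyclic primitive maps -/

/-- Smoothness of a map of the plane into `SO(2n,1)`. -/
def IsSmoothFrame {n : ℕ} (F : ℂ → SO n) : Prop :=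
  ∀ a b, ContDiff ℝ ∞ fun z => mat (F z) a b

/-- `F⁻¹ F_z`. -/
def maurerCartan {n : ℕ} (F : ℂ → SO n) (z : ℂ) :
    Matrix (Fin (2 * n + 1)) (Fin (2 * n + 1)) ℂ :=
  cmat (F z)⁻¹ * Matrix.of fun a b => dz (fun w => cmat (F w) a b) z

/-- Primitive frames: `F⁻¹ F_z` takes values in `𝔤_0^σ ⊕ 𝔤_1^σ`. For `n = 1`, when `σ` has
order two and this condition is vacuous, the map framed by `F` is required to be harmonic. -/
structure IsPrimitiveFrame {n : ℕ} (F : ℂ → SO n) : Prop where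
  smooth : IsSmoothFrame F
  graded : ∀ z, ∃ A₀ A₁, InGraded n 0 A₀ ∧ InGraded n 1 A₁ ∧ maurerCartan F z = A₀ + A₁
  harmonic : n = 1 → IsHarmonicMap fun z => (mat (F z)).mulVec (stdVec n ℝ 1)

/-- Cyclic primitive frames: primitive frames such that moreover the `𝔤_1^σ`-component of
`F⁻¹ F_z` is cyclic at some point. -/
structure IsCyclicPrimitiveFrame {n : ℕ} (F : ℂ → SO n) : Prop extends IsPrimitiveFrame F where
  cyclic : ∃ z A₀ A₁, InGraded n 0 A₀ ∧ IsCyclicElement n A₁ ∧ maurerCartan F z = A₀ + A₁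

/-- Cyclic primitive maps `ψ : ℂ → SO(2n,1)/T`: those with a smooth lift to `SO(2n,1)` that is a
cyclic primitive frame. -/
def IsCyclicPrimitive {n : ℕ} (ψ : ℂ → SO n ⧸ T n) : Prop :=
  ∃ F : ℂ → SO n, IsCyclicPrimitiveFrame F ∧ ∀ z, (QuotientGroup.mk (F z) : SO n ⧸ T n) = ψ z

/-- `F` is a frame of `f`: `F e_1 = f`. -/
def IsFrameOf {n : ℕ} (F : ℂ → SO n) (f : ℂ → Fin (2 * n + 1) → ℝ) : Prop :=
  ∀ z, (mat (F z)).mulVec (stdVec n ℝ 1) = f z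

/-- `c_0, …, c_n` are the root vector coefficients of `F`: the `𝔤_1^σ`-component of `F⁻¹ F_z`
is `∑_{k=0}^n c_k R_{α_k}`. -/
def IsRootCoeff {n : ℕ} (F : ℂ → SO n) (c : ℕ → ℂ → ℂ) : Prop :=
  ∀ z, InGraded n 0 (maurerCartan F z - ∑ k ∈ Finset.range (n + 1), c k z • rootVec n k)

end DeSitter

end

noncomputable section

namespace DeSitter

/-! ### The ring of smooth functions on the plane -/

/-! The computations take place in the ring `SmoothFn` of smooth complex functions on the plane,
with its derivations `D` = ∂_z and `Db` = ∂_z̄. This ring has zero divisors. A function is regular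
exactly when its non-vanishing set is dense, and division is replaced by cancelling regular factors.
By `Db_topSquare` the function ⟨∂^n f, ∂^n f⟩ is holomorphic for an isotropic harmonic map. So as
soon as it is not identically zero, it is regular and all its jets are non-zero.

From a frame to the sequence. Put V_l = F(e_{2l} + i e_{2l+1}) for l < n, so that V_0 = i f. An
element of 𝔤_0 ⊕ 𝔤_1 maps each eigenvector `Ep n l` to a multiple of itself plus a multiple of the
next one, the last one having its second part W in the plane of e_{2n}, e_{2n+1}. Thus ∂V_l is a
combination of V_l and c_{l+1} V_{l+1}, and ⟨W, W⟩ is a multiple of c_n c_0 (`isPrimitiveSystem`).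
Gram-Schmidt then yields multiples of the V_l with the stated products of coefficients. Isotropy and
the formula for ⟨∂^n f, ∂^n f⟩ follow because the V_l are mutually isotropic. Every factor of this
regular function is regular, so the sequence is defined everywhere.

From the sequence to a frame. The obstacle is the zeros of f_j, where its direction could fail to
extend or could become null. The key result `exists_isLevel` writes f_j = c g for j < n, where g is
nowhere null and c is locally (z - a)^m times a unit. It is proved by induction on j, in four steps.
(1) Since ∂̄f_{j+1} is proportional to f_j, the vector f_{j+1} solves a linear ∂̄-equation without
singularities. At a zero its whole ∂̄-jet therefore vanishes, and z - a divides it smoothly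
(`exists_eq_zeta_mul`). (2) The division stops, because the ∂-jet of f_{j+1} in the domain ℂ[[X]] is
non-zero (`jet_seq_ne_zero`). (3) The reduced vector is not null
(`hsq_ne_zero_of_eq_zeta_pow_smul`). Otherwise smoothness of f_{j+2} would make the ∂-jet of its
conjugate a constant isotropic vector orthogonal to f. Together with ∂f, …, ∂^{n-1}f this vector
would span an n-dimensional isotropic space orthogonal to both f and ∂^n f, which is impossible in
dimension 2n + 1 (`false_of_constant_isotropic`). (4) A Weierstrass-type product glues the local
factorizations (`exists_eq_mul_of_zeros`). Normalizing the g's gives 2n - 1 smooth orthonormal real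
vectors. A timelike unit vector and a cross product complete them to a frame
(`exists_frame_matrix`), and the relations for ∂f_j and ∂̄f_j make this frame primitive. -/

/-- Smooth complex valued functions on the plane. -/
def smoothAlg : Subalgebra ℂ (ℂ → ℂ) where
  carrier := {g | ContDiff ℝ ∞ g}
  mul_mem' := by
    intro a b ha hb
    simp only [Set.mem_ofPred_eq] at *
    exact ha.mul hb
  add_mem' := by
    intro a b ha hb
    simp only [Set.mem_ofPred_eq] at *
    exact ha.add hb
  algebraMap_mem' := by
    intro c
    simp only [Set.mem_ofPred_eq]
    exact contDiff_const (c := c)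

/-- The ring of smooth complex valued functions on the plane. -/
abbrev SmoothFn : Type := smoothAlg

instance : CommRing SmoothFn := smoothAlg.toCommRing

instance : Algebra ℂ SmoothFn := smoothAlg.algebra

theorem mem_smoothAlg {g : ℂ → ℂ} : g ∈ smoothAlg ↔ ContDiff ℝ ∞ g := Iff.rfl

namespace SmoothFn

theorem contDiff (g : SmoothFn) : ContDiff ℝ ∞ (g : ℂ → ℂ) := g.2

theorem continuous (g : SmoothFn) : Continuous (g : ℂ → ℂ) := g.contDiff.continuous

theorem differentiable (g : SmoothFn) : Differentiable ℝ (g : ℂ → ℂ) :=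
  g.contDiff.differentiable (by simp)

/-- Evaluation at a point. -/
def eval (z : ℂ) : SmoothFn →+* ℂ := (Pi.evalRingHom (fun _ : ℂ => ℂ) z).comp smoothAlg.val.toRingHom

@[simp] theorem eval_apply (z : ℂ) (g : SmoothFn) : eval z g = (g : ℂ → ℂ) z := rfl

theorem ext_eval {g h : SmoothFn} (H : ∀ z, (g : ℂ → ℂ) z = (h : ℂ → ℂ) z) : g = h :=
  Subtype.ext (funext H)

theorem contDiff_fderiv_apply (g : SmoothFn) (v : ℂ) :
    ContDiff ℝ ∞ fun z => fderiv ℝ (g : ℂ → ℂ) z v :=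
  (g.contDiff.fderiv_right (m := ∞) (by simp)).clm_apply contDiff_const

theorem contDiff_dz (g : SmoothFn) : ContDiff ℝ ∞ (dz (g : ℂ → ℂ)) :=
  contDiff_const.mul ((g.contDiff_fderiv_apply 1).sub
    (contDiff_const.mul (g.contDiff_fderiv_apply Complex.I)))

/-- The derivation `∂_z`. -/
def D : Derivation ℂ SmoothFn SmoothFn :=
  Derivation.mk'
    { toFun := fun g => ⟨dz (g : ℂ → ℂ), g.contDiff_dz⟩
      map_add' := by
        intro g h
        refine ext_eval fun z => ?_
        change dz ((g : ℂ → ℂ) + (h : ℂ → ℂ)) z = dz (g : ℂ → ℂ) z + dz (h : ℂ → ℂ) z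
        simp only [dz, fderiv_add (g.differentiable z) (h.differentiable z),
          add_apply]
        ring
      map_smul' := by
        intro c g
        refine ext_eval fun z => ?_
        change dz (c • (g : ℂ → ℂ)) z = c • dz (g : ℂ → ℂ) z
        simp only [dz, fderiv_const_smul (g.differentiable z) c, smul_apply,
          smul_eq_mul]
        ring }
    (by
      intro g h
      refine ext_eval fun z => ?_
      change dz ((g : ℂ → ℂ) * (h : ℂ → ℂ)) z =
        (g : ℂ → ℂ) z * dz (h : ℂ → ℂ) z + (h : ℂ → ℂ) z * dz (g : ℂ → ℂ) z
      simp only [dz, fderiv_mul (g.differentiable z) (h.differentiable z),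
        add_apply, smul_apply, smul_eq_mul]
      ring)

theorem D_apply (g : SmoothFn) (z : ℂ) : (D g : ℂ → ℂ) z = dz (g : ℂ → ℂ) z := rfl

/-- Complex conjugation. -/
def conj : SmoothFn →+* SmoothFn where
  toFun g := ⟨fun z => starRingEnd ℂ ((g : ℂ → ℂ) z), Complex.conjCLE.contDiff.comp g.contDiff⟩
  map_one' := ext_eval fun _ => map_one _
  map_mul' _ _ := ext_eval fun _ => map_mul _ _ _
  map_zero' := ext_eval fun _ => map_zero _
  map_add' _ _ := ext_eval fun _ => map_add _ _ _

@[simp] theorem conj_apply (g : SmoothFn) (z : ℂ) :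
    (conj g : ℂ → ℂ) z = starRingEnd ℂ ((g : ℂ → ℂ) z) := rfl

@[simp] theorem conj_conj (g : SmoothFn) : conj (conj g) = g :=
  ext_eval fun _ => Complex.conj_conj _

theorem conj_smul (c : ℂ) (g : SmoothFn) : conj (c • g) = starRingEnd ℂ c • conj g :=
  ext_eval fun _ => map_mul _ _ _

/-- The derivation `∂_{z̄}`. -/
def Db : Derivation ℂ SmoothFn SmoothFn :=
  Derivation.mk'
    { toFun := fun g => conj (D (conj g))
      map_add' := by intro g h; simp
      map_smul' := by intro c g; simp [conj_smul] }
    (by intro g h; simp)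

theorem Db_def (g : SmoothFn) : Db g = conj (D (conj g)) := rfl

theorem conj_Db (g : SmoothFn) : conj (Db g) = D (conj g) := by simp [Db_def]

theorem conj_D (g : SmoothFn) : conj (D g) = Db (conj g) := by simp [Db_def]

theorem Db_apply (g : SmoothFn) (z : ℂ) : (Db g : ℂ → ℂ) z =
    (1 / 2) * (fderiv ℝ (g : ℂ → ℂ) z 1 + Complex.I * fderiv ℝ (g : ℂ → ℂ) z Complex.I) := by
  have h : fderiv ℝ (conj g : ℂ → ℂ) z =
      (Complex.conjCLE : ℂ →L[ℝ] ℂ).comp (fderiv ℝ (g : ℂ → ℂ) z) :=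
    ((Complex.conjCLE : ℂ →L[ℝ] ℂ).hasFDerivAt.comp z (g.differentiable z).hasFDerivAt).fderiv
  rw [Db_def, conj_apply, D_apply, dz, h]
  simp [map_ofNat]

theorem fderiv_apply_eq (g : SmoothFn) (z v : ℂ) :
    fderiv ℝ (g : ℂ → ℂ) z v =
      (D g : ℂ → ℂ) z * v + (Db g : ℂ → ℂ) z * starRingEnd ℂ v := by
  have hv : v = v.re • (1 : ℂ) + v.im • Complex.I := by
    simp [Complex.re_add_im]
  rw [D_apply, dz, Db_apply]
  conv_lhs => rw [hv]
  rw [map_add, map_smul, map_smul]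
  conv_rhs => rw [← Complex.re_add_im v]
  simp only [Complex.real_smul, map_add, map_mul, Complex.conj_ofReal, Complex.conj_I]
  linear_combination (fderiv ℝ (g : ℂ → ℂ) z Complex.I * v.im) * Complex.I_sq

theorem fderiv_fderiv_apply (g : SmoothFn) (z v w : ℂ) :
    fderiv ℝ (fun y => fderiv ℝ (g : ℂ → ℂ) y v) z w =
      fderiv ℝ (fderiv ℝ (g : ℂ → ℂ)) z w v := by
  have h : DifferentiableAt ℝ (fderiv ℝ (g : ℂ → ℂ)) z :=
    (g.contDiff.fderiv_right (m := ∞) (by simp)).differentiable (by simp) z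
  rw [fderiv_clm_apply h (differentiableAt_const v)]
  simp

theorem fderiv_D (g : SmoothFn) (z w : ℂ) : fderiv ℝ (D g : ℂ → ℂ) z w =
    (1 / 2) * (fderiv ℝ (fderiv ℝ (g : ℂ → ℂ)) z w 1 -
      Complex.I * fderiv ℝ (fderiv ℝ (g : ℂ → ℂ)) z w Complex.I) := by
  have h1 := ((g.contDiff_fderiv_apply 1).differentiable (by simp) z).hasFDerivAt
  have h2 := ((g.contDiff_fderiv_apply Complex.I).differentiable (by simp) z).hasFDerivAt
  have h := (h1.sub (h2.const_mul Complex.I)).const_mul (1 / 2 : ℂ)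
  have h' : fderiv ℝ (D g : ℂ → ℂ) z = _ := h.fderiv
  rw [h']
  simp [fderiv_fderiv_apply]

theorem fderiv_Db (g : SmoothFn) (z w : ℂ) : fderiv ℝ (Db g : ℂ → ℂ) z w =
    (1 / 2) * (fderiv ℝ (fderiv ℝ (g : ℂ → ℂ)) z w 1 +
      Complex.I * fderiv ℝ (fderiv ℝ (g : ℂ → ℂ)) z w Complex.I) := by
  have h1 := ((g.contDiff_fderiv_apply 1).differentiable (by simp) z).hasFDerivAt
  have h2 := ((g.contDiff_fderiv_apply Complex.I).differentiable (by simp) z).hasFDerivAt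
  have h := (h1.add (h2.const_mul Complex.I)).const_mul (1 / 2 : ℂ)
  have e : (Db g : ℂ → ℂ) = fun z => (1 / 2) * (fderiv ℝ (g : ℂ → ℂ) z 1 +
    Complex.I * fderiv ℝ (g : ℂ → ℂ) z Complex.I) := funext g.Db_apply
  rw [e]
  have h' := h.fderiv
  simp only [Pi.add_apply] at h'
  rw [h']
  simp [fderiv_fderiv_apply]
  ring

theorem fderiv_fderiv_symm (g : SmoothFn) (z v w : ℂ) :
    fderiv ℝ (fderiv ℝ (g : ℂ → ℂ)) z v w = fderiv ℝ (fderiv ℝ (g : ℂ → ℂ)) z w v :=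
  (g.contDiff.contDiffAt.isSymmSndFDerivAt (n := ∞) (by
    rw [minSmoothness_of_isRCLikeNormedField]
    exact WithTop.coe_le_coe.mpr le_top)) v w

/-- Four times the mixed derivative is the Laplacian. -/
theorem four_mul_D_Db_apply (g : SmoothFn) (z : ℂ) : 4 * (D (Db g) : ℂ → ℂ) z =
    fderiv ℝ (fderiv ℝ (g : ℂ → ℂ)) z 1 1 +
      fderiv ℝ (fderiv ℝ (g : ℂ → ℂ)) z Complex.I Complex.I := by
  rw [D_apply, dz, fderiv_Db, fderiv_Db, g.fderiv_fderiv_symm z 1 Complex.I]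
  linear_combination (-(fderiv ℝ (fderiv ℝ (g : ℂ → ℂ)) z Complex.I Complex.I)) * Complex.I_sq

theorem D_Db (g : SmoothFn) : D (Db g) = Db (D g) := by
  refine ext_eval fun z => ?_
  have h : 4 * (Db (D g) : ℂ → ℂ) z = fderiv ℝ (fderiv ℝ (g : ℂ → ℂ)) z 1 1 +
      fderiv ℝ (fderiv ℝ (g : ℂ → ℂ)) z Complex.I Complex.I := by
    rw [Db_apply, fderiv_D, fderiv_D, g.fderiv_fderiv_symm z 1 Complex.I]
    linear_combination (-(fderiv ℝ (fderiv ℝ (g : ℂ → ℂ)) z Complex.I Complex.I)) * Complex.I_sq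
  linear_combination (1 / 4) * (g.four_mul_D_Db_apply z) - (1 / 4) * h

theorem eq_zero_of_dense {g : SmoothFn} {s : Set ℂ} (hs : Dense s)
    (h : ∀ z ∈ s, (g : ℂ → ℂ) z = 0) : g = 0 :=
  ext_eval fun z => congrFun (Continuous.ext_on hs g.continuous continuous_const h) z

theorem mem_nonZeroDivisors {p : SmoothFn} (hp : Dense {z | (p : ℂ → ℂ) z ≠ 0}) :
    p ∈ nonZeroDivisors SmoothFn := by
  rw [mem_nonZeroDivisors_iff_right]
  intro g hg
  refine eq_zero_of_dense hp fun z hz => ?_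
  have := congrArg (eval z) hg
  rw [map_mul, map_zero] at this
  exact (mul_eq_zero.mp this).resolve_right hz

/-- The coordinate `z - a`. -/
def zeta (a : ℂ) : SmoothFn := ⟨fun z => z - a, mem_smoothAlg.mpr (contDiff_id.sub contDiff_const)⟩

@[simp] theorem zeta_apply (a z : ℂ) : (zeta a : ℂ → ℂ) z = z - a := rfl

@[simp] theorem D_zeta (a : ℂ) : D (zeta a) = 1 := by
  refine ext_eval fun z => ?_
  have h : fderiv ℝ (zeta a : ℂ → ℂ) z = ContinuousLinearMap.id ℝ ℂ :=
    ((hasFDerivAt_id z).sub_const a).fderiv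
  rw [D_apply, dz, h]
  change (1 / 2 : ℂ) * (1 - Complex.I * Complex.I) = 1
  rw [Complex.I_mul_I]; norm_num

@[simp] theorem Db_zeta (a : ℂ) : Db (zeta a) = 0 := by
  refine ext_eval fun z => ?_
  have h : fderiv ℝ (zeta a : ℂ → ℂ) z = ContinuousLinearMap.id ℝ ℂ :=
    ((hasFDerivAt_id z).sub_const a).fderiv
  rw [Db_apply, h]
  change (1 / 2 : ℂ) * (1 + Complex.I * Complex.I) = 0
  rw [Complex.I_mul_I]; norm_num

theorem zeta_mem_nonZeroDivisors (a : ℂ) : zeta a ∈ nonZeroDivisors SmoothFn := by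
  refine mem_nonZeroDivisors ?_
  have : {z | (zeta a : ℂ → ℂ) z ≠ 0} = {a}ᶜ := by ext z; simp [sub_eq_zero]
  rw [this]
  exact dense_compl_singleton a

/-! ### Jets -/

/-- The jet of all `∂_z`-derivatives at `a`. -/
def jetFun (a : ℂ) (g : SmoothFn) : PowerSeries ℂ :=
  PowerSeries.mk fun k => ((D^[k] g : SmoothFn) : ℂ → ℂ) a / (k.factorial : ℂ)

theorem derivative_jetFun (a : ℂ) (g : SmoothFn) :
    PowerSeries.derivative ℂ (jetFun a g) = jetFun a (D g) := by
  ext k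
  rw [PowerSeries.coeff_derivative, jetFun, jetFun, PowerSeries.coeff_mk, PowerSeries.coeff_mk,
    Function.iterate_succ_apply, Nat.factorial_succ]
  push_cast
  have h1 : ((k : ℂ) + 1) ≠ 0 := Nat.cast_add_one_ne_zero k
  field_simp

theorem jetFun_add (a : ℂ) (g h : SmoothFn) : jetFun a (g + h) = jetFun a g + jetFun a h := by
  ext k
  simp [jetFun, iterate_map_add, add_div]

theorem coeff_zero_jetFun (a : ℂ) (g : SmoothFn) :
    PowerSeries.coeff 0 (jetFun a g) = (g : ℂ → ℂ) a := by
  simp [jetFun]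

/-- `D` and the formal derivative obey the same Leibniz rule, and the coefficient of index k + 1 is
recovered from the coefficient of index k of the derivative. The induction therefore has to run over
all pairs of functions at once. -/
theorem coeff_jetFun_mul (a : ℂ) (k : ℕ) : ∀ g h : SmoothFn,
    PowerSeries.coeff k (jetFun a (g * h)) =
      PowerSeries.coeff k (jetFun a g * jetFun a h) := by
  induction k with
  | zero =>
    intro g h
    have := coeff_zero_jetFun a
    simp only [PowerSeries.coeff_zero_eq_constantCoeff, map_mul] at this ⊢
    simp [this]
  | succ k ih =>
    intro g h
    have h1 : ((k : ℂ) + 1) ≠ 0 := Nat.cast_add_one_ne_zero k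
    refine mul_right_cancel₀ h1 ?_
    rw [← PowerSeries.coeff_derivative, ← PowerSeries.coeff_derivative, derivative_jetFun,
      Derivation.leibniz, Derivation.leibniz, derivative_jetFun, derivative_jetFun, jetFun_add,
      smul_eq_mul, smul_eq_mul, smul_eq_mul, smul_eq_mul, map_add, map_add, ih, ih]

/-- The `∂_z`-jet at `a` as a ring homomorphism. -/
def jet (a : ℂ) : SmoothFn →+* PowerSeries ℂ where
  toFun := jetFun a
  map_one' := by
    ext k
    cases k with
    | zero => rw [coeff_zero_jetFun]; simp
    | succ k =>
      have h1 : ((k : ℂ) + 1) ≠ 0 := Nat.cast_add_one_ne_zero k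
      refine mul_right_cancel₀ h1 ?_
      rw [← PowerSeries.coeff_derivative, ← PowerSeries.coeff_derivative, derivative_jetFun]
      simp [jetFun, iterate_map_zero]
  map_mul' g h := by ext k; exact coeff_jetFun_mul a k g h
  map_zero' := by ext k; simp [jetFun, iterate_map_zero]
  map_add' := jetFun_add a

theorem jet_D (a : ℂ) (g : SmoothFn) : jet a (D g) = PowerSeries.derivative ℂ (jet a g) :=
  (derivative_jetFun a g).symm

@[simp] theorem constantCoeff_jet (a : ℂ) (g : SmoothFn) :
    PowerSeries.constantCoeff (jet a g) = (g : ℂ → ℂ) a := by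
  rw [← PowerSeries.coeff_zero_eq_constantCoeff_apply]; exact coeff_zero_jetFun a g

/-- The jet of all `∂_{z̄}`-derivatives at `a`. -/
def jetb (a : ℂ) : SmoothFn →+* PowerSeries ℂ :=
  (PowerSeries.map (starRingEnd ℂ)).comp ((jet a).comp conj)

theorem jetb_def (a : ℂ) (g : SmoothFn) :
    jetb a g = PowerSeries.map (starRingEnd ℂ) (jet a (conj g)) := rfl

theorem jetb_Db (a : ℂ) (g : SmoothFn) :
    jetb a (Db g) = PowerSeries.derivative ℂ (jetb a g) := by
  rw [jetb_def, jetb_def, conj_Db, jet_D]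
  ext k
  simp [PowerSeries.coeff_derivative]

@[simp] theorem constantCoeff_jetb (a : ℂ) (g : SmoothFn) :
    PowerSeries.constantCoeff (jetb a g) = (g : ℂ → ℂ) a := by
  rw [← PowerSeries.coeff_zero_eq_constantCoeff_apply, jetb_def, PowerSeries.coeff_map,
    PowerSeries.coeff_zero_eq_constantCoeff_apply]
  simp

theorem jetb_eq_zero_iff (a : ℂ) (g : SmoothFn) : jetb a g = 0 ↔ jet a (conj g) = 0 := by
  rw [jetb_def]
  constructor
  · intro h
    ext k
    have := congrArg (PowerSeries.coeff k) h
    simpa using this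
  · intro h
    rw [h, map_zero]

/-- A power series is determined by its constant coefficient and its derivative. -/
theorem powerSeries_eq_zero {X : PowerSeries ℂ} (h0 : PowerSeries.constantCoeff X = 0)
    (h1 : PowerSeries.derivative ℂ X = 0) : X = 0 := by
  ext k
  cases k with
  | zero => simpa using h0
  | succ k =>
    have h := congrArg (PowerSeries.coeff k) h1
    rw [PowerSeries.coeff_derivative, map_zero] at h
    exact (mul_eq_zero.mp h).resolve_right (Nat.cast_add_one_ne_zero k)

/-- The two jets treat z - a asymmetrically: `jetb a` kills it and `jet a` does not. So applying
`jetb a` to an equation discards all multiples of z - a, which is how divisibility by z - a is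
detected below. -/
theorem jetb_zeta (a : ℂ) : jetb a (zeta a) = 0 :=
  powerSeries_eq_zero (by simp) (by rw [← jetb_Db, Db_zeta, map_zero])

theorem jet_zeta_ne_zero (a : ℂ) : jet a (zeta a) ≠ 0 := by
  intro h
  have := congrArg (PowerSeries.derivative ℂ) h
  rw [← jet_D, D_zeta, map_one, map_zero] at this
  exact one_ne_zero this

theorem jet_ne_zero_of_apply {a : ℂ} {g : SmoothFn} (h : (g : ℂ → ℂ) a ≠ 0) : jet a g ≠ 0 := by
  intro h0
  apply h
  rw [← constantCoeff_jet, h0, map_zero]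

end SmoothFn

/-! ### Division by `z - a` -/

open MeasureTheory in
theorem hasFDerivAt_intervalIntegral {E : Type} [NormedAddCommGroup E] [NormedSpace ℝ E]
    [CompleteSpace E] {F : ℂ → ℝ → E} {F' : ℂ → ℝ → ℂ →L[ℝ] E}
    (hF : Continuous (Function.uncurry F)) (hF' : Continuous (Function.uncurry F'))
    (h : ∀ z t, HasFDerivAt (fun x => F x t) (F' z t) z) (z : ℂ) :
    HasFDerivAt (fun x => ∫ t in (0 : ℝ)..1, F x t) (∫ t in (0 : ℝ)..1, F' z t) z := by
  obtain ⟨C, hC⟩ := ((isCompact_closedBall z 1).prod (isCompact_Icc (a := (0 : ℝ)) (b := 1))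
    ).exists_bound_of_continuousOn hF'.continuousOn
  refine intervalIntegral.hasFDerivAt_integral_of_dominated_of_fderiv_le (bound := fun _ => C)
    (Metric.closedBall_mem_nhds z one_pos) (Filter.Eventually.of_forall fun x => ?_) ?_ ?_ ?_ ?_ ?_
  · exact (hF.comp (by fun_prop : Continuous fun t : ℝ => (x, t))).aestronglyMeasurable
  · exact (hF.comp (by fun_prop : Continuous fun t : ℝ => (z, t))).intervalIntegrable _ _
  · exact (hF'.comp (by fun_prop : Continuous fun t : ℝ => (z, t))).aestronglyMeasurable
  · refine Filter.Eventually.of_forall fun t ht x hx => hC (x, t) ⟨hx, ?_⟩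
    rw [Set.uIoc_of_le zero_le_one] at ht
    exact ⟨ht.1.le, ht.2⟩
  · exact intervalIntegrable_const
  · exact Filter.Eventually.of_forall fun t _ x _ => h x t

/-- The target space varies in the induction because the derivative in the parameter is an integral
of the same kind with values in `ℂ →L[ℝ] E`. -/
theorem contDiff_nat_intervalIntegral (k : ℕ) : ∀ {E : Type} [NormedAddCommGroup E]
    [NormedSpace ℝ E] [CompleteSpace E] {F : ℂ → ℝ → E},
    ContDiff ℝ ∞ (Function.uncurry F) →
      ContDiff ℝ (k : ℕ) fun z => ∫ t in (0 : ℝ)..1, F z t := by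
  induction k with
  | zero =>
    intro E _ _ _ F hF
    exact contDiff_zero.mpr
      (intervalIntegral.continuous_parametric_intervalIntegral_of_continuous' hF.continuous 0 1)
  | succ k ih =>
    intro E _ _ _ F hF
    set F' : ℂ → ℝ → ℂ →L[ℝ] E := fun z t =>
      (fderiv ℝ (Function.uncurry F) (z, t)).comp (ContinuousLinearMap.inl ℝ ℂ ℝ) with hF'
    have hF's : ContDiff ℝ ∞ (Function.uncurry F') :=
      (hF.fderiv_right (m := ∞) (by simp)).clm_comp contDiff_const
    have hd : ∀ z t, HasFDerivAt (fun x => F x t) (F' z t) z := fun z t => by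
      have h1 : HasFDerivAt (fun x : ℂ => (x, t)) (ContinuousLinearMap.inl ℝ ℂ ℝ) z :=
        hasFDerivAt_prodMk_left z t
      exact ((hF.differentiable (by simp) (z, t)).hasFDerivAt).comp z h1
    have hi := hasFDerivAt_intervalIntegral hF.continuous hF's.continuous hd
    rw [Nat.cast_succ, contDiff_succ_iff_fderiv]
    refine ⟨fun z => (hi z).differentiableAt, by simp, ?_⟩
    rw [show fderiv ℝ (fun z => ∫ t in (0 : ℝ)..1, F z t) = fun z => ∫ t in (0 : ℝ)..1, F' z t from
      funext fun z => (hi z).fderiv]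
    exact ih hF's

namespace SmoothFn

/-- The mean of `g` over the segment from `a` to `z`. -/
def radialMean (a : ℂ) (g : SmoothFn) : SmoothFn :=
  ⟨fun z => ∫ t in (0 : ℝ)..1, (g : ℂ → ℂ) (a + t * (z - a)), by
    refine mem_smoothAlg.mpr (contDiff_infty.mpr fun k => contDiff_nat_intervalIntegral k
      (F := fun z t => (g : ℂ → ℂ) (a + t * (z - a))) ?_)
    refine g.contDiff.comp (contDiff_const.add (ContDiff.mul ?_ ?_))
    · exact Complex.ofRealCLM.contDiff.comp contDiff_snd
    · exact contDiff_fst.sub contDiff_const⟩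

theorem radialMean_apply (a : ℂ) (g : SmoothFn) (z : ℂ) :
    (radialMean a g : ℂ → ℂ) z = ∫ t in (0 : ℝ)..1, (g : ℂ → ℂ) (a + t * (z - a)) := rfl

/-- Hadamard's lemma. -/
theorem eq_add_zeta_mul (a : ℂ) (g : SmoothFn) :
    g = algebraMap ℂ SmoothFn ((g : ℂ → ℂ) a) + zeta a * radialMean a (D g) +
      conj (zeta a) * radialMean a (Db g) := by
  refine ext_eval fun z => ?_
  change (g : ℂ → ℂ) z = (g : ℂ → ℂ) a + (z - a) * (radialMean a (D g) : ℂ → ℂ) z +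
    starRingEnd ℂ (z - a) * (radialMean a (Db g) : ℂ → ℂ) z
  rw [radialMean_apply, radialMean_apply]
  have hc : Continuous fun t : ℝ => a + (t : ℂ) * (z - a) := by fun_prop
  have hd : ∀ t : ℝ, HasDerivAt (fun t : ℝ => (g : ℂ → ℂ) (a + t * (z - a)))
      ((z - a) * (D g : ℂ → ℂ) (a + t * (z - a)) +
        starRingEnd ℂ (z - a) * (Db g : ℂ → ℂ) (a + t * (z - a))) t := fun t => by
    have h1 : HasDerivAt (fun t : ℝ => a + (t : ℂ) * (z - a)) (z - a) t := by
      simpa using ((Complex.ofRealCLM.hasDerivAt (x := t)).mul_const (z - a)).const_add a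
    have h2 := (g.differentiable (a + t * (z - a))).hasFDerivAt.comp_hasDerivAt t h1
    rw [fderiv_apply_eq] at h2
    refine h2.congr_deriv ?_
    ring
  have c1 : Continuous fun t : ℝ => (D g : ℂ → ℂ) (a + t * (z - a)) := (D g).continuous.comp hc
  have c2 : Continuous fun t : ℝ => (Db g : ℂ → ℂ) (a + t * (z - a)) := (Db g).continuous.comp hc
  have := intervalIntegral.integral_eq_sub_of_hasDerivAt (a := 0) (b := 1) (fun t _ => hd t)
    (((continuous_const.mul c1).add (continuous_const.mul c2)).intervalIntegrable _ _)
  have i1 : IntervalIntegrable (fun t : ℝ => (z - a) * (D g : ℂ → ℂ) (a + t * (z - a)))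
    MeasureTheory.volume 0 1 := (continuous_const.mul c1).intervalIntegrable _ _
  have i2 : IntervalIntegrable (fun t : ℝ => starRingEnd ℂ (z - a) *
    (Db g : ℂ → ℂ) (a + t * (z - a))) MeasureTheory.volume 0 1 :=
    (continuous_const.mul c2).intervalIntegrable _ _
  rw [intervalIntegral.integral_add i1 i2, intervalIntegral.integral_const_mul,
    intervalIntegral.integral_const_mul] at this
  rw [add_assoc, this]
  simp

/-- Hadamard's lemma is applied repeatedly to the remainder. `jetb a` kills the multiple of z - a in
the expansion of B, and the jet of the conjugate coordinate is non-zero in a domain. Hence the new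
remainder again has zero ∂̄-jet. -/
theorem exists_eq_zeta_mul_add {a : ℂ} {g : SmoothFn} (hg : jetb a g = 0) (N : ℕ) :
    ∃ A B : SmoothFn, jetb a B = 0 ∧ g = zeta a * A + conj (zeta a) ^ N * B := by
  induction N with
  | zero => exact ⟨0, g, hg, by simp⟩
  | succ N ih =>
    obtain ⟨A, B, hB, h⟩ := ih
    have hB0 : (B : ℂ → ℂ) a = 0 := by rw [← constantCoeff_jetb, hB, map_zero]
    have hH := eq_add_zeta_mul a B
    rw [hB0, map_zero, zero_add] at hH
    refine ⟨A + conj (zeta a) ^ N * radialMean a (D B), radialMean a (Db B), ?_, ?_⟩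
    · have := congrArg (jetb a) hH
      rw [hB, map_add, map_mul, map_mul, jetb_zeta, zero_mul, zero_add] at this
      refine (mul_eq_zero.mp this.symm).resolve_left ?_
      rw [jetb_eq_zero_iff, conj_conj]
      exact jet_zeta_ne_zero a
    · rw [h]
      nth_rewrite 1 [hH]
      ring

/-- The differential combines conj(w)^(N-1) / w^M and conj(w)^N / w^(M+1), so each differentiation
lowers N - M by one. At the origin the numerator vanishes, and the quotient has the value 0 there,
also when the denominator is zero. -/
theorem contDiff_conj_pow_div_pow (k : ℕ) : ∀ N M : ℕ, M + k + 1 ≤ N →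
    ContDiff ℝ (k : ℕ) fun w : ℂ => starRingEnd ℂ w ^ N / w ^ M := by
  have hnorm : ∀ N M : ℕ, M + 1 ≤ N → ∀ w : ℂ,
      ‖starRingEnd ℂ w ^ N / w ^ M‖ ≤ ‖w‖ ^ (N - M) := by
    intro N M h w
    rw [norm_div, norm_pow, norm_pow, RCLike.norm_conj]
    rcases eq_or_ne w 0 with rfl | hw
    · rw [norm_zero, zero_pow (by omega), zero_div, zero_pow (by omega)]
    · rw [div_le_iff₀ (by positivity), ← pow_add, Nat.sub_add_cancel (by omega)]
  have hder : ∀ N M : ℕ, M + 2 ≤ N → ∀ w : ℂ,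
      HasFDerivAt (𝕜 := ℝ) (fun w : ℂ => starRingEnd ℂ w ^ N / w ^ M)
        ((N * (starRingEnd ℂ w ^ (N - 1) / w ^ M)) • (Complex.conjCLE : ℂ →L[ℝ] ℂ) -
          (M * (starRingEnd ℂ w ^ N / w ^ (M + 1))) • ContinuousLinearMap.id ℝ ℂ) w := by
    intro N M h w
    rcases eq_or_ne w 0 with rfl | hw
    · have e1 : ((N * (starRingEnd ℂ 0 ^ (N - 1) / 0 ^ M)) • (Complex.conjCLE : ℂ →L[ℝ] ℂ) -
          (M * (starRingEnd ℂ 0 ^ N / 0 ^ (M + 1))) • ContinuousLinearMap.id ℝ ℂ) = 0 := by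
        rw [map_zero, zero_pow (by omega), zero_pow (M₀ := ℂ) (n := N) (by omega)]
        refine ContinuousLinearMap.ext fun v => ?_
        simp
      rw [e1]
      refine .of_isLittleO ?_
      have hb : (fun w : ℂ => starRingEnd ℂ w ^ N / w ^ M) =O[nhds 0] fun w => ‖w‖ ^ 2 := by
        refine Asymptotics.IsBigO.of_bound 1 ?_
        filter_upwards [Metric.ball_mem_nhds (0 : ℂ) one_pos] with w hw
        rw [Metric.mem_ball, dist_zero_right] at hw
        rw [one_mul, Real.norm_of_nonneg (by positivity)]
        exact (hnorm N M (by omega) w).trans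
          (pow_le_pow_of_le_one (norm_nonneg _) hw.le (by omega))
      have h0 : starRingEnd ℂ 0 ^ N / 0 ^ M = (0 : ℂ) := by
        rw [map_zero, zero_pow (by omega), zero_div]
      simp only [h0, sub_zero, zero_apply]
      refine hb.trans_isLittleO ?_
      have := (Asymptotics.isLittleO_norm_pow_id (E' := ℂ) one_lt_two)
      simpa using this
    · have h1 : HasFDerivAt (fun w : ℂ => starRingEnd ℂ w) (Complex.conjCLE : ℂ →L[ℝ] ℂ) w :=
        (Complex.conjCLE : ℂ →L[ℝ] ℂ).hasFDerivAt
      have h2 : HasFDerivAt (𝕜 := ℝ) (fun w : ℂ => (w ^ M)⁻¹)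
          ((-(M * w ^ (M - 1)) / (w ^ M) ^ 2) • ContinuousLinearMap.id ℝ ℂ) w := by
        refine (((hasDerivAt_pow M w).fun_inv (pow_ne_zero M hw)).hasFDerivAt.restrictScalars
          ℝ).congr_fderiv (ContinuousLinearMap.ext fun v => ?_)
        simp [mul_comm]
      have h3 := (h1.pow N).mul h2
      rw [show (fun w : ℂ => starRingEnd ℂ w ^ N / w ^ M) =
        (fun w => starRingEnd ℂ w ^ N) * fun w => (w ^ M)⁻¹ from
          funext fun w => div_eq_mul_inv _ _]
      refine h3.congr_fderiv (ContinuousLinearMap.ext fun v => ?_)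
      rcases M with _ | M
      · simp
      · simp
        field_simp
        ring
  induction k with
  | zero =>
    intro N M h
    refine contDiff_zero.mpr (continuous_iff_continuousAt.mpr fun w => ?_)
    rcases eq_or_ne w 0 with rfl | hw
    · have h0 : starRingEnd ℂ 0 ^ N / 0 ^ M = (0 : ℂ) := by
        rw [map_zero, zero_pow (by omega), zero_div]
      rw [ContinuousAt, h0]
      refine squeeze_zero_norm (hnorm N M h) ?_
      have : Filter.Tendsto (fun w : ℂ => ‖w‖ ^ (N - M)) (nhds 0) (nhds (‖(0 : ℂ)‖ ^ (N - M))) :=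
        (continuous_norm.pow _).tendsto 0
      rwa [norm_zero, zero_pow (by omega)] at this
    · exact (Complex.continuous_conj.continuousAt.pow N).div (continuousAt_id.pow M)
        (pow_ne_zero M hw)
  | succ k ih =>
    intro N M h
    rw [Nat.cast_succ, contDiff_succ_iff_fderiv]
    refine ⟨fun w => (hder N M (by omega) w).differentiableAt, by simp, ?_⟩
    rw [funext fun w => (hder N M (by omega) w).fderiv]
    exact ((contDiff_const.mul (ih (N - 1) M (by omega))).smul contDiff_const).sub
      ((contDiff_const.mul (ih N (M + 1) (by omega))).smul contDiff_const)

/-- A smooth function whose `∂_{z̄}`-jet at `a` vanishes is divisible by `z - a`. -/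
theorem exists_eq_zeta_mul {a : ℂ} {g : SmoothFn} (hg : jetb a g = 0) :
    ∃ h : SmoothFn, g = zeta a * h := by
  -- Dividing the expansion of order N by z - a gives a function of class C^(N-2). Off the point a
  -- it equals g / (z - a), whatever N is. By continuity all these functions coincide, so the
  -- quotient is of every finite class.
  choose A B hB hAB using exists_eq_zeta_mul_add hg
  set q : ℕ → ℂ → ℂ := fun N z => (A N : ℂ → ℂ) z +
    starRingEnd ℂ (z - a) ^ N / (z - a) ^ 1 * (B N : ℂ → ℂ) z with hq
  have hs : ∀ k, ContDiff ℝ (k : ℕ) (q (k + 2)) := fun k =>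
    ((A _).contDiff.of_le (by exact_mod_cast le_top)).add
      (((contDiff_conj_pow_div_pow k (k + 2) 1 (by omega)).comp
        (contDiff_id.sub contDiff_const)).mul ((B _).contDiff.of_le (by exact_mod_cast le_top)))
  have hval : ∀ N z, (g : ℂ → ℂ) z = (z - a) * (A N : ℂ → ℂ) z +
      starRingEnd ℂ (z - a) ^ N * (B N : ℂ → ℂ) z := fun N z => by
    conv_lhs => rw [hAB N]
    rfl
  have hoff : ∀ N z, z ≠ a → q N z = (g : ℂ → ℂ) z / (z - a) := fun N z hz => by
    have hz' : z - a ≠ 0 := sub_ne_zero.mpr hz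
    rw [hval N z, hq]
    field_simp
  have heq : ∀ k, q (k + 2) = q 2 := fun k =>
    Continuous.ext_on (dense_compl_singleton a) (hs k).continuous (hs 0).continuous
      fun z hz => by rw [hoff _ z hz, hoff _ z hz]
  refine ⟨⟨q 2, mem_smoothAlg.mpr (contDiff_infty.mpr fun k => heq k ▸ hs k)⟩,
    ext_eval fun z => ?_⟩
  change (g : ℂ → ℂ) z = (z - a) * q 2 z
  rcases eq_or_ne z a with rfl | hz
  · rw [sub_self, zero_mul, hval 1 z]
    simp
  · rw [hoff 2 z hz, mul_div_cancel₀ _ (sub_ne_zero.mpr hz)]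

end SmoothFn

/-! ### Smooth functions with prescribed zeros -/

namespace SmoothFn

/-- A cutoff near the origin. -/
def cutoff : ContDiffBump (0 : ℂ) := ⟨1 / 2, 3 / 4, by norm_num, by norm_num⟩

/-- A nowhere vanishing function that agrees with `1 / (1 - w)` near the origin. -/
def convergenceFactor (w : ℂ) : ℂ := Complex.exp (-((cutoff w : ℝ) : ℂ) * Complex.log (1 - w))

/-- For |w| < 1 the logarithm is taken in the slit plane. Beyond radius 3/4 the cutoff vanishes and
the function is constantly 1. The two regions overlap. -/
theorem contDiff_convergenceFactor : ContDiff ℝ ∞ convergenceFactor := by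
  refine contDiff_iff_contDiffAt.mpr fun w => ?_
  rcases lt_or_ge ‖w‖ 1 with hw | hw
  · have hs : 1 - w ∈ Complex.slitPlane := by
      refine Or.inl ?_
      have := (Complex.re_le_norm w).trans_lt hw
      simpa using this
    have h1 : ContDiffAt ℝ ∞ (fun w : ℂ => Complex.log (1 - w)) w :=
      ((Complex.contDiffAt_log hs).restrict_scalars ℝ).comp w
        (contDiffAt_const.sub contDiffAt_id)
    have h2 : ContDiffAt ℝ ∞ (fun w : ℂ => ((cutoff w : ℝ) : ℂ)) w :=
      Complex.ofRealCLM.contDiff.contDiffAt.comp w cutoff.contDiffAt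
    exact (h2.neg.mul h1).cexp
  · have h : ∀ᶠ y in nhds w, convergenceFactor y = 1 := by
      have ho : IsOpen {y : ℂ | 3 / 4 < ‖y‖} := isOpen_lt continuous_const continuous_norm
      filter_upwards [ho.mem_nhds (show (3 / 4 : ℝ) < ‖w‖ by linarith)] with y hy
      have : cutoff y = 0 := cutoff.zero_of_le_dist (by
        rw [dist_zero_right]; exact le_of_lt hy)
      simp [convergenceFactor, this]
    exact contDiffAt_const.congr_of_eventuallyEq h

theorem one_sub_mul_convergenceFactor {w : ℂ} (hw : ‖w‖ ≤ 1 / 2) :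
    (1 - w) * convergenceFactor w = 1 := by
  have h1 : cutoff w = 1 := cutoff.one_of_mem_closedBall (by
    rw [Metric.mem_closedBall, dist_zero_right]; exact hw)
  have h2 : 1 - w ≠ 0 := by
    intro h
    rw [sub_eq_zero] at h
    rw [← h] at hw
    norm_num at hw
  rw [convergenceFactor, h1, Complex.ofReal_one, neg_one_mul, Complex.exp_neg, Complex.exp_log h2,
    mul_inv_cancel₀ h2]

/-- A nowhere vanishing function whose product with `z - a` is `1` for `‖z‖ ≤ ‖a‖ / 2`. -/
def elementaryUnit (a : ℂ) : SmoothFn :=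
  if a = 0 then 1 else
    ⟨fun z => -a⁻¹ * convergenceFactor (z * a⁻¹),
      mem_smoothAlg.mpr (contDiff_const.mul
        (contDiff_convergenceFactor.comp (contDiff_id.mul contDiff_const)))⟩

theorem elementaryUnit_ne_zero (a z : ℂ) : (elementaryUnit a : ℂ → ℂ) z ≠ 0 := by
  unfold elementaryUnit
  split_ifs with h
  · exact one_ne_zero
  · exact mul_ne_zero (neg_ne_zero.mpr (inv_ne_zero h)) (Complex.exp_ne_zero _)

/-- A function whose only zero is a simple one at `a`, and which is `1` for `‖z‖ ≤ ‖a‖ / 2`. -/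
def elementaryFactor (a : ℂ) : SmoothFn := zeta a * elementaryUnit a

theorem elementaryFactor_ne_zero {a z : ℂ} (h : z ≠ a) : (elementaryFactor a : ℂ → ℂ) z ≠ 0 :=
  mul_ne_zero (sub_ne_zero.mpr h) (elementaryUnit_ne_zero a z)

theorem elementaryFactor_eq_one {a z : ℂ} (ha : a ≠ 0) (h : 2 * ‖z‖ ≤ ‖a‖) :
    (elementaryFactor a : ℂ → ℂ) z = 1 := by
  have h1 : ‖z * a⁻¹‖ ≤ 1 / 2 := by
    rw [norm_mul, norm_inv, ← div_eq_mul_inv, div_le_iff₀ (norm_pos_iff.mpr ha)]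
    linarith
  change (z - a) * (elementaryUnit a : ℂ → ℂ) z = 1
  rw [elementaryUnit, if_neg ha]
  change (z - a) * (-a⁻¹ * convergenceFactor (z * a⁻¹)) = 1
  rw [← one_sub_mul_convergenceFactor h1]
  field_simp
  ring

/-- The product of elementary factors with given multiplicities. -/
def zeroProd (m : ℂ → ℕ) (z : ℂ) : ℂ := ∏ᶠ a, (elementaryFactor a : ℂ → ℂ) z ^ m a

/-- On a disc of radius r only the factors with |a| ≤ 2r differ from 1. The product is thus locally
finite, and no question of convergence arises. -/
theorem mulSupport_zeroProd_subset (m : ℂ → ℕ) {z : ℂ} {R : ℝ} (hR : 2 * ‖z‖ ≤ R) :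
    (Function.mulSupport fun a => (elementaryFactor a : ℂ → ℂ) z ^ m a) ⊆
      {a | ‖a‖ ≤ R ∧ m a ≠ 0} := by
  intro a ha
  rw [Function.mem_mulSupport] at ha
  refine ⟨?_, fun h => ha (by rw [h, pow_zero])⟩
  by_contra h
  rw [not_le] at h
  refine ha ?_
  rw [elementaryFactor_eq_one _ (by linarith), one_pow]
  rintro rfl
  rw [norm_zero] at h
  have := norm_nonneg z
  linarith

theorem contDiff_zeroProd {m : ℂ → ℕ} (hm : ∀ R : ℝ, {a | ‖a‖ ≤ R ∧ m a ≠ 0}.Finite) :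
     ContDiff ℝ ∞ (zeroProd m) := by
  refine contDiff_iff_contDiffAt.mpr fun w => ?_
  have h : ∀ᶠ z in nhds w, zeroProd m z =
      ((∏ a ∈ (hm (2 * ‖w‖ + 2)).toFinset, elementaryFactor a ^ m a : SmoothFn) : ℂ → ℂ) z := by
    filter_upwards [Metric.ball_mem_nhds w one_pos] with z hz
    have h1 : 2 * ‖z‖ ≤ 2 * ‖w‖ + 2 := by
      have := norm_sub_norm_le z w
      rw [Metric.mem_ball, dist_eq_norm] at hz
      linarith
    rw [← eval_apply, map_prod]
    simp only [map_pow, eval_apply]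
    refine finprod_eq_prod_of_mulSupport_subset _ ?_
    rw [Set.Finite.coe_toFinset]
    exact mulSupport_zeroProd_subset m h1
  exact (SmoothFn.contDiff _).contDiffAt.congr_of_eventuallyEq h

theorem finite_mulSupport_zeroProd {m : ℂ → ℕ} (hm : ∀ R : ℝ, {a | ‖a‖ ≤ R ∧ m a ≠ 0}.Finite) (z : ℂ) :
    (Function.mulSupport fun a => (elementaryFactor a : ℂ → ℂ) z ^ m a).Finite :=
  (hm _).subset (mulSupport_zeroProd_subset m le_rfl)

theorem finite_update {m : ℂ → ℕ} (hm : ∀ R : ℝ, {a | ‖a‖ ≤ R ∧ m a ≠ 0}.Finite) (b : ℂ) (R : ℝ) : {a | ‖a‖ ≤ R ∧ Function.update m b 0 a ≠ 0}.Finite := by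
  refine (hm R).subset fun a ha => ⟨ha.1, fun h => ha.2 ?_⟩
  rcases eq_or_ne a b with rfl | hab
  · simp
  · rw [Function.update_of_ne hab, h]

theorem zeroProd_eq_mul {m : ℂ → ℕ} (hm : ∀ R : ℝ, {a | ‖a‖ ≤ R ∧ m a ≠ 0}.Finite) (b z : ℂ) : zeroProd m z =
    (elementaryFactor b : ℂ → ℂ) z ^ m b * zeroProd (Function.update m b 0) z := by
  have h : ∀ a, (elementaryFactor a : ℂ → ℂ) z ^ m a =
      (if a = b then (elementaryFactor b : ℂ → ℂ) z ^ m b else 1) *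
        (elementaryFactor a : ℂ → ℂ) z ^ Function.update m b 0 a := by
    intro a
    rcases eq_or_ne a b with rfl | hab
    · simp
    · simp [hab]
  rw [zeroProd, finprod_congr h, finprod_mul_distrib _
    (finite_mulSupport_zeroProd (finite_update hm b) z), finprod_eq_single _ b]
  · simp [zeroProd]
  · intro a ha
    rw [if_neg ha]
  · refine (Set.finite_singleton b).subset fun a ha => ?_
    by_contra hab
    exact ha (if_neg hab)

theorem zeroProd_update_ne_zero (m : ℂ → ℕ) (b : ℂ) : zeroProd (Function.update m b 0) b ≠ 0 := by
  refine finprod_induction (p := fun x : ℂ => x ≠ 0) one_ne_zero (fun _ _ => mul_ne_zero)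
    fun a => ?_
  rcases eq_or_ne a b with rfl | hab
  · simp
  · exact pow_ne_zero _ (elementaryFactor_ne_zero hab.symm)

theorem exists_factor_zeroProd {m : ℂ → ℕ} (hm : ∀ R : ℝ, {a | ‖a‖ ≤ R ∧ m a ≠ 0}.Finite) (b : ℂ) : ∃ e : SmoothFn, (e : ℂ → ℂ) b ≠ 0 ∧
    (⟨zeroProd m, mem_smoothAlg.mpr (contDiff_zeroProd hm)⟩ : SmoothFn) = zeta b ^ m b * e := by
  refine ⟨elementaryUnit b ^ m b *
    ⟨_, mem_smoothAlg.mpr (contDiff_zeroProd (finite_update hm b))⟩, ?_, ?_⟩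
  · rw [← eval_apply, map_mul, map_pow]
    exact mul_ne_zero (pow_ne_zero _ (elementaryUnit_ne_zero b b)) (zeroProd_update_ne_zero m b)
  · rw [← mul_assoc, ← mul_pow]
    refine ext_eval fun z => ?_
    rw [← eval_apply, ← eval_apply, map_mul, map_pow]
    exact zeroProd_eq_mul hm b z

/-- Near a, some component is a power of z - a times a non-vanishing function, so a is the only
possible common zero there. Compactness of the disc then gives finiteness. -/
theorem finite_zeros {ι : Type*} {x : ι → SmoothFn}
    (hx : ∀ a, ∃ m : ℕ, ∃ g : ι → SmoothFn, (∃ i, (g i : ℂ → ℂ) a ≠ 0) ∧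
      ∀ i, x i = zeta a ^ m * g i) (R : ℝ) :
    {a : ℂ | ‖a‖ ≤ R ∧ ∀ i, (x i : ℂ → ℂ) a = 0}.Finite := by
  have h : ∀ a : ℂ, ∃ U ∈ nhds a, ∀ z ∈ U, (∀ i, (x i : ℂ → ℂ) z = 0) → z = a := by
    intro a
    obtain ⟨m, g, ⟨i, hi⟩, hg⟩ := hx a
    refine ⟨_, (g i).continuous.continuousAt.eventually_ne hi, fun z hz h0 => ?_⟩
    have h1 := h0 i
    rw [hg i, ← eval_apply, map_mul, map_pow] at h1
    have h2 := eq_zero_of_pow_eq_zero ((mul_eq_zero.mp h1).resolve_right hz)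
    simpa [sub_eq_zero] using h2
  choose U hU hUz using h
  obtain ⟨t, -, ht⟩ := (isCompact_closedBall (0 : ℂ) R).elim_nhds_subcover U fun a _ => hU a
  refine t.finite_toSet.subset fun a ha => ?_
  have := ht (show a ∈ Metric.closedBall 0 R by simpa using ha.1)
  simp only [Set.mem_iUnion] at this
  obtain ⟨b, hb, hab⟩ := this
  rw [hUz b a hab ha.2]
  exact hb

/-- A family of smooth functions whose common zeros are of finite holomorphic order is a smooth
multiple of a family without common zeros. -/
theorem exists_eq_mul_of_zeros {ι : Type*} {x : ι → SmoothFn}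
    (hx : ∀ a, ∃ m : ℕ, ∃ g : ι → SmoothFn, (∃ i, (g i : ℂ → ℂ) a ≠ 0) ∧
      ∀ i, x i = zeta a ^ m * g i) :
    ∃ (c : SmoothFn) (g : ι → SmoothFn), (∀ i, x i = c * g i) ∧
      (∀ a, ∃ i, (g i : ℂ → ℂ) a ≠ 0) ∧
      ∀ a, ∃ (m : ℕ) (e : SmoothFn), (e : ℂ → ℂ) a ≠ 0 ∧ c = zeta a ^ m * e := by
  have hfin := finite_zeros hx
  choose m g hg hxg using hx
  have hm : ∀ R : ℝ, {a | ‖a‖ ≤ R ∧ m a ≠ 0}.Finite := fun R =>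
    (hfin R).subset fun a ha => ⟨ha.1, fun i => by
      rw [hxg a i, ← eval_apply, map_mul, map_pow]
      simp [zero_pow ha.2]⟩
  set c : SmoothFn := ⟨zeroProd m, mem_smoothAlg.mpr (contDiff_zeroProd hm)⟩ with hc
  have hfac := exists_factor_zeroProd hm
  rw [← hc] at hfac
  choose e he hce using hfac
  -- At each point z the quotient x i / c is computed from the factorizations centred at z itself,
  -- which gives the correct value at the zeros too. Near a it agrees with g a i / e a, and this is
  -- smooth.
  set q : ι → ℂ → ℂ := fun i z => (g z i : ℂ → ℂ) z / (e z : ℂ → ℂ) z with hq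
  have hval : ∀ a i z, (x i : ℂ → ℂ) z = (z - a) ^ m a * (g a i : ℂ → ℂ) z := fun a i z => by
    conv_lhs => rw [hxg a i]
    rfl
  have hcval : ∀ a z, (c : ℂ → ℂ) z = (z - a) ^ m a * (e a : ℂ → ℂ) z := fun a z => by
    conv_lhs => rw [hce a]
    rfl
  have hmul : ∀ i z, (x i : ℂ → ℂ) z = (c : ℂ → ℂ) z * q i z := fun i z => by
    rw [hval z i z, hcval z z, hq, mul_assoc, mul_div_cancel₀ _ (he z)]
  have hsmooth : ∀ i, ContDiff ℝ ∞ (q i) := fun i => by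
    refine contDiff_iff_contDiffAt.mpr fun a => ?_
    have h : ∀ᶠ z in nhds a, q i z = (g a i : ℂ → ℂ) z / (e a : ℂ → ℂ) z := by
      filter_upwards [(e a).continuous.continuousAt.eventually_ne (he a)] with z hz
      rcases eq_or_ne z a with rfl | hza
      · rfl
      · have hz' : (z - a) ^ m a ≠ 0 := pow_ne_zero _ (sub_ne_zero.mpr hza)
        have h1 := hmul i z
        rw [hval a i z, hcval a z, mul_assoc] at h1
        rw [mul_left_cancel₀ hz' h1, mul_div_cancel_left₀ _ hz]
    simp only [div_eq_mul_inv] at h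
    exact ((g a i).contDiff.contDiffAt.mul ((e a).contDiff.contDiffAt.inv (he a))
      ).congr_of_eventuallyEq h
  refine ⟨c, fun i => ⟨q i, mem_smoothAlg.mpr (hsmooth i)⟩, fun i => ext_eval (hmul i),
    fun a => ?_, fun a => ⟨m a, e a, he a, hce a⟩⟩
  obtain ⟨i, hi⟩ := hg a
  exact ⟨i, div_ne_zero hi (he a)⟩

end SmoothFn

/-! ### Algebra of the Minkowski product over a ring with a derivation -/

section Form

variable {n : ℕ} {R : Type*} [CommRing R]

theorem form_apply (x y : Fin (2 * n + 1) → R) :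
    form x y = ∑ i, (if i = Fin.last (2 * n) then -1 else 1) * (x i * y i) := by
  simp only [form, upsilon, dotProduct, Matrix.mulVec_diagonal]
  exact Finset.sum_congr rfl fun i _ => by ring

theorem form_comm (x y : Fin (2 * n + 1) → R) : form x y = form y x := by
  simp only [form_apply, mul_comm (x _)]

theorem form_add_left (x y z : Fin (2 * n + 1) → R) : form (x + y) z = form x z + form y z :=
  add_dotProduct _ _ _

theorem form_sub_left (x y z : Fin (2 * n + 1) → R) : form (x - y) z = form x z - form y z :=
  sub_dotProduct _ _ _

theorem form_smul_left (c : R) (x z : Fin (2 * n + 1) → R) : form (c • x) z = c * form x z :=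
  smul_dotProduct _ _ _

@[simp] theorem form_zero_left (z : Fin (2 * n + 1) → R) : form 0 z = 0 := zero_dotProduct _

theorem form_add_right (x y z : Fin (2 * n + 1) → R) : form z (x + y) = form z x + form z y := by
  simp only [form_comm z, form_add_left]

theorem form_sub_right (x y z : Fin (2 * n + 1) → R) : form z (x - y) = form z x - form z y := by
  simp only [form_comm z, form_sub_left]

theorem form_smul_right (c : R) (x z : Fin (2 * n + 1) → R) : form z (c • x) = c * form z x := by
  simp only [form_comm z, form_smul_left]

@[simp] theorem form_zero_right (z : Fin (2 * n + 1) → R) : form z 0 = 0 := by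
  rw [form_comm, form_zero_left]

theorem form_sum_left {ι : Type*} (s : Finset ι) (x : ι → Fin (2 * n + 1) → R)
    (z : Fin (2 * n + 1) → R) : form (∑ i ∈ s, x i) z = ∑ i ∈ s, form (x i) z :=
  sum_dotProduct _ _ _

theorem form_sum_right {ι : Type*} (s : Finset ι) (x : ι → Fin (2 * n + 1) → R)
    (z : Fin (2 * n + 1) → R) : form z (∑ i ∈ s, x i) = ∑ i ∈ s, form z (x i) := by
  simp only [form_comm z, form_sum_left]

end Form

/-- A ring homomorphism applied to every coordinate. -/
def vmap {ι R S : Type*} [CommRing R] [CommRing S] (φ : R →+* S) : (ι → R) →+ (ι → S) where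
  toFun x i := φ (x i)
  map_zero' := funext fun _ => map_zero φ
  map_add' _ _ := funext fun _ => map_add φ _ _

@[simp] theorem vmap_apply {ι R S : Type*} [CommRing R] [CommRing S] (φ : R →+* S) (x : ι → R)
    (i : ι) : vmap φ x i = φ (x i) := rfl

theorem vmap_smul {ι R S : Type*} [CommRing R] [CommRing S] (φ : R →+* S) (p : R) (x : ι → R) :
    vmap φ (p • x) = φ p • vmap φ x := funext fun _ => map_mul φ _ _

theorem map_form {n : ℕ} {R S : Type*} [CommRing R] [CommRing S] (φ : R →+* S)
    (x y : Fin (2 * n + 1) → R) : φ (form x y) = form (vmap φ x) (vmap φ y) := by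
  simp only [form_apply, map_sum, map_mul, vmap_apply]
  refine Finset.sum_congr rfl fun i _ => ?_
  split_ifs <;> simp

/-- A derivation applied to every coordinate. -/
def vder {ι R : Type*} [CommRing R] [Algebra ℂ R] (δ : Derivation ℂ R R) :
    (ι → R) →ₗ[ℂ] (ι → R) :=
  (δ : R →ₗ[ℂ] R).compLeft ι

section Derivation

variable {ι R : Type*} [CommRing R] [Algebra ℂ R] (δ : Derivation ℂ R R)

@[simp] theorem vder_apply (x : ι → R) (i : ι) : vder δ x i = δ (x i) := rfl

theorem vder_smul (p : R) (x : ι → R) : vder δ (p • x) = p • vder δ x + δ p • x := by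
  funext i
  simp [mul_comm (x i)]

theorem derivation_form {n : ℕ} (x y : Fin (2 * n + 1) → R) :
    δ (form x y) = form (vder δ x) y + form x (vder δ y) := by
  have h : ∀ i : Fin (2 * n + 1), δ (if i = Fin.last (2 * n) then (-1 : R) else 1) = 0 := by
    intro i
    split_ifs <;> simp
  simp only [form_apply, map_sum, Derivation.leibniz, h, smul_zero, add_zero, vder_apply,
    ← Finset.sum_add_distrib]
  refine Finset.sum_congr rfl fun i _ => ?_
  simp only [smul_eq_mul]
  ring

end Derivation

/-! ### Spans up to regular multiples -/

section Saturation

variable {ι R : Type*} [CommRing R]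

/-- The vectors that have a regular multiple in the span of `s`. -/
def satSpan (s : Set (ι → R)) : Submodule R (ι → R) where
  carrier := {x | ∃ p ∈ nonZeroDivisors R, p • x ∈ Submodule.span R s}
  zero_mem' := ⟨1, one_mem _, by simp⟩
  add_mem' := by
    rintro x y ⟨p, hp, hx⟩ ⟨q, hq, hy⟩
    refine ⟨p * q, mul_mem hp hq, ?_⟩
    rw [smul_add, mul_smul, mul_comm p q, mul_smul, smul_comm p q, ← mul_smul, mul_comm q p,
      mul_smul, smul_comm p q]
    refine Submodule.add_mem _ (Submodule.smul_mem _ _ hx) ?_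
    rw [smul_comm q p]
    exact Submodule.smul_mem _ _ hy
  smul_mem' := by
    rintro c x ⟨p, hp, hx⟩
    exact ⟨p, hp, by rw [smul_comm]; exact Submodule.smul_mem _ _ hx⟩

theorem span_le_satSpan (s : Set (ι → R)) : Submodule.span R s ≤ satSpan s :=
  fun x hx => ⟨1, one_mem _, by simpa using hx⟩

theorem subset_satSpan (s : Set (ι → R)) : s ⊆ satSpan s :=
  Submodule.subset_span.trans (span_le_satSpan s)

theorem mem_satSpan_of_smul {s : Set (ι → R)} {p : R} (hp : p ∈ nonZeroDivisors R) {x : ι → R}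
    (h : p • x ∈ satSpan s) : x ∈ satSpan s := by
  obtain ⟨q, hq, h⟩ := h
  exact ⟨q * p, mul_mem hq hp, by rwa [mul_smul]⟩

theorem satSpan_le {s t : Set (ι → R)} (h : s ⊆ satSpan t) : satSpan s ≤ satSpan t := by
  rintro x ⟨p, hp, hx⟩
  exact mem_satSpan_of_smul hp (Submodule.span_le.mpr h hx)

theorem form_eq_zero_of_mem_satSpan {n : ℕ} {s : Set (Fin (2 * n + 1) → R)}
    {w x : Fin (2 * n + 1) → R} (h : ∀ y ∈ s, form w y = 0) (hx : x ∈ satSpan s) :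
    form w x = 0 := by
  obtain ⟨p, hp, hx⟩ := hx
  have key : ∀ y ∈ Submodule.span R s, form w y = 0 := by
    intro y hy
    induction hy using Submodule.span_induction with
    | mem y hy => exact h y hy
    | zero => exact form_zero_right w
    | add y z _ _ hy hz => rw [form_add_right, hy, hz, add_zero]
    | smul c y _ hy => rw [form_smul_right, hy, mul_zero]
  have h1 := key _ hx
  rw [form_smul_right] at h1
  exact (mul_left_mem_nonZeroDivisors_eq_zero_iff hp).mp h1

end Saturation

/-! ### Spans of successive derivatives -/

section JetSpan

variable {ι R : Type*} [CommRing R] [Algebra ℂ R] (δ : Derivation ℂ R R)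

/-- If p • x is a combination of s, then so is its derivative modulo the target, and the extra term
δ p • x already lies in the target. Hence p • vder δ x does, and p is cancelled by saturation. -/
theorem vder_mem_satSpan {s t : Set (ι → R)} (h : s ⊆ satSpan t)
    (h' : ∀ x ∈ s, vder δ x ∈ satSpan t) {x : ι → R} (hx : x ∈ satSpan s) :
    vder δ x ∈ satSpan t := by
  obtain ⟨p, hp, hx'⟩ := hx
  have key : ∀ y ∈ Submodule.span R s, vder δ y ∈ satSpan t := by
    intro y hy
    induction hy using Submodule.span_induction with
    | mem y hy => exact h' y hy
    | zero => rw [map_zero]; exact zero_mem _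
    | add y z _ _ hy hz => rw [map_add]; exact add_mem hy hz
    | smul c y hy hy' =>
      rw [vder_smul]
      exact add_mem (Submodule.smul_mem _ _ hy')
        (Submodule.smul_mem _ _ (Submodule.span_le.mpr h hy))
  have h1 := key _ hx'
  rw [vder_smul] at h1
  refine mem_satSpan_of_smul hp ?_
  have h2 := (Submodule.add_mem_iff_left (p := satSpan t)
    (x := p • vder δ x) (y := δ p • x)
    (Submodule.smul_mem _ _ (satSpan_le h ⟨p, hp, hx'⟩))).mp h1
  exact h2

/-- The saturated span of the first `k` derivatives of `A`. -/
def jetSpan (A : ι → R) (k : ℕ) : Submodule R (ι → R) :=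
  satSpan {x | ∃ i, 1 ≤ i ∧ i ≤ k ∧ x = (vder δ)^[i] A}

theorem iterate_mem_jetSpan (A : ι → R) {i k : ℕ} (h1 : 1 ≤ i) (h2 : i ≤ k) :
    (vder δ)^[i] A ∈ jetSpan δ A k :=
  subset_satSpan _ ⟨i, h1, h2, rfl⟩

theorem jetSpan_mono (A : ι → R) {k l : ℕ} (h : k ≤ l) : jetSpan δ A k ≤ jetSpan δ A l :=
  satSpan_le (by rintro _ ⟨i, h1, h2, rfl⟩; exact iterate_mem_jetSpan δ A h1 (h2.trans h))

theorem vder_mem_jetSpan (A : ι → R) {k : ℕ} {x : ι → R} (hx : x ∈ jetSpan δ A k) :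
    vder δ x ∈ jetSpan δ A (k + 1) := by
  refine vder_mem_satSpan δ ?_ ?_ hx
  · rintro _ ⟨i, h1, h2, rfl⟩
    exact iterate_mem_jetSpan δ A h1 (by omega)
  · rintro _ ⟨i, h1, h2, rfl⟩
    rw [← Function.iterate_succ_apply' (vder δ)]
    exact iterate_mem_jetSpan δ A (by omega) (by omega)

theorem form_eq_zero_of_mem_jetSpan {n : ℕ} {A w x : Fin (2 * n + 1) → R} {k : ℕ}
    (h : ∀ i, 1 ≤ i → i ≤ k → form w ((vder δ)^[i] A) = 0) (hx : x ∈ jetSpan δ A k) :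
    form w x = 0 :=
  form_eq_zero_of_mem_satSpan (by rintro _ ⟨i, h1, h2, rfl⟩; exact h i h1 h2) hx

/-- If one derivative depends on the previous ones, so do all later ones. -/
theorem iterate_mem_jetSpan_of_mem (A : ι → R) {k : ℕ}
    (h : (vder δ)^[k + 1] A ∈ jetSpan δ A k) (l : ℕ) (hl : k + 1 ≤ l) :
    (vder δ)^[l] A ∈ jetSpan δ A k := by
  induction l, hl using Nat.le_induction with
  | base => exact h
  | succ l hl ih =>
    rw [Function.iterate_succ_apply']
    refine satSpan_le ?_ (vder_mem_jetSpan δ A ih)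
    rintro _ ⟨i, h1, h2, rfl⟩
    rcases Nat.lt_or_ge i (k + 1) with hi | hi
    · exact iterate_mem_jetSpan δ A h1 (by omega)
    · rw [show i = k + 1 by omega]
      exact h

end JetSpan

namespace SmoothFn

/-! ### Harmonic sequences over the ring of smooth functions -/

section Vectors

variable {ι : Type*}

instance : SMul SmoothFn (ι → SmoothFn) := Pi.instSMul

instance : Module SmoothFn (ι → SmoothFn) := Pi.module _ _ _

/-- Complex conjugation of vectors of smooth functions. -/
abbrev cj : (ι → SmoothFn) →+ (ι → SmoothFn) := vmap conj

/-- `∂_z` of vectors of smooth functions. -/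
abbrev dv : (ι → SmoothFn) →ₗ[ℂ] (ι → SmoothFn) := vder D

/-- `∂_{z̄}` of vectors of smooth functions. -/
abbrev dbv : (ι → SmoothFn) →ₗ[ℂ] (ι → SmoothFn) := vder Db

@[simp] theorem cj_cj (x : ι → SmoothFn) : cj (cj x) = x := funext fun _ => conj_conj _

theorem cj_dv (x : ι → SmoothFn) : cj (dv x) = dbv (cj x) := funext fun _ => conj_D _

theorem cj_dbv (x : ι → SmoothFn) : cj (dbv x) = dv (cj x) := funext fun _ => conj_Db _

theorem dv_dbv (x : ι → SmoothFn) : dv (dbv x) = dbv (dv x) := funext fun _ => D_Db _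

theorem iterate_dv_dbv (k : ℕ) (x : ι → SmoothFn) : dv^[k] (dbv x) = dbv (dv^[k] x) := by
  induction k with
  | zero => rfl
  | succ k ih => rw [Function.iterate_succ_apply', Function.iterate_succ_apply', ih, dv_dbv]

end Vectors

variable {n : ℕ}

theorem conj_form (x y : Fin (2 * n + 1) → SmoothFn) :
    conj (form x y) = form (cj x) (cj y) := map_form _ _ _

/-- `‖x‖²` for a vector of smooth functions. -/
def hsq (x : Fin (2 * n + 1) → SmoothFn) : SmoothFn := form x (cj x)

theorem conj_hsq (x : Fin (2 * n + 1) → SmoothFn) : conj (hsq x) = hsq x := by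
  rw [hsq, conj_form, cj_cj, form_comm]

/-- A harmonic map into de Sitter space, in terms of the ring of smooth functions. -/
structure IsHarmonicVec (f : Fin (2 * n + 1) → SmoothFn) : Prop where
  real : cj f = f
  norm : form f f = 1
  harm : dv (dbv f) = -(hsq (dv f)) • f

/-- Vanishing of the products of derivatives of total order at most `2n - 1`. -/
def IsIsotropicVec (f : Fin (2 * n + 1) → SmoothFn) : Prop :=
  ∀ a b : ℕ, 1 ≤ a + b → a + b ≤ 2 * n - 1 → form (dv^[a] f) (dv^[b] f) = 0

/-- The square `⟨∂^n f, ∂^n f⟩` of the first non-isotropic derivative. -/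
def topSquare (f : Fin (2 * n + 1) → SmoothFn) : SmoothFn := form (dv^[n] f) (dv^[n] f)

/-- The entries `s 0, …, s n` of the harmonic sequence of `f`. -/
structure IsHarmonicSeq (f : Fin (2 * n + 1) → SmoothFn)
    (s : ℕ → Fin (2 * n + 1) → SmoothFn) : Prop where
  zero : s 0 = f
  succ : ∀ j < n, hsq (s j) • s (j + 1) =
    hsq (s j) • dv (s j) - form (dv (s j)) (cj (s j)) • s j
  regular : ∀ j < n, hsq (s j) ∈ nonZeroDivisors SmoothFn

theorem smul_vec_cancel {ι : Type*} {p : SmoothFn} (hp : p ∈ nonZeroDivisors SmoothFn)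
    {x y : ι → SmoothFn} (h : p • x = p • y) : x = y :=
  funext fun i => (mul_cancel_left_mem_nonZeroDivisors hp).mp (congrFun h i)

theorem mul_eq_zero_cancel {p x : SmoothFn} (hp : p ∈ nonZeroDivisors SmoothFn)
    (h : p * x = 0) : x = 0 :=
  (mul_left_mem_nonZeroDivisors_eq_zero_iff hp).mp h

/-! ### Holomorphy of the first non-isotropic product -/

section Isotropy

variable {f : Fin (2 * n + 1) → SmoothFn}

/-- Harmonicity makes ∂̄∂f a multiple of f. Differentiating this k times in z, and commuting ∂̄ with
∂, leaves only derivatives of order at most k. -/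
theorem dbv_iterate_mem (hf : IsHarmonicVec f) (k : ℕ) :
    dbv (dv^[k + 1] f) ∈ Submodule.span SmoothFn {x | ∃ i ≤ k, x = dv^[i] f} := by
  rw [← iterate_dv_dbv]
  induction k with
  | zero =>
    rw [zero_add, Function.iterate_one, hf.harm]
    exact Submodule.smul_mem _ _ (Submodule.subset_span ⟨0, le_rfl, rfl⟩)
  | succ k ih =>
    rw [Function.iterate_succ_apply']
    refine Submodule.span_induction (p := fun x _ => dv x ∈ Submodule.span SmoothFn
      {x | ∃ i ≤ k + 1, x = dv^[i] f}) ?_ ?_ ?_ ?_ ih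
    · rintro _ ⟨i, hi, rfl⟩
      exact Submodule.subset_span ⟨i + 1, by omega, (Function.iterate_succ_apply' _ _ _).symm⟩
    · rw [map_zero]; exact zero_mem _
    · intro x y _ _ hx hy
      rw [map_add]; exact add_mem hx hy
    · intro c x hx h
      rw [vder_smul]
      refine add_mem (Submodule.smul_mem _ _ h) (Submodule.smul_mem _ _ ?_)
      refine Submodule.span_mono ?_ hx
      rintro _ ⟨i, hi, rfl⟩
      exact ⟨i, by omega, rfl⟩

/-- ∂̄∂^n f is a combination of f, …, ∂^{n-1} f, and isotropy makes all of these orthogonal to ∂^n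
f. -/
theorem Db_topSquare (hn : 1 ≤ n) (hf : IsHarmonicVec f) (hi : IsIsotropicVec f) :
    Db (topSquare f) = 0 := by
  have h : form (dv^[n] f) (dbv (dv^[n] f)) = 0 := by
    obtain ⟨k, rfl⟩ : ∃ k, n = k + 1 := ⟨n - 1, by omega⟩
    refine form_eq_zero_of_mem_satSpan ?_ (span_le_satSpan _ (dbv_iterate_mem hf k))
    rintro _ ⟨i, hik, rfl⟩
    exact hi _ _ (by omega) (by omega)
  rw [topSquare, derivation_form, form_comm, h, add_zero]

end Isotropy

/-! ### Orthogonality relations of the harmonic sequence -/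

section Sequence

variable {f : Fin (2 * n + 1) → SmoothFn} {s : ℕ → Fin (2 * n + 1) → SmoothFn}

theorem IsHarmonicVec.hsq_eq_one (hf : IsHarmonicVec f) : hsq f = 1 := by
  rw [hsq, hf.real, hf.norm]

theorem form_dv_self (hf : form f f = 1) : form (dv f) f = 0 := by
  have h := derivation_form D f f
  rw [hf, form_comm f, Derivation.map_one_eq_zero] at h
  have h2 : (2 : SmoothFn) * form (dv f) f = 0 := by rw [two_mul]; exact h.symm
  have h3 := congrArg (fun g => algebraMap ℂ SmoothFn (1 / 2) * g) h2
  simp only [mul_zero, ← mul_assoc] at h3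
  rwa [show (2 : SmoothFn) = algebraMap ℂ SmoothFn 2 from (map_ofNat _ 2).symm, ← map_mul,
    show (1 / 2 * 2 : ℂ) = 1 by norm_num, map_one, one_mul] at h3

theorem IsHarmonicSeq.one (hn : 1 ≤ n) (hf : IsHarmonicVec f) (hs : IsHarmonicSeq f s) :
    s 1 = dv f := by
  have h := hs.succ 0 hn
  rw [hs.zero, hf.real, form_dv_self hf.norm, hf.hsq_eq_one] at h
  simpa using h

/-- Up to a regular factor, a Gram-Schmidt step changes the derivative of an entry only by a
multiple of that entry. So each entry equals the corresponding derivative of f modulo derivatives of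
lower positive order. -/
theorem sub_iterate_mem (hn : 1 ≤ n) (hf : IsHarmonicVec f) (hs : IsHarmonicSeq f s) (j : ℕ)
    (hj : j + 1 ≤ n) : s (j + 1) - dv^[j + 1] f ∈ jetSpan D f j := by
  induction j with
  | zero =>
    rw [zero_add, hs.one hn hf, Function.iterate_one, sub_self]
    exact zero_mem _
  | succ j ih =>
    specialize ih (by omega)
    have h1 : s (j + 1) ∈ jetSpan D f (j + 1) := by
      have := add_mem (jetSpan_mono D f (Nat.le_succ j) ih)
        (iterate_mem_jetSpan D f (show 1 ≤ j + 1 by omega) (le_refl (j + 1)))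
      rwa [sub_add_cancel] at this
    refine mem_satSpan_of_smul (hs.regular (j + 1) (by omega)) ?_
    have h2 : hsq (s (j + 1)) • (s (j + 1 + 1) - dv^[j + 1 + 1] f) =
        hsq (s (j + 1)) • dv (s (j + 1) - dv^[j + 1] f) -
          form (dv (s (j + 1))) (cj (s (j + 1))) • s (j + 1) := by
      rw [smul_sub, hs.succ (j + 1) (by omega), map_sub, smul_sub,
        Function.iterate_succ_apply' _ (j + 1)]
      abel
    rw [h2]
    exact sub_mem (Submodule.smul_mem _ _ (vder_mem_jetSpan D f ih)) (Submodule.smul_mem _ _ h1)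

theorem seq_mem_jetSpan (hn : 1 ≤ n) (hf : IsHarmonicVec f) (hs : IsHarmonicSeq f s) {j : ℕ}
    (h1 : 1 ≤ j) (hj : j ≤ n) : s j ∈ jetSpan D f j := by
  obtain ⟨k, rfl⟩ : ∃ k, j = k + 1 := ⟨j - 1, by omega⟩
  have := add_mem (jetSpan_mono D f (Nat.le_succ k) (sub_iterate_mem hn hf hs k hj))
    (iterate_mem_jetSpan D f (show 1 ≤ k + 1 by omega) (le_refl (k + 1)))
  rwa [sub_add_cancel] at this

/-- Entries of positive index lie in the saturated span of derivatives of f of no higher order, so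
isotropy is inherited from the derivatives. Index 0 is separate because `jetSpan` does not contain f
itself. -/
theorem form_seq_seq (hn : 1 ≤ n) (hf : IsHarmonicVec f) (hi : IsIsotropicVec f)
    (hs : IsHarmonicSeq f s) {j k : ℕ} (hj : j ≤ n) (hk : k ≤ n) (h1 : 1 ≤ j + k)
    (h2 : j + k ≤ 2 * n - 1) : form (s j) (s k) = 0 := by
  have key : ∀ i l, 1 ≤ l → l ≤ n → 1 ≤ i + l → i + l ≤ 2 * n - 1 →
      form (dv^[i] f) (s l) = 0 := fun i l h1 hl h2 h3 =>
    form_eq_zero_of_mem_jetSpan D (fun m _ _ => hi i m (by omega) (by omega))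
      (seq_mem_jetSpan hn hf hs h1 hl)
  rcases Nat.eq_zero_or_pos j with rfl | hj'
  · rw [hs.zero]
    exact key 0 k (by omega) hk h1 h2
  rcases Nat.eq_zero_or_pos k with rfl | hk'
  · rw [hs.zero, form_comm]
    exact key 0 j (by omega) hj (by omega) (by omega)
  refine form_eq_zero_of_mem_jetSpan D (fun m _ _ => ?_) (seq_mem_jetSpan hn hf hs hk' hk)
  rw [form_comm]
  exact key m j hj' hj (by omega) (by omega)

/-- The harmonic sequence is orthogonal for the Hermitian product, and `∂_{z̄}` leads back to
the previous entry. -/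
theorem seq_orthogonal (hn : 1 ≤ n) (hf : IsHarmonicVec f) (hi : IsIsotropicVec f)
    (hs : IsHarmonicSeq f s) (j : ℕ) (hj : j ≤ n) :
    (∀ i < j, form (s j) (cj (s i)) = 0) ∧
      ∀ k, j = k + 1 → hsq (s k) • dbv (s j) = -hsq (s j) • s k := by
  induction j using Nat.strong_induction_on with
  | _ j ih =>
  rcases j with _ | j
  · exact ⟨by simp, by simp⟩
  rcases j with _ | j
  · rw [zero_add, hs.one hn hf]
    refine ⟨fun i hi => ?_, fun k hk => ?_⟩
    · rw [show i = 0 by omega, hs.zero, hf.real, form_dv_self hf.norm]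
    · rw [show k = 0 by omega, hs.zero, hf.hsq_eq_one, one_smul, ← dv_dbv, hf.harm]
  obtain ⟨ho, hd⟩ := ih (j + 1) (by omega) (by omega)
  specialize hd j rfl
  have hreg := hs.regular (j + 1) (by omega)
  have hreg0 := hs.regular j (by omega)
  have hsucc := hs.succ (j + 1) (by omega)
  have hsucc0 := hs.succ j (by omega)
  set T := form (dv (s (j + 1))) (cj (s (j + 1))) with hT
  set T0 := form (dv (s j)) (cj (s j)) with hT0
  have horth : ∀ i < j + 1 + 1, form (s (j + 1 + 1)) (cj (s i)) = 0 := by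
    intro i hij
    refine mul_eq_zero_cancel hreg ?_
    rw [← form_smul_left, hsucc, form_sub_left, form_smul_left, form_smul_left]
    rcases Nat.lt_or_ge i (j + 1) with h | h
    · rw [ho i h, mul_zero, sub_zero]
      have h1 := derivation_form D (s (j + 1)) (cj (s i))
      rw [ho i h, map_zero] at h1
      -- ∂ of the conjugate of s i is the conjugate of ∂̄ (s i), by induction proportional to the
      -- conjugate of s (i - 1). For i = 0 it is s 1, and the bilinear isotropy applies instead.
      have h2 : form (s (j + 1)) (dv (cj (s i))) = 0 := by
        rw [← cj_dbv]
        rcases i with _ | i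
        · rw [hs.zero, cj_dbv, hf.real, ← hs.one hn hf]
          exact form_seq_seq hn hf hi hs (by omega) (by omega) (by omega) (by omega)
        · have h3 := (ih (i + 1) (by omega) (by omega)).2 i rfl
          refine mul_eq_zero_cancel (hs.regular i (by omega)) ?_
          rw [← form_smul_right, ← conj_hsq, ← vmap_smul, h3, vmap_smul, form_smul_right,
            ho i (by omega), mul_zero]
      rw [h2, add_zero] at h1
      rw [← h1, mul_zero]
    · rw [show i = j + 1 by omega, ← hT, ← hsq]
      ring
  refine ⟨horth, fun k hk => ?_⟩
  obtain rfl : k = j + 1 := by omega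
  -- Applying ∂̄ to the Gram-Schmidt relation and commuting it with ∂ places ∂̄ (s (j + 2)) in the
  -- saturated span of s (j + 1) and s j. The two coefficients are then found by pairing with the
  -- conjugates of these entries: the one along s j vanishes.
  set Q : Set (Fin (2 * n + 1) → SmoothFn) := {s (j + 1), s j} with hQ
  have m1 : s (j + 1) ∈ satSpan Q := subset_satSpan _ (by simp [hQ])
  have m0 : s j ∈ satSpan Q := subset_satSpan _ (by simp [hQ])
  have mdb : dbv (s (j + 1)) ∈ satSpan Q :=
    mem_satSpan_of_smul hreg0 (by rw [hd]; exact Submodule.smul_mem _ _ m0)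
  have md0 : dv (s j) ∈ satSpan Q := by
    refine mem_satSpan_of_smul hreg0 ?_
    rw [show hsq (s j) • dv (s j) = hsq (s j) • s (j + 1) + T0 • s j by rw [hsucc0]; abel]
    exact add_mem (Submodule.smul_mem _ _ m1) (Submodule.smul_mem _ _ m0)
  have mddb : dv (dbv (s (j + 1))) ∈ satSpan Q := by
    refine mem_satSpan_of_smul hreg0 ?_
    have h1 := congrArg dv hd
    rw [vder_smul, vder_smul] at h1
    rw [eq_sub_of_add_eq h1]
    exact sub_mem (add_mem (Submodule.smul_mem _ _ md0) (Submodule.smul_mem _ _ m0))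
      (Submodule.smul_mem _ _ mdb)
  have my : dbv (s (j + 1 + 1)) ∈ satSpan Q := by
    refine mem_satSpan_of_smul hreg ?_
    have h1 := congrArg dbv hsucc
    rw [vder_smul, map_sub, vder_smul, vder_smul, ← dv_dbv] at h1
    have h2 : s (j + 1 + 1) - dv (s (j + 1)) ∈ satSpan Q := by
      refine mem_satSpan_of_smul hreg ?_
      rw [smul_sub, hsucc, sub_sub_cancel_left]
      exact neg_mem (Submodule.smul_mem _ _ m1)
    have h3 : hsq (s (j + 1)) • dbv (s (j + 1 + 1)) =
        hsq (s (j + 1)) • dv (dbv (s (j + 1))) -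
          Db (hsq (s (j + 1))) • (s (j + 1 + 1) - dv (s (j + 1))) -
          (T • dbv (s (j + 1)) + Db T • s (j + 1)) := by
      rw [eq_sub_of_add_eq h1, smul_sub]
      abel
    rw [h3]
    exact sub_mem (sub_mem (Submodule.smul_mem _ _ mddb) (Submodule.smul_mem _ _ h2))
      (add_mem (Submodule.smul_mem _ _ mdb) (Submodule.smul_mem _ _ m1))
  obtain ⟨p, hp, hy⟩ := my
  obtain ⟨α, β, hαβ⟩ := Submodule.mem_span_pair.mp hy
  have hder : ∀ i < j + 1 + 1, form (dbv (s (j + 1 + 1))) (cj (s i)) =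
      -form (s (j + 1 + 1)) (cj (dv (s i))) := fun i hij => by
    have h1 := derivation_form Db (s (j + 1 + 1)) (cj (s i))
    rw [horth i hij, map_zero] at h1
    rw [cj_dv]
    exact eq_neg_of_add_eq_zero_left h1.symm
  have e0 : form (s (j + 1 + 1)) (cj (dv (s j))) = 0 := by
    refine mul_eq_zero_cancel hreg0 ?_
    rw [← form_smul_right, ← conj_hsq, ← vmap_smul,
      show hsq (s j) • dv (s j) = hsq (s j) • s (j + 1) + T0 • s j by rw [hsucc0]; abel,
      map_add, vmap_smul, vmap_smul, form_add_right, form_smul_right, form_smul_right,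
      horth j (by omega), horth (j + 1) (by omega), mul_zero, mul_zero, add_zero]
  have e1 : form (s (j + 1 + 1)) (cj (dv (s (j + 1)))) = hsq (s (j + 1 + 1)) := by
    refine (mul_cancel_left_mem_nonZeroDivisors hreg).mp ?_
    rw [← form_smul_right, ← conj_hsq, ← vmap_smul,
      show hsq (s (j + 1)) • dv (s (j + 1)) =
        hsq (s (j + 1)) • s (j + 1 + 1) + T • s (j + 1) by rw [hsucc]; abel,
      map_add, vmap_smul, vmap_smul, form_add_right, form_smul_right, form_smul_right,
      horth (j + 1) (by omega), mul_zero, add_zero, conj_hsq, ← hsq]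
  have o10 : form (s j) (cj (s (j + 1))) = 0 := by
    have := congrArg conj (ho j (by omega))
    rwa [conj_form, cj_cj, map_zero, form_comm] at this
  have hβ : β = 0 := by
    have h1 := congrArg (fun x => form x (cj (s j))) hαβ
    simp only [form_add_left, form_smul_left, ho j (by omega), hder j (by omega), e0] at h1
    rw [← hsq, mul_zero, zero_add, neg_zero, mul_zero, mul_comm] at h1
    exact mul_eq_zero_cancel hreg0 h1
  have hα : α * hsq (s (j + 1)) = -p * hsq (s (j + 1 + 1)) := by
    have h1 := congrArg (fun x => form x (cj (s (j + 1)))) hαβ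
    simp only [form_add_left, form_smul_left, hder (j + 1) (by omega), e1, o10] at h1
    rw [← hsq, mul_zero, add_zero] at h1
    rw [h1]; ring
  refine smul_vec_cancel hp (funext fun i => ?_)
  have h1 := congrFun hαβ i
  simp only [Pi.add_apply, Pi.smul_apply, smul_eq_mul, hβ] at h1 ⊢
  linear_combination (-hsq (s (j + 1))) * h1 + s (j + 1) i * hα

end Sequence

end SmoothFn

/-! ### Isotropic subspaces -/

theorem upsilon_det {n : ℕ} {K : Type*} [Field K] : (upsilon n K).det ≠ 0 := by
  rw [upsilon, Matrix.det_diagonal]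
  refine Finset.prod_ne_zero_iff.mpr fun i _ => ?_
  split_ifs
  · exact neg_ne_zero.mpr one_ne_zero
  · exact one_ne_zero

/-- In dimension `2n + 1` an `n`-dimensional isotropic subspace is not orthogonal to two
orthogonal non-isotropic vectors. -/
theorem false_of_isotropic {n : ℕ} {K ι : Type*} [Field K] [Fintype ι] (hι : Fintype.card ι = n)
    {y : ι → Fin (2 * n + 1) → K} (hy : LinearIndependent K y) (hyy : ∀ i j, form (y i) (y j) = 0)
    {a b : Fin (2 * n + 1) → K} (ha : ∀ i, form a (y i) = 0) (hb : ∀ i, form b (y i) = 0)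
    (hab : form a b = 0) (haa : form a a ≠ 0) (hbb : form b b ≠ 0) : False := by
  classical
  set B : LinearMap.BilinForm K (Fin (2 * n + 1) → K) := Matrix.toBilin' (upsilon n K) with hB
  have hBf : ∀ x z, B x z = form x z := fun x z => by
    rw [hB, Matrix.toBilin'_apply']; rfl
  have hnd : B.Nondegenerate := LinearMap.BilinForm.nondegenerate_toBilin'_of_det_ne_zero' _
    upsilon_det
  set W := Submodule.span K (Set.range y) with hW
  have hWd : Module.finrank K W = n := by rw [hW, finrank_span_eq_card hy, hι]
  -- The orthogonal complement of the span of y has dimension n + 1, but it contains the n + 2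
  -- independent vectors y, a, b.
  have hperp := LinearMap.BilinForm.finrank_orthogonal hnd W
  rw [hWd, Module.finrank_fintype_fun_eq_card, Fintype.card_fin] at hperp
  have hmem : ∀ x, (∀ i, form x (y i) = 0) → x ∈ B.orthogonal W := by
    intro x hx
    rw [LinearMap.BilinForm.mem_orthogonal_iff]
    intro w hw
    rw [hBf]
    refine Submodule.span_induction (p := fun w _ => form w x = 0) ?_ (form_zero_left _) ?_ ?_ hw
    · rintro _ ⟨i, rfl⟩
      rw [form_comm]; exact hx i
    · intro u v _ _ hu hv
      rw [form_add_left, hu, hv, add_zero]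
    · intro c u _ hu
      rw [form_smul_left, hu, mul_zero]
  have hli : LinearIndependent K (Sum.elim y ![a, b]) := by
    rw [Fintype.linearIndependent_iff] at hy ⊢
    intro c hc
    rw [Fintype.sum_sum_type, Fin.sum_univ_two] at hc
    simp only [Sum.elim_inl, Sum.elim_inr, Matrix.cons_val_zero, Matrix.cons_val_one] at hc
    have h0 : c (Sum.inr 0) = 0 := by
      have := congrArg (form a) hc
      rw [form_add_right, form_add_right, form_sum_right, form_smul_right, form_smul_right, hab,
        form_zero_right] at this
      simp only [form_smul_right, ha, mul_zero, Finset.sum_const_zero, zero_add, add_zero] at this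
      exact (mul_eq_zero.mp this).resolve_right haa
    have h1 : c (Sum.inr 1) = 0 := by
      have := congrArg (form b) hc
      rw [form_add_right, form_add_right, form_sum_right, form_smul_right, form_smul_right,
        form_comm b a, hab, form_zero_right] at this
      simp only [form_smul_right, hb, mul_zero, Finset.sum_const_zero, zero_add] at this
      exact (mul_eq_zero.mp this).resolve_right hbb
    rw [h0, h1, zero_smul, zero_smul, add_zero, add_zero] at hc
    rintro (i | i)
    · exact hy (fun i => c (Sum.inl i)) hc i
    · fin_cases i
      · exact h0
      · exact h1
  have hle : Submodule.span K (Set.range (Sum.elim y ![a, b])) ≤ B.orthogonal W := by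
    rw [Submodule.span_le]
    rintro _ ⟨i | i, rfl⟩
    · exact hmem _ fun j => hyy i j
    · fin_cases i
      · exact hmem _ ha
      · exact hmem _ hb
  have h1 := Submodule.finrank_mono hle
  rw [finrank_span_eq_card hli, hperp, Fintype.card_sum, hι, Fintype.card_fin] at h1
  omega

/-! ### Isotropic curves over a differential domain -/

section Domain

variable {R : Type*} [CommRing R] [Algebra ℂ R] (δ : Derivation ℂ R R) {n : ℕ}
  {A G : Fin (2 * n + 1) → R}

/-- A dependence at order k + 1 would propagate to order n. The n-th derivative would then be a
combination of derivatives orthogonal to it, hence orthogonal to itself. -/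
theorem iterate_notMem_jetSpan
    (hA : ∀ a b : ℕ, 1 ≤ a + b → a + b ≤ 2 * n - 1 → form ((vder δ)^[a] A) ((vder δ)^[b] A) = 0)
    (htop : form ((vder δ)^[n] A) ((vder δ)^[n] A) ≠ 0) {k : ℕ} (hk : k + 1 ≤ n) :
    (vder δ)^[k + 1] A ∉ jetSpan δ A k := by
  intro h
  exact htop (form_eq_zero_of_mem_jetSpan δ (fun i _ _ => hA n i (by omega) (by omega))
    (iterate_mem_jetSpan_of_mem δ A h n hk))

theorem sum_mem_jetSpan (α : ℕ → R) (k : ℕ) :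
    ∑ i ∈ Finset.range k, α i • (vder δ)^[i + 1] A ∈ jetSpan δ A k :=
  Submodule.sum_mem _ fun i hi => Submodule.smul_mem _ _
    (iterate_mem_jetSpan δ A (by omega) (by have := Finset.mem_range.mp hi; omega))

/-- The top coefficient is removed first. If γ = 0, the relation contradicts independence of the
derivatives. Otherwise γ times the differentiated relation minus δ γ times the relation eliminates
the constant vector G, and expresses the derivative of order k + 2 through earlier ones. This extra
order accounts for the bound m + 1 ≤ n. -/
theorem coeff_eq_zero_of_sum [IsDomain R]
    (hA : ∀ a b : ℕ, 1 ≤ a + b → a + b ≤ 2 * n - 1 → form ((vder δ)^[a] A) ((vder δ)^[b] A) = 0)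
    (htop : form ((vder δ)^[n] A) ((vder δ)^[n] A) ≠ 0) (hG : vder δ G = 0) (γ : R) (α : ℕ → R)
    (m : ℕ) (hm : m + 1 ≤ n) (h : γ • G + ∑ i ∈ Finset.range m, α i • (vder δ)^[i + 1] A = 0) :
    ∀ i < m, α i = 0 := by
  induction m with
  | zero => simp
  | succ k ih =>
    have hk : α k = 0 := by
      by_contra hα
      set y := ∑ i ∈ Finset.range k, α i • (vder δ)^[i + 1] A with hy
      have hymem : y ∈ jetSpan δ A k := sum_mem_jetSpan δ α k
      rw [Finset.sum_range_succ, ← hy] at h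
      rcases eq_or_ne γ 0 with rfl | hγ
      · rw [zero_smul, zero_add] at h
        refine iterate_notMem_jetSpan δ hA htop (show k + 1 ≤ n by omega)
          (mem_satSpan_of_smul (mem_nonZeroDivisors_of_ne_zero hα) ?_)
        rw [eq_neg_of_add_eq_zero_right h]
        exact neg_mem hymem
      · have h' := congrArg (vder δ) h
        rw [map_add, map_add, vder_smul, vder_smul, hG, smul_zero, zero_add, map_zero,
          ← Function.iterate_succ_apply' (vder δ)] at h'
        have hx : y + α k • (vder δ)^[k + 1] A ∈ jetSpan δ A (k + 1) :=
          add_mem (jetSpan_mono δ A (Nat.le_succ k) hymem)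
            (Submodule.smul_mem _ _ (iterate_mem_jetSpan δ A (by omega) le_rfl))
        refine iterate_notMem_jetSpan δ hA htop (show k + 1 + 1 ≤ n by omega)
          (mem_satSpan_of_smul (mem_nonZeroDivisors_of_ne_zero (mul_ne_zero hγ hα)) ?_)
        have e : (γ * α k) • (vder δ)^[k + 1 + 1] A =
            δ γ • (y + α k • (vder δ)^[k + 1] A) - γ • vder δ y -
              (γ * δ (α k)) • (vder δ)^[k + 1] A := by
          funext i
          have e1 := congrFun h i
          have e2 := congrFun h' i
          simp only [Pi.add_apply, Pi.smul_apply, Pi.sub_apply, Pi.zero_apply, smul_eq_mul]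
            at e1 e2 ⊢
          linear_combination γ * e2 - δ γ * e1
        rw [e]
        exact sub_mem (sub_mem (Submodule.smul_mem _ _ hx)
          (Submodule.smul_mem _ _ (vder_mem_jetSpan δ A hymem)))
          (Submodule.smul_mem _ _ (iterate_mem_jetSpan δ A (by omega) le_rfl))
    rw [Finset.sum_range_succ, hk, zero_smul, add_zero] at h
    intro i hi
    rcases Nat.lt_succ_iff_lt_or_eq.mp hi with hi | rfl
    · exact ih (by omega) h i hi
    · exact hk

/-- A curve with the isotropy of a superconformal one is not orthogonal to a constant
isotropic vector. -/
theorem false_of_constant_isotropic [IsDomain R] (hn : 1 ≤ n) (hAA : form A A ≠ 0)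
    (hA : ∀ a b : ℕ, 1 ≤ a + b → a + b ≤ 2 * n - 1 → form ((vder δ)^[a] A) ((vder δ)^[b] A) = 0)
    (htop : form ((vder δ)^[n] A) ((vder δ)^[n] A) ≠ 0) (hG : vder δ G = 0) (hG0 : G ≠ 0)
    (hAG : form A G = 0) (hGG : form G G = 0) : False := by
  have hiG : ∀ k, form ((vder δ)^[k] A) G = 0 := by
    intro k
    induction k with
    | zero => exact hAG
    | succ k ih =>
      have h := derivation_form δ ((vder δ)^[k] A) G
      rw [ih, hG, form_zero_right, add_zero, map_zero] at h
      rw [Function.iterate_succ_apply', ← h]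
  -- The n isotropic vectors are G and the derivatives of orders 1, …, n - 1. The two non-isotropic
  -- vectors orthogonal to them are A and its n-th derivative. Independence is carried over to the
  -- fraction field, where dimensions can be counted.
  set y : Option (Fin (n - 1)) → Fin (2 * n + 1) → R :=
    fun o => o.elim G fun i => (vder δ)^[(i : ℕ) + 1] A with hy
  have hli : LinearIndependent R y := by
    rw [Fintype.linearIndependent_iff]
    intro c hc
    rw [Fintype.sum_option] at hc
    set α : ℕ → R := fun i => if h : i < n - 1 then c (some ⟨i, h⟩) else 0 with hα
    have hsum : ∑ i : Fin (n - 1), c (some i) • y (some i) =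
        ∑ i ∈ Finset.range (n - 1), α i • (vder δ)^[i + 1] A := by
      rw [Finset.sum_range]
      exact Finset.sum_congr rfl fun i _ => by simp [hα, hy]
    rw [hsum] at hc
    have h1 := coeff_eq_zero_of_sum δ hA htop hG (c none) α (n - 1) (by omega) hc
    have hsome : ∀ i, c (some i) = 0 := fun i => by
      have := h1 i i.2
      simpa [hα] using this
    rintro (_ | i)
    · rw [Finset.sum_eq_zero fun i hi => by rw [h1 i (Finset.mem_range.mp hi), zero_smul],
        add_zero] at hc
      exact (smul_eq_zero.mp hc).resolve_right hG0
    · exact hsome i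
  set φ := algebraMap R (FractionRing R) with hφ
  have hinj : Function.Injective φ := IsFractionRing.injective R (FractionRing R)
  have hmap : ∀ x z : Fin (2 * n + 1) → R, form (vmap φ x) (vmap φ z) = φ (form x z) :=
    fun x z => (map_form φ x z).symm
  have hliK : LinearIndependent (FractionRing R) fun o => vmap φ (y o) := by
    rw [← LinearIndependent.iff_fractionRing R (FractionRing R)]
    exact hli.map' (f := (Algebra.linearMap R (FractionRing R)).compLeft (Fin (2 * n + 1)))
      (LinearMap.ker_eq_bot.mpr fun x z h => funext fun i => hinj (congrFun h i))
  refine false_of_isotropic (y := fun o => vmap φ (y o)) (a := vmap φ A)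
    (b := vmap φ ((vder δ)^[n] A)) (by simp; omega) hliK ?_ ?_ ?_ ?_ ?_ ?_
  · rintro (_ | i) (_ | j) <;> rw [hmap, map_eq_zero_iff φ hinj]
    · exact hGG
    · rw [form_comm]; exact hiG _
    · exact hiG _
    · exact hA _ _ (by omega) (by omega)
  · rintro (_ | i) <;> rw [hmap, map_eq_zero_iff φ hinj]
    · exact hAG
    · exact hA 0 _ (by omega) (by omega)
  · rintro (_ | i) <;> rw [hmap, map_eq_zero_iff φ hinj]
    · exact hiG _
    · exact hA _ _ (by omega) (by omega)
  · rw [hmap, map_eq_zero_iff φ hinj]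
    exact hA 0 n (by omega) (by omega)
  · rw [hmap, Ne, map_eq_zero_iff φ hinj]
    exact hAA
  · rw [hmap, Ne, map_eq_zero_iff φ hinj]
    exact htop

end Domain

namespace SmoothFn

/-! ### Holomorphic functions -/

theorem hasDerivAt_of_Db {q : SmoothFn} (h : Db q = 0) (z : ℂ) :
    HasDerivAt (q : ℂ → ℂ) ((D q : ℂ → ℂ) z) z := by
  rw [hasDerivAt_iff_hasFDerivAt]
  refine hasFDerivAt_of_restrictScalars ℝ (q.differentiable z).hasFDerivAt
    (ContinuousLinearMap.ext fun v => ?_)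
  rw [fderiv_apply_eq, h]
  change _ = (D q : ℂ → ℂ) z * v + 0 * _
  simp [mul_comm]

/-- A smooth function with `Db q = 0` is entire, and its ∂-jet is its Taylor series. -/
theorem eq_zero_of_jet {q : SmoothFn} (h : Db q = 0) {a : ℂ} (ha : jet a q = 0) : q = 0 := by
  have hd : Differentiable ℂ (q : ℂ → ℂ) := fun z => (hasDerivAt_of_Db h z).differentiableAt
  have hk : ∀ k, iteratedDeriv k (q : ℂ → ℂ) = ((D^[k] q : SmoothFn) : ℂ → ℂ) := by
    intro k
    induction k with
    | zero => rfl
    | succ k ih =>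
      rw [iteratedDeriv_succ, ih, Function.iterate_succ_apply']
      refine funext fun z => (hasDerivAt_of_Db ?_ z).deriv
      clear ih
      induction k with
      | zero => exact h
      | succ k ih => rw [Function.iterate_succ_apply', ← D_Db, ih, map_zero]
  refine ext_eval fun z => ?_
  rw [← Complex.taylorSeries_eq_of_entire hd a z]
  change _ = (0 : ℂ)
  have h0 : ∀ k, iteratedDeriv k (q : ℂ → ℂ) a = 0 := fun k => by
    have h1 : ((D^[k] q : SmoothFn) : ℂ → ℂ) a / (k.factorial : ℂ) = 0 := by
      have := congrArg (PowerSeries.coeff k) ha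
      change PowerSeries.coeff k (jetFun a q) = 0 at this
      rwa [jetFun, PowerSeries.coeff_mk] at this
    rw [hk k]
    exact (div_eq_zero_iff.mp h1).resolve_right (Nat.cast_ne_zero.mpr k.factorial_ne_zero)
  simp [h0]

theorem dense_of_Db {q : SmoothFn} (h : Db q = 0) (hq : q ≠ 0) :
    Dense {z | (q : ℂ → ℂ) z ≠ 0} := by
  have hd : Differentiable ℂ (q : ℂ → ℂ) := fun z => (hasDerivAt_of_Db h z).differentiableAt
  rw [← Set.compl_ofPred, ← interior_eq_empty_iff_dense_compl]
  by_contra hne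
  obtain ⟨z₀, hz₀⟩ := Set.nonempty_iff_ne_empty.mpr hne
  refine hq (ext_eval fun z => ?_)
  have := AnalyticOnNhd.eq_of_eventuallyEq (f := (q : ℂ → ℂ)) (g := fun _ => 0) (z₀ := z₀)
    (fun z _ => hd.analyticAt z) (fun z _ => analyticAt_const) (mem_interior_iff_mem_nhds.mp hz₀)
  exact congrFun this z

end SmoothFn

namespace SmoothFn

/-! ### Zeros of the entries of a harmonic sequence -/

theorem conj_mem_nonZeroDivisors {p : SmoothFn} (hp : p ∈ nonZeroDivisors SmoothFn) :
    conj p ∈ nonZeroDivisors SmoothFn := by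
  rw [mem_nonZeroDivisors_iff_right] at hp ⊢
  intro g hg
  have h := hp (conj g) (by rw [← conj_conj p, ← map_mul, hg, map_zero])
  rw [← conj_conj g, h, map_zero]

theorem mem_nonZeroDivisors_of_ne_zero {p : SmoothFn} (hp : ∀ z, (p : ℂ → ℂ) z ≠ 0) :
    p ∈ nonZeroDivisors SmoothFn :=
  mem_nonZeroDivisors (by simp [hp])

/-- `c` is locally a power of `z - a` times a function that does not vanish at `a`. -/
def IsHoloType (c : SmoothFn) : Prop :=
  ∀ a, ∃ (m : ℕ) (e : SmoothFn), (e : ℂ → ℂ) a ≠ 0 ∧ c = zeta a ^ m * e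

theorem IsHoloType.jet_ne_zero {c : SmoothFn} (hc : IsHoloType c) (a : ℂ) : jet a c ≠ 0 := by
  obtain ⟨m, e, he, rfl⟩ := hc a
  rw [map_mul, map_pow]
  exact mul_ne_zero (pow_ne_zero _ (jet_zeta_ne_zero a)) (jet_ne_zero_of_apply he)

theorem IsHoloType.eventually_ne {c : SmoothFn} (hc : IsHoloType c) (a : ℂ) :
    ∀ᶠ z in nhdsWithin a {a}ᶜ, (c : ℂ → ℂ) z ≠ 0 := by
  obtain ⟨m, e, he, rfl⟩ := hc a
  have h := (e.continuous.continuousAt (x := a)).eventually_ne he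
  filter_upwards [h.filter_mono nhdsWithin_le_nhds, self_mem_nhdsWithin] with z hz hza
  exact mul_ne_zero (a := ((zeta a ^ m : SmoothFn) : ℂ → ℂ) z)
    (pow_ne_zero m (sub_ne_zero.mpr hza)) hz

theorem IsHoloType.mem_nonZeroDivisors {c : SmoothFn} (hc : IsHoloType c) :
    c ∈ nonZeroDivisors SmoothFn := by
  refine SmoothFn.mem_nonZeroDivisors fun a => ?_
  refine mem_closure_iff_frequently.mpr ?_
  exact ((hc.eventually_ne a).frequently).filter_mono nhdsWithin_le_nhds

variable {n : ℕ}

theorem hsq_smul (p : SmoothFn) (x : Fin (2 * n + 1) → SmoothFn) :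
    hsq (p • x) = p * conj p * hsq x := by
  rw [hsq, vmap_smul, form_smul_left, form_smul_right, hsq]
  ring

/-- The equation that says that `∂_{z̄} x` is the multiple of `g` forced by `⟨x, ḡ⟩ = 0`. -/
def IsBackward (g x : Fin (2 * n + 1) → SmoothFn) : Prop :=
  hsq g • dbv x = -form x (cj (dv g)) • g

/-- The equation is linear over holomorphic functions, so it passes to the quotient by a power of z
- a. -/
theorem IsBackward.of_smul {g x : Fin (2 * n + 1) → SmoothFn} {p : SmoothFn}
    (hp : p ∈ nonZeroDivisors SmoothFn) (hpb : Db p = 0) (h : IsBackward g (p • x)) :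
    IsBackward g x := by
  rw [IsBackward, vder_smul, hpb, zero_smul, add_zero, form_smul_left] at h
  refine smul_vec_cancel hp (funext fun i => ?_)
  have h1 := congrFun h i
  simp only [Pi.smul_apply, smul_eq_mul] at h1 ⊢
  linear_combination h1

/-- A linear first order equation for power series has no nonzero solution with value zero. -/
theorem powerSeries_eq_zero_of_ode {ι : Type*} {H : PowerSeries ℂ}
    (hH : PowerSeries.constantCoeff H ≠ 0) {X : ι → PowerSeries ℂ}
    (h0 : ∀ i, PowerSeries.constantCoeff (X i) = 0)
    (h : ∀ N : ℕ, (∀ i, PowerSeries.X ^ N ∣ X i) →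
      ∀ i, PowerSeries.X ^ N ∣ H * PowerSeries.derivative ℂ (X i)) (i : ι) : X i = 0 := by
  have hu : IsUnit H := PowerSeries.isUnit_iff_constantCoeff.mpr (isUnit_iff_ne_zero.mpr hH)
  -- Each round gains one power of X: divisibility of the derivative by X^N and a zero constant term
  -- give divisibility of the series by X^(N+1).
  have key : ∀ N : ℕ, ∀ i, PowerSeries.X ^ N ∣ X i := by
    intro N
    induction N with
    | zero => simp
    | succ N ih =>
      intro i
      have h1 := (hu.dvd_mul_left).mp (h N ih i)
      rw [PowerSeries.X_pow_dvd_iff] at h1 ⊢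
      intro m hm
      rcases m with _ | m
      · simpa using h0 i
      · have h2 := h1 m (by omega)
        rw [PowerSeries.coeff_derivative] at h2
        exact (mul_eq_zero.mp h2).resolve_right (Nat.cast_add_one_ne_zero m)
  ext m
  exact PowerSeries.X_pow_dvd_iff.mp (key (m + 1) i) m (by omega)

theorem constantCoeff_jetb_ne_zero {a : ℂ} {g : SmoothFn} (h : (g : ℂ → ℂ) a ≠ 0) :
    PowerSeries.constantCoeff (jetb a g) ≠ 0 := by
  rwa [constantCoeff_jetb]

/-- Under `jetb a` the equation becomes a linear system for power series whose leading coefficient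
is a unit and whose initial value is zero. So the whole ∂̄-jet of x vanishes and
`exists_eq_zeta_mul` applies to every component. -/
theorem IsBackward.exists_eq_zeta_smul {g x : Fin (2 * n + 1) → SmoothFn} (h : IsBackward g x)
    {a : ℂ} (hg : (hsq g : ℂ → ℂ) a ≠ 0) (hx : ∀ i, (x i : ℂ → ℂ) a = 0) :
    ∃ y, x = zeta a • y ∧ IsBackward g y := by
  have hj : ∀ i, jetb a (x i) = 0 := by
    refine powerSeries_eq_zero_of_ode (constantCoeff_jetb_ne_zero hg) (by simpa using hx) ?_
    intro N hN i
    have h1 := congrArg (jetb a) (congrFun h i)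
    simp only [Pi.smul_apply, smul_eq_mul, vder_apply, map_mul, map_neg, map_form, jetb_Db] at h1
    rw [h1, form_apply]
    refine Dvd.dvd.mul_right ((dvd_neg).mpr (Finset.dvd_sum fun k _ => ?_)) _
    exact Dvd.dvd.mul_left (Dvd.dvd.mul_right (hN k) _) _
  choose y hy using fun i => exists_eq_zeta_mul (hj i)
  have hxy : x = zeta a • y := funext hy
  rw [hxy] at h
  exact ⟨y, hxy, h.of_smul (zeta_mem_nonZeroDivisors a) (Db_zeta a)⟩

theorem Db_zeta_pow (a : ℂ) (m : ℕ) : Db (zeta a ^ m) = 0 := by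
  rw [Derivation.leibniz_pow, Db_zeta, smul_zero, smul_zero]

/-- The quotient satisfies the same equation, so division can go on as long as it vanishes at a. If
it never stopped, every coefficient of the ∂-jet of x would be zero. -/
theorem IsBackward.exists_eq_zeta_pow_smul {g x : Fin (2 * n + 1) → SmoothFn}
    (h : IsBackward g x) {a : ℂ} (hg : (hsq g : ℂ → ℂ) a ≠ 0) (hx : vmap (jet a) x ≠ 0) :
    ∃ (m : ℕ) (y : Fin (2 * n + 1) → SmoothFn), (∃ i, (y i : ℂ → ℂ) a ≠ 0) ∧
      ∀ i, x i = zeta a ^ m * y i := by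
  by_contra hcon
  push Not at hcon
  have key : ∀ m : ℕ, ∃ y, x = zeta a ^ m • y ∧ IsBackward g y := by
    intro m
    induction m with
    | zero => exact ⟨x, by simp, h⟩
    | succ m ih =>
      obtain ⟨y, hy, hb⟩ := ih
      have h0 : ∀ i, (y i : ℂ → ℂ) a = 0 := by
        by_contra hne
        push Not at hne
        obtain ⟨i, hi⟩ := hcon m y hne
        exact hi (congrFun hy i)
      obtain ⟨y', hy', hb'⟩ := hb.exists_eq_zeta_smul hg h0
      exact ⟨y', by rw [hy, hy', smul_smul, pow_succ], hb'⟩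
  refine hx (funext fun i => ?_)
  have hX : (PowerSeries.X : PowerSeries ℂ) ∣ jet a (zeta a) := by
    rw [PowerSeries.X_dvd_iff]; simp
  ext k
  obtain ⟨y, hy, -⟩ := key (k + 1)
  have h1 : (PowerSeries.X : PowerSeries ℂ) ^ (k + 1) ∣ jet a (x i) := by
    rw [hy, Pi.smul_apply, smul_eq_mul, map_mul, map_pow]
    exact Dvd.dvd.mul_right (pow_dvd_pow_of_dvd hX _) _
  exact PowerSeries.X_pow_dvd_iff.mp h1 k (by omega)

/-- A real function whose logarithmic derivative has at most a pole has vanishing `∂_z`-jet at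
its zeros. -/
theorem jet_eq_zero_of_logDeriv {a : ℂ} {u E : SmoothFn} (hu : conj u = u)
    (hua : (u : ℂ → ℂ) a = 0) (hE : (E : ℂ → ℂ) a ≠ 0) (m : ℕ) :
    ∀ β : SmoothFn, zeta a ^ m * (E * D u) = β * u → jet a u = 0 := by
  induction m with
  | zero =>
    intro β h
    rw [pow_zero, one_mul] at h
    have h1 := congrArg (jet a) h
    rw [map_mul, map_mul, jet_D] at h1
    refine powerSeries_eq_zero_of_ode (ι := Unit) (X := fun _ => jet a u)
      (H := jet a E) (by rwa [constantCoeff_jet]) (by simpa using hua) ?_ ()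
    intro N hN _
    rw [h1]
    exact Dvd.dvd.mul_left (hN ()) _
  | succ m ih =>
    intro β h
    by_contra hne
    -- Since u is real, its two jets vanish together. `jetb a` kills the left side of the equation,
    -- so the ∂̄-jet of β is zero. Hence z - a divides β, and one factor cancels. At m = 0 a regular
    -- linear equation with initial value zero remains.
    have hb : jetb a u ≠ 0 := by
      rw [Ne, jetb_eq_zero_iff, hu]; exact hne
    have h1 := congrArg (jetb a) h
    rw [map_mul, map_pow, jetb_zeta, zero_pow (by omega), zero_mul, map_mul] at h1
    obtain ⟨β', rfl⟩ := exists_eq_zeta_mul ((mul_eq_zero.mp h1.symm).resolve_right hb)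
    refine hne (ih β' ((mul_cancel_left_mem_nonZeroDivisors (zeta_mem_nonZeroDivisors a)).mp ?_))
    linear_combination h

variable {f : Fin (2 * n + 1) → SmoothFn} {s : ℕ → Fin (2 * n + 1) → SmoothFn}

/-- `s` is a smooth multiple, with zeros of holomorphic type, of a vector with nowhere vanishing
Hermitian square. -/
structure IsLevel (x : Fin (2 * n + 1) → SmoothFn) (c : SmoothFn)
    (g : Fin (2 * n + 1) → SmoothFn) : Prop where
  eq : x = c • g
  holo : IsHoloType c
  ne : ∀ z, (hsq g : ℂ → ℂ) z ≠ 0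

/-- Up to the regular factor, ∂ (s j) and s (j + 1) differ by a multiple of s j, which is Hermitian
orthogonal to s (j + 1). -/
theorem form_seq_cj_dv (hn : 1 ≤ n) (hf : IsHarmonicVec f) (hi : IsIsotropicVec f)
    (hs : IsHarmonicSeq f s) {j : ℕ} (hj : j + 1 ≤ n) :
    form (s (j + 1)) (cj (dv (s j))) = hsq (s (j + 1)) := by
  have hreg := hs.regular j (by omega)
  have hsucc := hs.succ j (by omega)
  refine (mul_cancel_left_mem_nonZeroDivisors hreg).mp ?_
  rw [← form_smul_right, ← conj_hsq, ← vmap_smul,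
    show hsq (s j) • dv (s j) =
      hsq (s j) • s (j + 1) + form (dv (s j)) (cj (s j)) • s j by rw [hsucc]; abel,
    map_add, vmap_smul, vmap_smul, form_add_right, form_smul_right, form_smul_right,
    (seq_orthogonal hn hf hi hs (j + 1) hj).1 j (by omega), mul_zero, add_zero, conj_hsq, ← hsq]

theorem IsLevel.form_cj_dv (hn : 1 ≤ n) (hf : IsHarmonicVec f) (hi : IsIsotropicVec f)
    (hs : IsHarmonicSeq f s) {j : ℕ} (hj : j + 1 ≤ n) {c : SmoothFn}
    {g : Fin (2 * n + 1) → SmoothFn} (h : IsLevel (s j) c g) :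
    conj c * form (s (j + 1)) (cj (dv g)) = hsq (s (j + 1)) := by
  have hc := conj_mem_nonZeroDivisors h.holo.mem_nonZeroDivisors
  have h1 := form_seq_cj_dv hn hf hi hs hj
  have h2 := (seq_orthogonal hn hf hi hs (j + 1) hj).1 j (by omega)
  rw [h.eq, vmap_smul, form_smul_right] at h2
  have h3 := mul_eq_zero_cancel hc h2
  rw [h.eq, vder_smul, map_add, vmap_smul, vmap_smul, form_add_right, form_smul_right,
    form_smul_right, h3, mul_zero, add_zero] at h1
  exact h1

/-- Written in terms of g, the formula for ∂̄ (s (j + 1)) contains the factor c times its conjugate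
on both sides. Cancelling it leaves the leading coefficient `hsq g`, which has no zeros. -/
theorem IsLevel.isBackward (hn : 1 ≤ n) (hf : IsHarmonicVec f) (hi : IsIsotropicVec f)
    (hs : IsHarmonicSeq f s) {j : ℕ} (hj : j + 1 ≤ n) {c : SmoothFn}
    {g : Fin (2 * n + 1) → SmoothFn} (h : IsLevel (s j) c g) : IsBackward g (s (j + 1)) := by
  have hc := h.holo.mem_nonZeroDivisors
  have h1 := (seq_orthogonal hn hf hi hs (j + 1) hj).2 j rfl
  have h2 := h.form_cj_dv hn hf hi hs hj
  rw [h.eq, hsq_smul, ← h2] at h1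
  refine smul_vec_cancel (mul_mem hc (conj_mem_nonZeroDivisors hc)) (funext fun i => ?_)
  have h3 := congrFun h1 i
  simp only [Pi.smul_apply, smul_eq_mul] at h3 ⊢
  linear_combination h3

/-- The relation between consecutive entries of the harmonic sequence without denominators. -/
theorem IsLevel.succ (hs : IsHarmonicSeq f s) {j : ℕ} (hj : j < n) {c : SmoothFn}
    {g : Fin (2 * n + 1) → SmoothFn} (h : IsLevel (s j) c g) :
    (c * hsq g) • s (j + 1) = (c * hsq g) • dv (s j) - form (dv (s j)) (cj g) • s j := by
  have hc := conj_mem_nonZeroDivisors h.holo.mem_nonZeroDivisors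
  have h1 := hs.succ j hj
  have h2 : hsq (s j) = c * conj c * hsq g := by rw [h.eq, hsq_smul]
  have h3 : form (dv (s j)) (cj (s j)) = conj c * form (dv (s j)) (cj g) := by
    conv_lhs => rw [show cj (s j) = conj c • cj g by rw [h.eq, vmap_smul]]
    rw [form_smul_right]
  rw [h2, h3] at h1
  -- The conjugate of c has to be removed before ∂-jets are taken, because its ∂-jet is zero at
  -- every zero of c. The remaining coefficient `c * hsq g` has non-zero ∂-jet everywhere.
  refine smul_vec_cancel hc (funext fun i => ?_)
  have h4 := congrFun h1 i
  simp only [Pi.smul_apply, Pi.sub_apply, smul_eq_mul] at h4 ⊢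
  linear_combination h4

theorem vmap_jet_iterate {ι : Type*} (a : ℂ) (k : ℕ) (x : ι → SmoothFn) :
    (vder (PowerSeries.derivative ℂ))^[k] (vmap (jet a) x) = vmap (jet a) (dv^[k] x) := by
  induction k with
  | zero => rfl
  | succ k ih =>
    rw [Function.iterate_succ_apply', Function.iterate_succ_apply', ih]
    exact funext fun i => (jet_D a _).symm

theorem jet_isotropic (hi : IsIsotropicVec f) (a : ℂ) (k l : ℕ) (h1 : 1 ≤ k + l)
    (h2 : k + l ≤ 2 * n - 1) : form ((vder (PowerSeries.derivative ℂ))^[k] (vmap (jet a) f))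
      ((vder (PowerSeries.derivative ℂ))^[l] (vmap (jet a) f)) = 0 := by
  rw [vmap_jet_iterate, vmap_jet_iterate, ← map_form, hi k l h1 h2, map_zero]

theorem jet_top (hn : 1 ≤ n) (hf : IsHarmonicVec f) (hi : IsIsotropicVec f)
    (ht : topSquare f ≠ 0) (a : ℂ) :
    form ((vder (PowerSeries.derivative ℂ))^[n] (vmap (jet a) f))
      ((vder (PowerSeries.derivative ℂ))^[n] (vmap (jet a) f)) ≠ 0 := by
  rw [vmap_jet_iterate, ← map_form]
  exact fun h => ht (eq_zero_of_jet (Db_topSquare hn hf hi) h)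

/-- The comparison of `sub_iterate_mem` is repeated in ℂ[[X]], using the recursion `IsLevel.succ`.
If the jet of s (j + 1) were zero, the jet of ∂^{j+1} f would depend on those of lower positive
order. `iterate_notMem_jetSpan` excludes this, because the holomorphic function `topSquare f` has
non-zero jet. -/
theorem jet_seq_ne_zero (hn : 1 ≤ n) (hf : IsHarmonicVec f) (hi : IsIsotropicVec f)
    (ht : topSquare f ≠ 0) (hs : IsHarmonicSeq f s) {j : ℕ} (hj : j + 1 ≤ n)
    (hl : ∀ i ≤ j, ∃ c g, IsLevel (s i) c g) (a : ℂ) : vmap (jet a) (s (j + 1)) ≠ 0 := by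
  set d := PowerSeries.derivative ℂ with hd
  set A := vmap (jet a) f with hA
  have key : ∀ i ≤ j, vmap (jet a) (s (i + 1)) - (vder d)^[i + 1] A ∈ jetSpan d A i := by
    intro i
    induction i with
    | zero =>
      intro _
      rw [hs.one hn hf, vmap_jet_iterate, zero_add, Function.iterate_one, sub_self]
      exact zero_mem _
    | succ i ih =>
      intro hij
      specialize ih (by omega)
      obtain ⟨c, g, h⟩ := hl (i + 1) hij
      have h1 := congrArg (vmap (jet a)) (h.succ hs (show i + 1 < n by omega))
      rw [map_sub, vmap_smul, vmap_smul, vmap_smul] at h1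
      have hreg : jet a (c * hsq g) ∈ nonZeroDivisors (PowerSeries ℂ) := by
        rw [map_mul]
        exact _root_.mem_nonZeroDivisors_of_ne_zero
          (mul_ne_zero (h.holo.jet_ne_zero a) (jet_ne_zero_of_apply (h.ne a)))
      have hmem : vmap (jet a) (s (i + 1)) ∈ jetSpan d A (i + 1) := by
        have := add_mem (jetSpan_mono d A (Nat.le_succ i) ih)
          (iterate_mem_jetSpan d A (show 1 ≤ i + 1 by omega) (le_refl (i + 1)))
        rwa [sub_add_cancel] at this
      have hdv : vmap (jet a) (dv (s (i + 1))) = vder d (vmap (jet a) (s (i + 1))) :=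
        funext fun k => jet_D a _
      refine mem_satSpan_of_smul hreg ?_
      have h2 : jet a (c * hsq g) • (vmap (jet a) (s (i + 1 + 1)) - (vder d)^[i + 1 + 1] A) =
          jet a (c * hsq g) • vder d (vmap (jet a) (s (i + 1)) - (vder d)^[i + 1] A) -
            jet a (form (dv (s (i + 1))) (cj g)) • vmap (jet a) (s (i + 1)) := by
        rw [smul_sub, h1, map_sub, smul_sub, hdv, Function.iterate_succ_apply' _ (i + 1)]
        abel
      rw [h2]
      exact sub_mem (Submodule.smul_mem _ _ (vder_mem_jetSpan d A ih))
        (Submodule.smul_mem _ _ hmem)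
  intro h0
  have h1 := key j le_rfl
  rw [h0, zero_sub, neg_mem_iff] at h1
  exact iterate_notMem_jetSpan d (jet_isotropic hi a) (jet_top hn hf hi ht a) hj h1

theorem hermitian_self_ne_zero {ι : Type*} [Fintype ι] {x : ι → SmoothFn} {a : ℂ}
    (h : ∃ i, (x i : ℂ → ℂ) a ≠ 0) : ((∑ i, x i * conj (x i) : SmoothFn) : ℂ → ℂ) a ≠ 0 := by
  have h1 : ((∑ i, x i * conj (x i) : SmoothFn) : ℂ → ℂ) a =
      ((∑ i, Complex.normSq ((x i : ℂ → ℂ) a) : ℝ) : ℂ) := by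
    rw [← eval_apply, map_sum]
    push_cast
    refine Finset.sum_congr rfl fun i _ => ?_
    rw [map_mul, eval_apply, eval_apply, conj_apply, Complex.mul_conj]
  rw [h1]
  obtain ⟨i, hi⟩ := h
  refine Complex.ofReal_ne_zero.mpr (ne_of_gt ?_)
  exact Finset.sum_pos' (fun _ _ => Complex.normSq_nonneg _)
    ⟨i, Finset.mem_univ _, Complex.normSq_pos.mpr hi⟩

/-- The directions of the entries of the harmonic sequence do not become null at zeros. -/
theorem hsq_ne_zero_of_eq_zeta_pow_smul (hn : 1 ≤ n) (hf : IsHarmonicVec f)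
    (hi : IsIsotropicVec f) (ht : topSquare f ≠ 0) (hs : IsHarmonicSeq f s) {j : ℕ}
    (hj : j + 1 < n) {c' : SmoothFn} {g' : Fin (2 * n + 1) → SmoothFn}
    (hl : IsLevel (s j) c' g') {a : ℂ} {m : ℕ} {g : Fin (2 * n + 1) → SmoothFn}
    (hg : ∃ i, (g i : ℂ → ℂ) a ≠ 0) (hsg : s (j + 1) = zeta a ^ m • g) :
    (hsq g : ℂ → ℂ) a ≠ 0 := by
  intro hua
  set ζm := zeta a ^ m with hζ
  have hζr : ζm ∈ nonZeroDivisors SmoothFn := pow_mem (zeta_mem_nonZeroDivisors a) m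
  have hζc := conj_mem_nonZeroDivisors hζr
  have hc' := hl.holo.mem_nonZeroDivisors
  have hg' := mem_nonZeroDivisors_of_ne_zero hl.ne
  have hbS := hl.isBackward hn hf hi hs (by omega)
  have horth := (seq_orthogonal hn hf hi hs (j + 1) (by omega)).1
  have hcS := hl.form_cj_dv hn hf hi hs (by omega)
  have hiso := form_seq_seq hn hf hi hs (j := j + 1) (k := j + 1) (by omega) (by omega)
    (by omega) (by omega)
  have hsucc := hs.succ (j + 1) hj
  have hregS := hs.regular (j + 1) hj
  rw [hsg] at hbS hcS hiso hsucc hregS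
  have hb : IsBackward g' g := hbS.of_smul hζr (Db_zeta_pow a m)
  have hgg' : form g (cj g') = 0 := by
    have h1 := horth j (by omega)
    rw [hsg, hl.eq, vmap_smul, form_smul_left, form_smul_right] at h1
    exact mul_eq_zero_cancel (conj_mem_nonZeroDivisors hc') (mul_eq_zero_cancel hζr h1)
  have hgf : form (cj g) f = 0 := by
    have h1 := horth 0 (by omega)
    rw [hsg, hs.zero, hf.real, form_smul_left] at h1
    have h2 := congrArg conj (mul_eq_zero_cancel hζr h1)
    rwa [conj_form, hf.real, map_zero] at h2
  have hgg : form (cj g) (cj g) = 0 := by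
    rw [form_smul_left, form_smul_right] at hiso
    rw [← conj_form, mul_eq_zero_cancel hζr (mul_eq_zero_cancel hζr hiso), map_zero]
  have hbc : hsq g' • dv (cj g) = -form (cj g) (dv g') • cj g' := by
    have h1 := congrArg cj hb
    rwa [vmap_smul, vmap_smul, conj_hsq, cj_dbv, map_neg, conj_form, cj_cj] at h1
  have hDu : D (hsq g) = form (dv g) (cj g) := by
    have h1 : form g (dv (cj g)) = 0 := by
      refine mul_eq_zero_cancel hg' ?_
      rw [← form_smul_right, hbc, form_smul_right, hgg', mul_zero]
    rw [hsq, derivation_form, h1, add_zero]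
  -- This is the Gram-Schmidt formula for the following entry, written in terms of g. The entry is
  -- smooth on the left, which restricts how the logarithmic derivative of `hsq g` can behave at a.
  have hrel : hsq g • s (j + 1 + 1) = ζm • (hsq g • dv g - D (hsq g) • g) := by
    have hp : ζm * conj ζm ∈ nonZeroDivisors SmoothFn := mul_mem hζr hζc
    rw [hsq_smul, vder_smul, vmap_smul, form_smul_right, form_add_left, form_smul_left,
      form_smul_left, ← hDu, ← hsq] at hsucc
    refine smul_vec_cancel hp (funext fun i => ?_)
    have h1 := congrFun hsucc i
    simp only [Pi.smul_apply, Pi.sub_apply, Pi.add_apply, smul_eq_mul] at h1 ⊢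
    linear_combination h1
  -- The relation is contracted with the conjugate of g in the positive definite product rather than
  -- the Minkowski one. Its coefficient E is then non-zero at a, where `hsq g` was assumed to
  -- vanish.
  have hjet : jet a (hsq g) = 0 := by
    refine jet_eq_zero_of_logDeriv (E := ∑ i, g i * conj (g i)) (conj_hsq g) hua
      (hermitian_self_ne_zero hg) m (∑ i, (ζm * D (g i) - s (j + 1 + 1) i) * conj (g i)) ?_
    rw [← hζ, Finset.sum_mul, Finset.sum_mul, Finset.mul_sum]
    refine Finset.sum_congr rfl fun i _ => ?_
    have h1 := congrFun hrel i
    simp only [Pi.smul_apply, Pi.sub_apply, smul_eq_mul, vder_apply] at h1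
    linear_combination conj (g i) * h1
  have hcon : c' * form (cj g) (dv g') = ζm * hsq g := by
    refine (mul_cancel_left_mem_nonZeroDivisors hζc).mp ?_
    have h1 := congrArg conj hcS
    rw [map_mul, conj_conj, conj_form, cj_cj, conj_hsq, vmap_smul, form_smul_left, hsq_smul] at h1
    linear_combination h1
  -- A vanishing ∂-jet of `hsq g` forces the same for ⟨conj g, ∂g'⟩, which is the coefficient in the
  -- equation for ∂ (conj g). So the ∂-jet of conj g is constant. It is also non-zero, isotropic and
  -- orthogonal to f, as `false_of_constant_isotropic` forbids.
  have hG : vder (PowerSeries.derivative ℂ) (vmap (jet a) (cj g)) = 0 := by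
    have h1 := congrArg (jet a) hcon
    rw [map_mul, map_mul, hjet, mul_zero] at h1
    have h2 := (mul_eq_zero.mp h1).resolve_left (hl.holo.jet_ne_zero a)
    refine funext fun i => ?_
    have h3 := congrArg (jet a) (congrFun hbc i)
    rw [Pi.smul_apply, Pi.smul_apply, smul_eq_mul, smul_eq_mul, map_mul, map_mul, map_neg, h2,
      neg_zero, zero_mul, vder_apply, jet_D] at h3
    exact (mul_eq_zero.mp h3).resolve_left (jet_ne_zero_of_apply (hl.ne a))
  refine false_of_constant_isotropic (PowerSeries.derivative ℂ) hn (A := vmap (jet a) f)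
    (G := vmap (jet a) (cj g)) ?_ (jet_isotropic hi a) (jet_top hn hf hi ht a) hG ?_ ?_ ?_
  · rw [← map_form, hf.norm, map_one]; exact one_ne_zero
  · obtain ⟨i, h⟩ := hg
    intro h0
    have h1 : jet a (conj (g i)) = 0 := congrFun h0 i
    exact jet_ne_zero_of_apply (by simpa using h) h1
  · rw [← map_form, form_comm, hgf, map_zero]
  · rw [← map_form, hgg, map_zero]

/-- Level j supplies the ∂̄-equation for s (j + 1), hence a factorization at each point, and these
are glued globally. Near a the global c is ζ^m times a unit e, and the non-null test is applied to e
• g. Since it uses the entry after s (j + 1), it reaches only the levels below n. -/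
theorem exists_isLevel (hn : 1 ≤ n) (hf : IsHarmonicVec f)
    (hi : IsIsotropicVec f) (ht : topSquare f ≠ 0) (hs : IsHarmonicSeq f s) (j : ℕ)
    (hj : j < n) : ∃ c g, IsLevel (s j) c g := by
  induction j using Nat.strong_induction_on with
  | _ j ih =>
  rcases j with _ | j
  · refine ⟨1, f, by rw [hs.zero, one_smul], fun a => ⟨0, 1, one_ne_zero, by simp⟩, fun z => ?_⟩
    rw [hf.hsq_eq_one]
    exact one_ne_zero
  obtain ⟨c', g', hl⟩ := ih j (by omega) (by omega)
  have hjet := jet_seq_ne_zero hn hf hi ht hs (j := j) (by omega)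
    fun i hij => ih i (by omega) (by omega)
  have hb := hl.isBackward hn hf hi hs (by omega)
  obtain ⟨c, g, hcg, hg0, hc⟩ := exists_eq_mul_of_zeros
    fun a => hb.exists_eq_zeta_pow_smul (hl.ne a) (hjet a)
  refine ⟨c, g, funext hcg, hc, fun a => ?_⟩
  obtain ⟨m, e, he, rfl⟩ := hc a
  obtain ⟨i, hgi⟩ := hg0 a
  have h := hsq_ne_zero_of_eq_zeta_pow_smul hn hf hi ht hs hj hl (a := a) (m := m) (g := e • g)
    ⟨i, mul_ne_zero (a := (e : ℂ → ℂ) a) he hgi⟩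
    (funext fun i => by rw [hcg i, Pi.smul_apply, Pi.smul_apply, smul_eq_mul, smul_eq_mul,
      mul_assoc])
  rw [hsq_smul, ← eval_apply, map_mul] at h
  exact right_ne_zero_of_mul h

end SmoothFn

/-! ### The grading of `𝔰𝔬(2n,1,ℂ)` -/

section Grading

open Matrix

variable {n : ℕ}

theorem form_stdVec {R : Type*} [CommRing R] {k : ℕ} (h1 : 1 ≤ k) (h2 : k ≤ 2 * n + 1)
    (y : Fin (2 * n + 1) → R) :
    form (stdVec n R k) y = (if k = 2 * n + 1 then -1 else 1) * y ⟨k - 1, by omega⟩ := by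
  rw [form_apply, Finset.sum_eq_single ⟨k - 1, by omega⟩]
  · have h : k - 1 + 1 = k := by omega
    simp only [stdVec, h, if_true, one_mul, Fin.ext_iff, Fin.val_last]
    congr 1
    split_ifs <;> first | rfl | omega
  · intro b _ hb
    have : ¬ (b.val + 1 = k) := fun h => hb (Fin.ext (by simp only; omega))
    simp [stdVec, this]
  · simp

/-- Indices start at 1, so index 0 gives the zero vector. This lets `Ep n 0` = i e_1 be treated as
the first member of the family `Ep n l`. -/
theorem stdVec_zero {R : Type*} [CommRing R] : stdVec n R 0 = 0 := by
  funext a; simp [stdVec]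

theorem form_stdVec_stdVec {R : Type*} [CommRing R] {j k : ℕ} (h1 : 1 ≤ j) (h2 : j ≤ 2 * n + 1) :
    form (stdVec n R j) (stdVec n R k) =
      if j = k then (if k = 2 * n + 1 then -1 else 1) else 0 := by
  rw [form_stdVec h1 h2]
  have h : j - 1 + 1 = j := by omega
  simp only [stdVec, h]
  split_ifs <;> first | omega | simp

theorem eq_zero_of_form_stdVec {R : Type*} [CommRing R] {y : Fin (2 * n + 1) → R}
    (h : ∀ k, 1 ≤ k → k ≤ 2 * n + 1 → form (stdVec n R k) y = 0) : y = 0 := by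
  funext a
  have h1 := h (a.val + 1) (by omega) (by omega)
  rw [form_stdVec (by omega) (by omega)] at h1
  have e : (⟨a.val + 1 - 1, by omega⟩ : Fin (2 * n + 1)) = a := by ext; simp
  rw [e] at h1
  split_ifs at h1 <;> simpa using h1

/-- `e_{2l} + i e_{2l+1}`; for `l = 0` this is `i e_1`. -/
def Ep (n l : ℕ) : Fin (2 * n + 1) → ℂ :=
  stdVec n ℂ (2 * l) + Complex.I • stdVec n ℂ (2 * l + 1)

/-- `e_{2l} - i e_{2l+1}`. -/
def Em (n l : ℕ) : Fin (2 * n + 1) → ℂ :=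
  stdVec n ℂ (2 * l) - Complex.I • stdVec n ℂ (2 * l + 1)

theorem Ep_zero : Ep n 0 = Complex.I • stdVec n ℂ 1 := by
  rw [Ep, mul_zero, stdVec_zero, zero_add, zero_add]

/-- Membership with weight `m` in the eigenbasis of the Coxeter matrix. -/
def IsBasisEig (n : ℕ) (m : ℤ) (x : Fin (2 * n + 1) → ℂ) : Prop :=
  (∃ k : ℕ, k < n ∧ x = Ep n k ∧ m = k) ∨ (∃ k : ℕ, 1 ≤ k ∧ k < n ∧ x = Em n k ∧ m = -k) ∨
    ((x = stdVec n ℂ (2 * n) ∨ x = stdVec n ℂ (2 * n + 1)) ∧ m = n)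

theorem eq_zero_of_basisEig {y : Fin (2 * n + 1) → ℂ}
    (h : ∀ m x, IsBasisEig n m x → form x y = 0) : y = 0 := by
  refine eq_zero_of_form_stdVec fun k h1 h2 => ?_
  rcases Nat.lt_or_ge k (2 * n) with hk | hk
  · have hp := h _ _ (Or.inl ⟨k / 2, by omega, rfl, rfl⟩)
    rw [Ep, form_add_left, form_smul_left] at hp
    rcases Nat.eq_zero_or_pos (k / 2) with h0 | h0
    · rw [h0, mul_zero, stdVec_zero, form_zero_left, zero_add, zero_add] at hp
      rw [show k = 1 by omega]
      exact (mul_eq_zero.mp hp).resolve_left Complex.I_ne_zero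
    · have hm := h _ _ (Or.inr (Or.inl ⟨k / 2, h0, by omega, rfl, rfl⟩))
      rw [Em, form_sub_left, form_smul_left] at hm
      rcases Nat.even_or_odd' k with ⟨l, rfl | rfl⟩
      · rw [show 2 * l / 2 = l by omega] at hp hm
        linear_combination (1 / 2) * hp + (1 / 2) * hm
      · rw [show (2 * l + 1) / 2 = l by omega] at hp hm
        refine (mul_eq_zero.mp ?_).resolve_left Complex.I_ne_zero
        linear_combination (1 / 2) * hp - (1 / 2) * hm
  · rcases (show k = 2 * n ∨ k = 2 * n + 1 by omega) with rfl | rfl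
    · exact h _ _ (Or.inr (Or.inr ⟨Or.inl rfl, rfl⟩))
    · exact h _ _ (Or.inr (Or.inr ⟨Or.inr rfl, rfl⟩))

theorem mulVec_eq_form (M : Matrix (Fin (2 * n + 1)) (Fin (2 * n + 1)) ℂ)
    (y : Fin (2 * n + 1) → ℂ) (a : Fin (2 * n + 1)) :
    (M *ᵥ y) a = form y ((upsilon n ℂ) *ᵥ (M a)) := by
  have h : ∀ x : Fin (2 * n + 1) → ℂ, (upsilon n ℂ) *ᵥ ((upsilon n ℂ) *ᵥ x) = x := fun x => by
    funext i
    simp only [upsilon, mulVec_diagonal]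
    split_ifs <;> ring
  rw [form, h, mulVec, dotProduct_comm]

theorem matrix_eq_zero_of_basisEig {M : Matrix (Fin (2 * n + 1)) (Fin (2 * n + 1)) ℂ}
    (h : ∀ m x, IsBasisEig n m x → M *ᵥ x = 0) : M = 0 := by
  ext a b
  have h1 : (upsilon n ℂ) *ᵥ (M a) = 0 := eq_zero_of_basisEig fun m x hx => by
    rw [← mulVec_eq_form, h m x hx]; rfl
  have h2 := congrFun h1 b
  simp only [upsilon, mulVec_diagonal, Pi.zero_apply] at h2
  split_ifs at h2 <;> simpa using h2

/-- The eigenvalue `e^{iπm/n}`. -/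
def ev (n : ℕ) (m : ℤ) : ℂ := Complex.exp (Real.pi * Complex.I * m / n)

theorem ev_add (m k : ℤ) : ev n (m + k) = ev n m * ev n k := by
  rw [ev, ev, ev, ← Complex.exp_add]
  congr 1
  push_cast
  ring

theorem ev_ne_zero (m : ℤ) : ev n m ≠ 0 := Complex.exp_ne_zero _

theorem ev_eq_one_iff (hn : 1 ≤ n) (m : ℤ) : ev n m = 1 ↔ (2 * n : ℤ) ∣ m := by
  have hn' : (n : ℂ) ≠ 0 := Nat.cast_ne_zero.mpr (by omega)
  have hpi : (Real.pi : ℂ) ≠ 0 := Complex.ofReal_ne_zero.mpr Real.pi_ne_zero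
  rw [ev, Complex.exp_eq_one_iff]
  constructor
  · rintro ⟨k, hk⟩
    refine ⟨k, ?_⟩
    have h1 : Real.pi * Complex.I * (m - 2 * n * k) = 0 := by
      field_simp at hk
      linear_combination Real.pi * Complex.I * hk
    have h2 := (mul_eq_zero.mp h1).resolve_left (mul_ne_zero hpi Complex.I_ne_zero)
    have h3 : ((m : ℤ) : ℂ) = ((2 * n * k : ℤ) : ℂ) := by
      push_cast
      linear_combination h2
    exact_mod_cast h3
  · rintro ⟨k, rfl⟩
    refine ⟨k, ?_⟩
    push_cast
    field_simp

/-- `x` is an eigenvector of the Coxeter matrix of weight `m`. -/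
def IsEig (n : ℕ) (m : ℤ) (x : Fin (2 * n + 1) → ℂ) : Prop := coxeterMat n *ᵥ x = ev n m • x

theorem coxeterMat_mulVec_stdVec {k : ℕ} (h1 : 1 ≤ k) (h2 : k ≤ 2 * n + 1)
    (b : Fin (2 * n + 1)) :
    (coxeterMat n *ᵥ stdVec n ℂ k) b = coxeterMat n b ⟨k - 1, by omega⟩ := by
  rw [mulVec, dotProduct, Finset.sum_eq_single ⟨k - 1, by omega⟩]
  · have h : k - 1 + 1 = k := by omega
    simp [stdVec, h]
  · intro c _ hc
    have : ¬ (c.val + 1 = k) := fun h => hc (Fin.ext (by simp only; omega))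
    simp [stdVec, this]
  · simp

theorem ev_eq (l : ℕ) :
    ev n l = Real.cos (l * Real.pi / n) + Real.sin (l * Real.pi / n) * Complex.I := by
  rw [ev, Complex.ofReal_cos, Complex.ofReal_sin, ← Complex.exp_mul_I]
  congr 1
  push_cast
  ring

theorem ev_neg_eq (l : ℕ) :
    ev n (-l) = Real.cos (l * Real.pi / n) - Real.sin (l * Real.pi / n) * Complex.I := by
  have h : ev n (-l) = Complex.exp (-((l * Real.pi / n : ℝ) : ℂ) * Complex.I) := by
    rw [ev]
    congr 1
    push_cast
    ring
  rw [h, Complex.exp_mul_I, Complex.cos_neg, Complex.sin_neg, Complex.ofReal_cos,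
    Complex.ofReal_sin]
  ring

theorem coxeterMat_mulVec_even {l : ℕ} (h1 : 1 ≤ l) (h2 : l ≤ n) :
    coxeterMat n *ᵥ stdVec n ℂ (2 * l) = (Real.cos (l * Real.pi / n) : ℂ) • stdVec n ℂ (2 * l) -
      (Real.sin (l * Real.pi / n) : ℂ) • stdVec n ℂ (2 * l + 1) := by
  funext b
  rw [coxeterMat_mulVec_stdVec (by omega) (by omega)]
  simp only [coxeterMat, block, Fin.ext_iff, Fin.lt_def, Pi.sub_apply, Pi.smul_apply, stdVec,
    smul_eq_mul]
  by_cases hb : (b.val + 1) / 2 = l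
  · rw [hb, show (2 * l - 1 + 1) / 2 = l by omega, if_pos rfl]
    rcases (show b.val + 1 = 2 * l ∨ b.val + 1 = 2 * l + 1 by omega) with h | h
    · rw [if_pos (show b.val = 2 * l - 1 by omega), if_pos h,
        if_neg (show ¬ (b.val + 1 = 2 * l + 1) by omega)]
      ring
    · rw [if_neg (show ¬ (b.val = 2 * l - 1) by omega),
        if_neg (show ¬ (b.val < 2 * l - 1) by omega), if_pos h,
        if_neg (show ¬ (b.val + 1 = 2 * l) by omega)]
      ring
  · rw [if_neg (by omega), if_neg (by omega), if_neg (by omega)]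
    ring

theorem coxeterMat_mulVec_odd {l : ℕ} (h2 : l ≤ n) :
    coxeterMat n *ᵥ stdVec n ℂ (2 * l + 1) =
      (Real.sin (l * Real.pi / n) : ℂ) • stdVec n ℂ (2 * l) +
      (Real.cos (l * Real.pi / n) : ℂ) • stdVec n ℂ (2 * l + 1) := by
  funext b
  rw [coxeterMat_mulVec_stdVec (by omega) (by omega)]
  simp only [coxeterMat, block, Fin.ext_iff, Fin.lt_def, Pi.add_apply, Pi.smul_apply, stdVec,
    smul_eq_mul]
  by_cases hb : (b.val + 1) / 2 = l
  · rw [hb, show (2 * l + 1 - 1 + 1) / 2 = l by omega, if_pos rfl]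
    rcases (show b.val + 1 = 2 * l ∨ b.val + 1 = 2 * l + 1 by omega) with h | h
    · rw [if_neg (show ¬ (b.val = 2 * l + 1 - 1) by omega),
        if_pos (show b.val < 2 * l + 1 - 1 by omega), if_pos h,
        if_neg (show ¬ (b.val + 1 = 2 * l + 1) by omega)]
      ring
    · rw [if_pos (show b.val = 2 * l + 1 - 1 by omega), if_pos h,
        if_neg (show ¬ (b.val + 1 = 2 * l) by omega)]
      ring
  · rw [if_neg (by omega), if_neg (by omega), if_neg (by omega)]
    ring

theorem coxeterMat_mulVec_even' {l : ℕ} (h2 : l ≤ n) :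
    coxeterMat n *ᵥ stdVec n ℂ (2 * l) = (Real.cos (l * Real.pi / n) : ℂ) • stdVec n ℂ (2 * l) -
      (Real.sin (l * Real.pi / n) : ℂ) • stdVec n ℂ (2 * l + 1) := by
  rcases Nat.eq_zero_or_pos l with rfl | h
  · simp [stdVec_zero]
  · exact coxeterMat_mulVec_even h h2

theorem isEig_Ep {l : ℕ} (h : l ≤ n) : IsEig n l (Ep n l) := by
  rw [IsEig, Ep, mulVec_add, mulVec_smul, coxeterMat_mulVec_even' h, coxeterMat_mulVec_odd h,
    ev_eq]
  funext a
  simp only [Pi.add_apply, Pi.sub_apply, Pi.smul_apply, smul_eq_mul]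
  linear_combination (-(Real.sin (l * Real.pi / n) : ℂ) * stdVec n ℂ (2 * l + 1) a) * Complex.I_sq

theorem isEig_Em {l : ℕ} (h : l ≤ n) : IsEig n (-l) (Em n l) := by
  rw [IsEig, Em, mulVec_sub, mulVec_smul, coxeterMat_mulVec_even' h, coxeterMat_mulVec_odd h,
    ev_neg_eq]
  funext a
  simp only [Pi.add_apply, Pi.sub_apply, Pi.smul_apply, smul_eq_mul]
  linear_combination (-(Real.sin (l * Real.pi / n) : ℂ) * stdVec n ℂ (2 * l + 1) a) * Complex.I_sq

theorem isEig_last (hn : 1 ≤ n) {k : ℕ} (hk : k = 2 * n ∨ k = 2 * n + 1) :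
    IsEig n n (stdVec n ℂ k) := by
  have hn' : (n : ℝ) ≠ 0 := Nat.cast_ne_zero.mpr (by omega)
  have h1 : (n : ℝ) * Real.pi / n = Real.pi := by field_simp
  rw [IsEig, ev_eq]
  rcases hk with rfl | rfl
  · rw [coxeterMat_mulVec_even hn le_rfl, h1]
    simp
  · rw [coxeterMat_mulVec_odd le_rfl, h1]
    simp

theorem IsBasisEig.isEig (hn : 1 ≤ n) {m : ℤ} {x : Fin (2 * n + 1) → ℂ}
    (h : IsBasisEig n m x) : IsEig n m x := by
  rcases h with ⟨k, hk, rfl, rfl⟩ | ⟨k, -, hk, rfl, rfl⟩ | ⟨rfl | rfl, rfl⟩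
  · exact isEig_Ep hk.le
  · exact isEig_Em hk.le
  · exact isEig_last hn (Or.inl rfl)
  · exact isEig_last hn (Or.inr rfl)

theorem form_std (j k : ℕ) : form (stdVec n ℂ j) (stdVec n ℂ k) =
    if j = k ∧ 1 ≤ j ∧ j ≤ 2 * n + 1 then (if k = 2 * n + 1 then -1 else 1) else 0 := by
  by_cases h : 1 ≤ j ∧ j ≤ 2 * n + 1
  · rw [form_stdVec_stdVec h.1 h.2]
    simp [h]
  · rw [if_neg (by tauto)]
    have : stdVec n ℂ j = 0 := by
      funext a
      simp only [stdVec]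
      rw [if_neg (by omega)]
      rfl
    rw [this, form_zero_left]

theorem form_Ep_Ep {k l : ℕ} (hk : k < n) (h : ¬ (k = 0 ∧ l = 0)) :
    form (Ep n k) (Ep n l) = 0 := by
  simp only [Ep, form_add_left, form_add_right, form_smul_left, form_smul_right, form_std]
  rw [if_neg (show ¬ (2 * k = 2 * l + 1 ∧ 1 ≤ 2 * k ∧ 2 * k ≤ 2 * n + 1) by omega),
    if_neg (show ¬ (2 * k + 1 = 2 * l ∧ 1 ≤ 2 * k + 1 ∧ 2 * k + 1 ≤ 2 * n + 1) by omega)]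
  by_cases hkl : k = l
  · subst hkl
    rw [if_pos (show 2 * k = 2 * k ∧ 1 ≤ 2 * k ∧ 2 * k ≤ 2 * n + 1 by omega),
      if_pos (show 2 * k + 1 = 2 * k + 1 ∧ 1 ≤ 2 * k + 1 ∧ 2 * k + 1 ≤ 2 * n + 1 by omega),
      if_neg (show ¬ (2 * k = 2 * n + 1) by omega),
      if_neg (show ¬ (2 * k + 1 = 2 * n + 1) by omega)]
    linear_combination Complex.I_sq
  · rw [if_neg (by omega), if_neg (by omega)]
    ring

theorem form_Em_Em {k l : ℕ} (hk : k < n) (h : ¬ (k = 0 ∧ l = 0)) :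
    form (Em n k) (Em n l) = 0 := by
  simp only [Em, form_sub_left, form_sub_right, form_smul_left, form_smul_right, form_std]
  rw [if_neg (show ¬ (2 * k = 2 * l + 1 ∧ 1 ≤ 2 * k ∧ 2 * k ≤ 2 * n + 1) by omega),
    if_neg (show ¬ (2 * k + 1 = 2 * l ∧ 1 ≤ 2 * k + 1 ∧ 2 * k + 1 ≤ 2 * n + 1) by omega)]
  by_cases hkl : k = l
  · subst hkl
    rw [if_pos (show 2 * k = 2 * k ∧ 1 ≤ 2 * k ∧ 2 * k ≤ 2 * n + 1 by omega),
      if_pos (show 2 * k + 1 = 2 * k + 1 ∧ 1 ≤ 2 * k + 1 ∧ 2 * k + 1 ≤ 2 * n + 1 by omega),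
      if_neg (show ¬ (2 * k = 2 * n + 1) by omega),
      if_neg (show ¬ (2 * k + 1 = 2 * n + 1) by omega)]
    linear_combination Complex.I_sq
  · rw [if_neg (by omega), if_neg (by omega)]
    ring

theorem form_Em_Ep {k l : ℕ} (hk : k < n) (hk0 : 1 ≤ k) :
    form (Em n k) (Ep n l) = if k = l then 2 else 0 := by
  simp only [Em, Ep, form_sub_left, form_add_right, form_smul_left, form_smul_right, form_std]
  rw [if_neg (show ¬ (2 * k = 2 * l + 1 ∧ 1 ≤ 2 * k ∧ 2 * k ≤ 2 * n + 1) by omega),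
    if_neg (show ¬ (2 * k + 1 = 2 * l ∧ 1 ≤ 2 * k + 1 ∧ 2 * k + 1 ≤ 2 * n + 1) by omega)]
  by_cases hkl : k = l
  · subst hkl
    rw [if_pos (show 2 * k = 2 * k ∧ 1 ≤ 2 * k ∧ 2 * k ≤ 2 * n + 1 by omega),
      if_pos (show 2 * k + 1 = 2 * k + 1 ∧ 1 ≤ 2 * k + 1 ∧ 2 * k + 1 ≤ 2 * n + 1 by omega),
      if_neg (show ¬ (2 * k = 2 * n + 1) by omega),
      if_neg (show ¬ (2 * k + 1 = 2 * n + 1) by omega), if_pos rfl]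
    linear_combination (-1) * Complex.I_sq
  · rw [if_neg (by omega), if_neg (by omega), if_neg hkl]
    ring

theorem form_last_Ep {k l : ℕ} (hl : l < n) (hk : k = 2 * n ∨ k = 2 * n + 1) :
    form (stdVec n ℂ k) (Ep n l) = 0 := by
  simp only [Ep, form_add_right, form_smul_right, form_std]
  rw [if_neg (by omega), if_neg (by omega)]
  ring

theorem form_last_Em {k l : ℕ} (hl : l < n) (hk : k = 2 * n ∨ k = 2 * n + 1) :
    form (stdVec n ℂ k) (Em n l) = 0 := by
  simp only [Em, form_sub_right, form_smul_right, form_std]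
  rw [if_neg (by omega), if_neg (by omega)]
  ring

theorem form_basisEig {m k : ℤ} {x y : Fin (2 * n + 1) → ℂ} (hx : IsBasisEig n m x)
    (hy : IsBasisEig n k y) : form x y = 0 ∨ (2 * n : ℤ) ∣ m + k := by
  rcases hx with ⟨a, ha, rfl, rfl⟩ | ⟨a, ha', ha, rfl, rfl⟩ | ⟨hx, rfl⟩
  · rcases hy with ⟨b, hb, rfl, rfl⟩ | ⟨b, hb', hb, rfl, rfl⟩ | ⟨hy, rfl⟩
    · by_cases h : a = 0 ∧ b = 0
      · right; rw [h.1, h.2]; simp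
      · exact Or.inl (form_Ep_Ep ha h)
    · rw [form_comm, form_Em_Ep hb hb']
      by_cases h : b = a
      · right; rw [h]; simp
      · left; rw [if_neg h]
    · left
      rw [form_comm]
      rcases hy with rfl | rfl
      · exact form_last_Ep ha (Or.inl rfl)
      · exact form_last_Ep ha (Or.inr rfl)
  · rcases hy with ⟨b, hb, rfl, rfl⟩ | ⟨b, hb', hb, rfl, rfl⟩ | ⟨hy, rfl⟩
    · rw [form_Em_Ep ha ha']
      by_cases h : a = b
      · right; rw [h]; simp
      · left; rw [if_neg h]
    · exact Or.inl (form_Em_Em ha (by omega))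
    · left
      rw [form_comm]
      rcases hy with rfl | rfl
      · exact form_last_Em ha (Or.inl rfl)
      · exact form_last_Em ha (Or.inr rfl)
  · rcases hy with ⟨b, hb, rfl, rfl⟩ | ⟨b, hb', hb, rfl, rfl⟩ | ⟨hy, rfl⟩
    · left
      rcases hx with rfl | rfl
      · exact form_last_Ep hb (Or.inl rfl)
      · exact form_last_Ep hb (Or.inr rfl)
    · left
      rcases hx with rfl | rfl
      · exact form_last_Em hb (Or.inl rfl)
      · exact form_last_Em hb (Or.inr rfl)
    · right; exact ⟨1, by ring⟩

theorem upsilon_mul_upsilon {R : Type*} [CommRing R] : upsilon n R * upsilon n R = 1 := by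
  rw [upsilon, diagonal_mul_diagonal, ← diagonal_one]
  congr 1
  funext i
  split_ifs <;> ring

theorem form_mulVec_mulVec {R : Type*} [CommRing R]
    (M N : Matrix (Fin (2 * n + 1)) (Fin (2 * n + 1)) R) (x y : Fin (2 * n + 1) → R) :
    form (M *ᵥ x) (N *ᵥ y) = form x ((upsilon n R * Mᵀ * upsilon n R * N) *ᵥ y) := by
  rw [form, form, mulVec_mulVec, mulVec_mulVec, ← mul_assoc, ← mul_assoc, ← mul_assoc,
    upsilon_mul_upsilon, one_mul, dotProduct_comm, dotProduct_mulVec, ← mulVec_transpose,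
    dotProduct_comm, mulVec_mulVec, mul_assoc]

/-- On eigenvectors of weights m and k the product is multiplied by e^{iπ(m+k)/n}. By
`form_basisEig` either the product is zero or this factor is 1. -/
theorem coxeterMat_isometry (hn : 1 ≤ n) :
    (coxeterMat n)ᵀ * upsilon n ℂ * coxeterMat n = upsilon n ℂ := by
  set K := upsilon n ℂ * (coxeterMat n)ᵀ * upsilon n ℂ * coxeterMat n with hK
  have h1 : K - 1 = 0 := by
    refine matrix_eq_zero_of_basisEig fun k y hy => eq_zero_of_basisEig fun m x hx => ?_
    rw [sub_mulVec, one_mulVec, form_sub_right, hK, ← form_mulVec_mulVec, hx.isEig hn,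
      hy.isEig hn, form_smul_left, form_smul_right, ← mul_assoc, ← ev_add]
    rcases form_basisEig hx hy with h | h
    · rw [h]; ring
    · rw [(ev_eq_one_iff hn _).mpr h]; ring
  have h2 : upsilon n ℂ * K = upsilon n ℂ := by rw [sub_eq_zero.mp h1, mul_one]
  rw [hK, ← mul_assoc, ← mul_assoc, ← mul_assoc, upsilon_mul_upsilon, one_mul] at h2
  exact h2

theorem form_coxeterMat (hn : 1 ≤ n) (x y : Fin (2 * n + 1) → ℂ) :
    form (coxeterMat n *ᵥ x) (coxeterMat n *ᵥ y) = form x y := by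
  rw [form_mulVec_mulVec, mul_assoc, mul_assoc, ← mul_assoc _ (upsilon n ℂ),
    coxeterMat_isometry hn, upsilon_mul_upsilon, one_mulVec]

theorem isUnit_det_coxeterMat (hn : 1 ≤ n) : IsUnit (coxeterMat n).det := by
  have h := congrArg Matrix.det (coxeterMat_isometry hn)
  rw [det_mul, det_mul] at h
  refine isUnit_iff_ne_zero.mpr fun h0 => ?_
  rw [h0, mul_zero] at h
  exact upsilon_det h.symm

theorem sigma_eq_iff (hn : 1 ≤ n) (A : Matrix (Fin (2 * n + 1)) (Fin (2 * n + 1)) ℂ) (c : ℂ) :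
    sigma n A = c • A ↔ coxeterMat n * A = c • (A * coxeterMat n) := by
  have hu := isUnit_det_coxeterMat hn
  rw [sigma]
  constructor
  · intro h
    have h1 := congrArg (fun B => B * coxeterMat n) h
    simp only [mul_assoc, nonsing_inv_mul _ hu, mul_one, smul_mul] at h1
    exact h1
  · intro h
    rw [h, smul_mul, mul_assoc, mul_nonsing_inv _ hu, mul_one]

/-- Skew symmetry for the Minkowski product. -/
def IsSkew (A : Matrix (Fin (2 * n + 1)) (Fin (2 * n + 1)) ℂ) : Prop :=
  Aᵀ * upsilon n ℂ + upsilon n ℂ * A = 0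

theorem isSkew_iff {A : Matrix (Fin (2 * n + 1)) (Fin (2 * n + 1)) ℂ} :
    IsSkew A ↔ ∀ x y, form x (A *ᵥ y) = -form (A *ᵥ x) y := by
  have hu : (upsilon n ℂ)ᵀ = upsilon n ℂ := diagonal_transpose _
  have key : ∀ x y, form x (A *ᵥ y) + form (A *ᵥ x) y =
      dotProduct x ((Aᵀ * upsilon n ℂ + upsilon n ℂ * A) *ᵥ y) := fun x y => by
    rw [add_mulVec, dotProduct_add, form, form, ← mulVec_mulVec y, ← mulVec_mulVec y, add_comm,
      dotProduct_mulVec x Aᵀ, vecMul_transpose]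
  constructor
  · intro h x y
    rw [eq_neg_iff_add_eq_zero, key, h, zero_mulVec, dotProduct_zero]
  · intro h
    have h2 : ∀ y, (Aᵀ * upsilon n ℂ + upsilon n ℂ * A) *ᵥ y = 0 := fun y =>
      dotProduct_eq_zero _ fun x => by
        rw [dotProduct_comm, ← key, h, neg_add_cancel]
    exact matrix_eq_zero_of_basisEig fun _ y _ => h2 y

/-- Applying the isometry `coxeterMat n` to both arguments of ⟨x, A y⟩ multiplies it by
e^{iπ(m+k+j)/n} when A has degree j. Membership in an eigenspace of σ thus becomes a congruence
modulo 2n on the weights of the non-zero matrix coefficients. -/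
theorem inGraded_iff (hn : 1 ≤ n) (j : ℕ) (A : Matrix (Fin (2 * n + 1)) (Fin (2 * n + 1)) ℂ) :
    InGraded n j A ↔ IsSkew A ∧ ∀ m x, IsBasisEig n m x → ∀ k y, IsBasisEig n k y →
      form x (A *ᵥ y) = 0 ∨ (2 * n : ℤ) ∣ m + k + j := by
  have he : Complex.exp (2 * Real.pi * Complex.I * j / (2 * n)) = ev n j := by
    rw [ev]
    congr 1
    have hn' : (n : ℂ) ≠ 0 := Nat.cast_ne_zero.mpr (by omega)
    push_cast
    field_simp
  rw [InGraded, he, sigma_eq_iff hn, ← IsSkew]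
  refine and_congr_right fun _ => ?_
  have key : ∀ m x, IsBasisEig n m x → ∀ k y, IsBasisEig n k y →
      ev n m * form x ((coxeterMat n * A - ev n j • (A * coxeterMat n)) *ᵥ y) =
        (1 - ev n (m + k + j)) * form x (A *ᵥ y) := by
    intro m x hx k y hy
    have h1 := form_coxeterMat hn x (A *ᵥ y)
    rw [hx.isEig hn, form_smul_left] at h1
    rw [sub_mulVec, smul_mulVec, ← mulVec_mulVec, ← mulVec_mulVec, hy.isEig hn, mulVec_smul,
      form_sub_right, form_smul_right, form_smul_right, ev_add, ev_add]
    linear_combination h1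
  constructor
  · intro h m x hx k y hy
    have h1 := key m x hx k y hy
    rw [h, sub_self, zero_mulVec, form_zero_right, mul_zero] at h1
    rcases mul_eq_zero.mp h1.symm with h2 | h2
    · exact Or.inr ((ev_eq_one_iff hn _).mp (sub_eq_zero.mp h2).symm)
    · exact Or.inl h2
  · intro h
    rw [← sub_eq_zero]
    refine matrix_eq_zero_of_basisEig fun k y hy => eq_zero_of_basisEig fun m x hx => ?_
    have h1 := key m x hx k y hy
    refine (mul_eq_zero.mp (h1.trans ?_)).resolve_left (ev_ne_zero m)
    rcases h m x hx k y hy with h2 | h2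
    · rw [h2, mul_zero]
    · rw [(ev_eq_one_iff hn _).mpr h2, sub_self, zero_mul]

end Grading

/-! ### Root vectors -/

section RootVectors

open Matrix

variable {n : ℕ}

theorem IsSkew.apply {A : Matrix (Fin (2 * n + 1)) (Fin (2 * n + 1)) ℂ} (h : IsSkew A)
    (x y : Fin (2 * n + 1) → ℂ) : form x (A *ᵥ y) = -form y (A *ᵥ x) := by
  rw [isSkew_iff.mp h, form_comm]

theorem IsSkew.add {A B : Matrix (Fin (2 * n + 1)) (Fin (2 * n + 1)) ℂ} (hA : IsSkew A)
    (hB : IsSkew B) : IsSkew (A + B) := isSkew_iff.mpr fun x y => by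
  rw [add_mulVec, add_mulVec, form_add_left, form_add_right, isSkew_iff.mp hA, isSkew_iff.mp hB]
  ring

theorem IsSkew.smul {A : Matrix (Fin (2 * n + 1)) (Fin (2 * n + 1)) ℂ} (hA : IsSkew A)
    (c : ℂ) : IsSkew (c • A) := isSkew_iff.mpr fun x y => by
  rw [smul_mulVec, smul_mulVec, form_smul_left, form_smul_right, isSkew_iff.mp hA]
  ring

theorem IsSkew.sub {A B : Matrix (Fin (2 * n + 1)) (Fin (2 * n + 1)) ℂ} (hA : IsSkew A)
    (hB : IsSkew B) : IsSkew (A - B) := isSkew_iff.mpr fun x y => by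
  rw [sub_mulVec, sub_mulVec, form_sub_left, form_sub_right, isSkew_iff.mp hA, isSkew_iff.mp hB]
  ring

theorem elemMat_mulVec {j k : ℕ} (h1 : 1 ≤ k) (h2 : k ≤ 2 * n + 1) (y : Fin (2 * n + 1) → ℂ) :
    elemMat n ℂ j k *ᵥ y = y ⟨k - 1, by omega⟩ • stdVec n ℂ j := by
  funext a
  rw [mulVec, dotProduct, Finset.sum_eq_single ⟨k - 1, by omega⟩]
  · have h : k - 1 + 1 = k := by omega
    simp only [elemMat, h, and_true, Pi.smul_apply, stdVec, smul_eq_mul]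
    ring
  · intro b _ hb
    have : ¬ (b.val + 1 = k) := fun h => hb (Fin.ext (by simp only; omega))
    simp [elemMat, this]
  · simp

theorem br_mulVec {j k : ℕ} (h1 : 1 ≤ j) (h2 : j < k) (h3 : k ≤ 2 * n + 1)
    (y : Fin (2 * n + 1) → ℂ) :
    br n ℂ j k *ᵥ y = form (stdVec n ℂ j) y • stdVec n ℂ k -
      form (stdVec n ℂ k) y • stdVec n ℂ j := by
  rw [form_stdVec h1 (by omega), form_stdVec (by omega) h3, if_neg (by omega), br]
  split_ifs with h
  · rw [add_mulVec, elemMat_mulVec h1 (by omega), elemMat_mulVec (by omega) h3]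
    module
  · rw [sub_mulVec, elemMat_mulVec h1 (by omega), elemMat_mulVec (by omega) h3]
    module

/-- `A` is the infinitesimal rotation `u ∧ w`. -/
def IsWedge (A : Matrix (Fin (2 * n + 1)) (Fin (2 * n + 1)) ℂ) (u w : Fin (2 * n + 1) → ℂ) :
    Prop := ∀ y, A *ᵥ y = form u y • w - form w y • u

theorem IsWedge.isSkew {A : Matrix (Fin (2 * n + 1)) (Fin (2 * n + 1)) ℂ}
    {u w : Fin (2 * n + 1) → ℂ} (h : IsWedge A u w) : IsSkew A := isSkew_iff.mpr fun x y => by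
  rw [h, h, form_sub_left, form_sub_right, form_smul_left, form_smul_right, form_smul_left,
    form_smul_right, form_comm x w, form_comm x u]
  ring

/-- The lower partner of `Ep n l` for the Minkowski product. -/
def lo (n l : ℕ) : Fin (2 * n + 1) → ℂ := if l = 0 then stdVec n ℂ 1 else Em n l

/-- The pairing of `lo n l` with `Ep n l`. -/
def loc (l : ℕ) : ℂ := if l = 0 then Complex.I else 2

theorem loc_ne_zero (l : ℕ) : loc l ≠ 0 := by
  rw [loc]; split_ifs
  · exact Complex.I_ne_zero
  · norm_num

/-- The sign that distinguishes the conventions for `n = 1` and for `n ≥ 2`. -/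
def rsign (n : ℕ) : ℂ := if n = 1 then -1 else 1

theorem rsign_mul_self : rsign n * rsign n = 1 := by
  rw [rsign]; split_ifs <;> norm_num

theorem form_lo_Ep {k l : ℕ} (hk : k < n) :
    form (lo n k) (Ep n l) = if k = l then loc l else 0 := by
  rw [lo, loc]
  split_ifs with h1 h2 h3 h2 h3
  · rw [← h2, h1, Ep_zero, form_smul_right, form_std, if_pos (by omega),
      if_neg (by omega)]
    ring
  · omega
  · rw [Ep, form_add_right, form_smul_right, form_std, form_std, if_neg (by omega),
      if_neg (by omega)]
    ring
  · omega
  · rw [form_Em_Ep hk (by omega), if_pos h2]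
  · rw [form_Em_Ep hk (by omega), if_neg h2]

/-- For k > 1 the four terms of the root vector are the expansion of (e_{2k-2} - i e_{2k-1}) ∧
(e_{2k} + i e_{2k+1}). For k = 1 the first factor is e_1. -/
theorem isWedge_rootVec {k : ℕ} (h1 : 1 ≤ k) (h2 : k < n) :
    IsWedge (rootVec n k) (lo n (k - 1)) (Ep n k) := by
  intro y
  rw [rootVec, if_neg (by omega), if_neg (by omega)]
  by_cases hk : k = 1
  · subst hk
    rw [if_pos rfl, lo, if_pos rfl, add_mulVec, smul_mulVec, br_mulVec le_rfl (by omega) (by omega),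
      br_mulVec le_rfl (by omega) (by omega), Ep, form_add_left, form_smul_left]
    module
  · rw [if_neg hk, if_neg (by omega), lo, if_neg (by omega)]
    simp only [add_mulVec, sub_mulVec, smul_mulVec]
    rw [br_mulVec (by omega) (by omega) (by omega), br_mulVec (by omega) (by omega) (by omega),
      br_mulVec (by omega) (by omega) (by omega), br_mulVec (by omega) (by omega) (by omega), Ep,
      Em, show 2 * (k - 1) = 2 * k - 2 by omega, show 2 * k - 2 + 1 = 2 * k - 1 by omega,
      form_add_left, form_smul_left, form_sub_left, form_smul_left]
    funext a
    simp only [Pi.add_apply, Pi.sub_apply, Pi.smul_apply, smul_eq_mul]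
    linear_combination (form (stdVec n ℂ (2 * k - 1)) y * stdVec n ℂ (2 * k + 1) a -
      form (stdVec n ℂ (2 * k + 1)) y * stdVec n ℂ (2 * k - 1) a) * Complex.I_sq

theorem isWedge_rootVec_top (hn : 1 ≤ n) :
    IsWedge (rootVec n n) (lo n (n - 1))
      (stdVec n ℂ (2 * n) - rsign n • stdVec n ℂ (2 * n + 1)) := by
  intro y
  rw [rootVec, rsign, lo]
  by_cases h : n = 1
  · subst h
    rw [if_pos rfl, if_neg one_ne_zero, if_pos rfl, if_pos rfl, add_mulVec,
      br_mulVec le_rfl (by omega) (by omega), br_mulVec le_rfl (by omega) (by omega),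
      form_sub_left, form_smul_left]
    module
  · rw [if_neg h, if_neg (by omega), if_neg h, if_pos rfl, if_neg (by omega), if_neg h]
    simp only [add_mulVec, sub_mulVec, smul_mulVec]
    rw [br_mulVec (by omega) (by omega) (by omega), br_mulVec (by omega) (by omega) (by omega),
      br_mulVec (by omega) (by omega) (by omega), br_mulVec (by omega) (by omega) (by omega),
      Em, show 2 * (n - 1) = 2 * n - 2 by omega, show 2 * n - 2 + 1 = 2 * n - 1 by omega,
      form_sub_left, form_smul_left, form_sub_left, form_smul_left]
    module

theorem isWedge_rootVec_zero (hn : 1 ≤ n) :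
    IsWedge (rootVec n 0) (lo n (n - 1))
      (stdVec n ℂ (2 * n) + rsign n • stdVec n ℂ (2 * n + 1)) := by
  intro y
  rw [rootVec, rsign, lo]
  by_cases h : n = 1
  · subst h
    rw [if_pos rfl, if_pos rfl, if_pos rfl, if_pos rfl, sub_mulVec,
      br_mulVec le_rfl (by omega) (by omega), br_mulVec le_rfl (by omega) (by omega),
      form_add_left, form_smul_left]
    module
  · rw [if_neg h, if_pos rfl, if_neg (by omega), if_neg h]
    simp only [add_mulVec, sub_mulVec, smul_mulVec]
    rw [br_mulVec (by omega) (by omega) (by omega), br_mulVec (by omega) (by omega) (by omega),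
      br_mulVec (by omega) (by omega) (by omega), br_mulVec (by omega) (by omega) (by omega),
      Em, show 2 * (n - 1) = 2 * n - 2 by omega, show 2 * n - 2 + 1 = 2 * n - 1 by omega,
      form_add_left, form_smul_left, form_sub_left, form_smul_left]
    module

/-- `u` pairs trivially with the basis vectors whose weight is not opposite to `m`. -/
def HasWeight (n : ℕ) (m : ℤ) (u : Fin (2 * n + 1) → ℂ) : Prop :=
  ∀ k y, IsBasisEig n k y → form u y = 0 ∨ (2 * n : ℤ) ∣ m + k

theorem HasWeight.smul {m : ℤ} {u : Fin (2 * n + 1) → ℂ} (h : HasWeight n m u) (c : ℂ) :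
    HasWeight n m (c • u) := fun k y hy => (h k y hy).imp_left fun h => by
  rw [form_smul_left, h, mul_zero]

theorem HasWeight.add {m : ℤ} {u v : Fin (2 * n + 1) → ℂ} (h : HasWeight n m u)
    (h' : HasWeight n m v) : HasWeight n m (u + v) := fun k y hy => by
  rcases h k y hy with h1 | h1
  · exact (h' k y hy).imp_left fun h2 => by rw [form_add_left, h1, h2, add_zero]
  · exact Or.inr h1

theorem HasWeight.sub {m : ℤ} {u v : Fin (2 * n + 1) → ℂ} (h : HasWeight n m u)
    (h' : HasWeight n m v) : HasWeight n m (u - v) := fun k y hy => by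
  rcases h k y hy with h1 | h1
  · exact (h' k y hy).imp_left fun h2 => by rw [form_sub_left, h1, h2, sub_zero]
  · exact Or.inr h1

theorem IsBasisEig.hasWeight {m : ℤ} {u : Fin (2 * n + 1) → ℂ} (h : IsBasisEig n m u) :
    HasWeight n m u := fun _ _ hy => form_basisEig h hy

theorem isBasisEig_Ep {l : ℕ} (h : l < n) : IsBasisEig n l (Ep n l) := Or.inl ⟨l, h, rfl, rfl⟩

theorem isBasisEig_Em {l : ℕ} (h1 : 1 ≤ l) (h : l < n) : IsBasisEig n (-l) (Em n l) :=
  Or.inr (Or.inl ⟨l, h1, h, rfl, rfl⟩)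

theorem isBasisEig_last {k : ℕ} (hk : k = 2 * n ∨ k = 2 * n + 1) :
    IsBasisEig n n (stdVec n ℂ k) :=
  Or.inr (Or.inr ⟨hk.imp (fun h => by rw [h]) fun h => by rw [h], rfl⟩)

theorem hasWeight_lo {l : ℕ} (h : l < n) : HasWeight n (-l) (lo n l) := by
  rw [lo]
  split_ifs with h0
  · subst h0
    have h1 := (isBasisEig_Ep h).hasWeight.smul (-Complex.I)
    rw [Ep_zero, smul_smul, neg_mul, Complex.I_mul_I, neg_neg, one_smul] at h1
    simpa using h1
  · exact (isBasisEig_Em (by omega) h).hasWeight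

/-- Weights add under the wedge. Every root vector is a wedge of weights -(l - 1) and l for some l,
and so has degree one. -/
theorem IsWedge.inGraded_one (hn : 1 ≤ n) {A : Matrix (Fin (2 * n + 1)) (Fin (2 * n + 1)) ℂ}
    {u w : Fin (2 * n + 1) → ℂ} (h : IsWedge A u w) {a b : ℤ} (hu : HasWeight n a u)
    (hw : HasWeight n b w) (hab : a + b = 1) : InGraded n 1 A := by
  refine (inGraded_iff hn 1 A).mpr ⟨h.isSkew, fun m x hx k y hy => ?_⟩
  rw [h, form_sub_right, form_smul_right, form_smul_right, form_comm x w, form_comm x u]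
  have key : ∀ p q : ℤ, p + q = 1 → (2 * n : ℤ) ∣ p + k → (2 * n : ℤ) ∣ q + m →
      (2 * n : ℤ) ∣ m + k + (1 : ℕ) := fun p q hpq h1 h2 => by
    have h3 := dvd_add h1 h2
    rwa [show p + k + (q + m) = m + k + (1 : ℕ) by push_cast; linarith] at h3
  rcases hu k y hy with h1 | h1
  · rcases hw k y hy with h2 | h2
    · left; rw [h1, h2]; ring
    · rcases hu m x hx with h3 | h3
      · left; rw [h1, h3]; ring
      · exact Or.inr (key b a (by linarith) h2 h3)
  · rcases hw m x hx with h2 | h2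
    · rcases hw k y hy with h3 | h3
      · left; rw [h2, h3]; ring
      · rcases hu m x hx with h4 | h4
        · left; rw [h2, h4]; ring
        · exact Or.inr (key b a (by linarith) h3 h4)
    · exact Or.inr (key a b hab h1 h2)

theorem inGraded_one_rootVec (hn : 1 ≤ n) {k : ℕ} (hk : k ≤ n) : InGraded n 1 (rootVec n k) := by
  have hl : HasWeight n (-((n - 1 : ℕ) : ℤ)) (lo n (n - 1)) := hasWeight_lo (by omega)
  have h1 := (isBasisEig_last (n := n) (Or.inl rfl)).hasWeight
  have h2 := (isBasisEig_last (n := n) (Or.inr rfl)).hasWeight.smul (rsign n)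
  rcases Nat.eq_zero_or_pos k with rfl | h0
  · exact (isWedge_rootVec_zero hn).inGraded_one hn hl (h1.add h2) (by push_cast [hn]; ring)
  · rcases hk.lt_or_eq with h | rfl
    · exact (isWedge_rootVec h0 h).inGraded_one hn (hasWeight_lo (by omega))
        (isBasisEig_Ep h).hasWeight (by push_cast [h0]; ring)
    · exact (isWedge_rootVec_top hn).inGraded_one hn hl (h1.sub h2) (by push_cast [hn]; ring)

/-- The combination `∑ c_k R_{α_k}`. -/
def rootSum (n : ℕ) (c : ℕ → ℂ) : Matrix (Fin (2 * n + 1)) (Fin (2 * n + 1)) ℂ :=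
  ∑ k ∈ Finset.range (n + 1), c k • rootVec n k

theorem inGraded_one_rootSum (hn : 1 ≤ n) (c : ℕ → ℂ) : InGraded n 1 (rootSum n c) := by
  refine Finset.sum_induction _ (InGraded n 1) (fun A B hA hB => ?_) ?_ fun k hk => ?_
  · rw [inGraded_iff hn] at *
    refine ⟨hA.1.add hB.1, fun m x hx k y hy => ?_⟩
    rcases hA.2 m x hx k y hy with h1 | h1
    · exact (hB.2 m x hx k y hy).imp_left fun h2 => by
        rw [add_mulVec, form_add_right, h1, h2, add_zero]
    · exact Or.inr h1
  · rw [inGraded_iff hn]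
    exact ⟨isSkew_iff.mpr fun x y => by simp [form_zero_left, form_zero_right],
      fun m x hx k y hy => Or.inl (by rw [zero_mulVec, form_zero_right])⟩
  · have h := inGraded_one_rootVec hn (Finset.mem_range_succ_iff.mp hk)
    rw [inGraded_iff hn] at *
    exact ⟨h.1.smul _, fun m x hx k y hy => (h.2 m x hx k y hy).imp_left fun h2 => by
      rw [smul_mulVec, form_smul_right, h2, mul_zero]⟩

theorem sum_mulVec_apply (c : ℕ → ℂ) (y : Fin (2 * n + 1) → ℂ) :
    rootSum n c *ᵥ y = ∑ k ∈ Finset.range (n + 1), c k • (rootVec n k *ᵥ y) := by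
  rw [rootSum, sum_mulVec]
  exact Finset.sum_congr rfl fun k _ => smul_mulVec _ _ _

theorem rootVec_mulVec_Ep {k l : ℕ} (h1 : 1 ≤ k) (h2 : k < n) :
    rootVec n k *ᵥ Ep n l = if k = l + 1 then loc l • Ep n k else 0 := by
  rw [isWedge_rootVec h1 h2, form_lo_Ep (by omega), form_Ep_Ep h2 (by omega), zero_smul, sub_zero]
  split_ifs <;> first | rfl | omega | exact zero_smul _ _

theorem form_last_combination_Ep {l : ℕ} (hl : l < n) (c : ℂ) :
    form (stdVec n ℂ (2 * n) + c • stdVec n ℂ (2 * n + 1)) (Ep n l) = 0 := by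
  rw [form_add_left, form_smul_left, form_last_Ep hl (Or.inl rfl), form_last_Ep hl (Or.inr rfl)]
  ring

theorem rootVec_top_mulVec_Ep (hn : 1 ≤ n) {l : ℕ} (hl : l < n) :
    rootVec n n *ᵥ Ep n l = if l = n - 1 then
      loc l • (stdVec n ℂ (2 * n) - rsign n • stdVec n ℂ (2 * n + 1)) else 0 := by
  rw [isWedge_rootVec_top hn, form_lo_Ep (by omega), sub_eq_add_neg (stdVec n ℂ (2 * n)),
    ← neg_smul, form_last_combination_Ep hl, zero_smul, sub_zero]
  split_ifs <;> first | rfl | omega | exact zero_smul _ _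

theorem rootVec_zero_mulVec_Ep (hn : 1 ≤ n) {l : ℕ} (hl : l < n) :
    rootVec n 0 *ᵥ Ep n l = if l = n - 1 then
      loc l • (stdVec n ℂ (2 * n) + rsign n • stdVec n ℂ (2 * n + 1)) else 0 := by
  rw [isWedge_rootVec_zero hn, form_lo_Ep (by omega), form_last_combination_Ep hl, zero_smul,
    sub_zero]
  split_ifs <;> first | rfl | omega | exact zero_smul _ _

/-- The root vectors raise the index of `Ep` by one. Below the top only `rootVec n (l + 1)` acts
non-trivially on `Ep n l`, since the wedge factor `lo n (k - 1)` pairs only with `Ep n (k - 1)`. -/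
theorem rootSum_mulVec_Ep (c : ℕ → ℂ) {l : ℕ} (hl : l + 1 < n) :
    rootSum n c *ᵥ Ep n l = (loc l * c (l + 1)) • Ep n (l + 1) := by
  rw [sum_mulVec_apply, Finset.sum_eq_single (l + 1)]
  · rw [rootVec_mulVec_Ep (by omega) hl, if_pos rfl, smul_smul,
      mul_comm (c _)]
  · intro k hk hkl
    have hk' := Finset.mem_range_succ_iff.mp hk
    rcases Nat.eq_zero_or_pos k with rfl | h0
    · rw [rootVec_zero_mulVec_Ep (by omega) (by omega), if_neg (by omega), smul_zero]
    · rcases hk'.lt_or_eq with h | rfl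
      · rw [rootVec_mulVec_Ep h0 h, if_neg hkl, smul_zero]
      · rw [rootVec_top_mulVec_Ep (by omega) (by omega), if_neg (by omega), smul_zero]
  · exact fun h => absurd (Finset.mem_range_succ_iff.mpr (by omega)) h

theorem rootSum_mulVec_Ep_top (hn : 1 ≤ n) (c : ℕ → ℂ) :
    rootSum n c *ᵥ Ep n (n - 1) = loc (n - 1) • ((c n + c 0) • stdVec n ℂ (2 * n) +
      (rsign n * (c 0 - c n)) • stdVec n ℂ (2 * n + 1)) := by
  rw [sum_mulVec_apply, Finset.sum_range_succ, Finset.sum_eq_single 0]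
  · rw [rootVec_zero_mulVec_Ep hn (by omega), rootVec_top_mulVec_Ep hn (by omega), if_pos rfl,
      if_pos rfl]
    module
  · intro k hk h0
    have := Finset.mem_range.mp hk
    rw [rootVec_mulVec_Ep (by omega) this, if_neg (by omega), smul_zero]
  · exact fun h => absurd (Finset.mem_range.mpr hn) h

theorem not_dvd_of_lt {m : ℤ} (h0 : m ≠ 0) (h1 : -(2 * n : ℤ) < m) (h2 : m < 2 * n) :
    ¬ (2 * n : ℤ) ∣ m := fun h => by
  rcases lt_or_gt_of_ne h0 with h3 | h3
  · have := Int.le_of_dvd (by linarith) ((dvd_neg).mpr h)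
    linarith
  · have := Int.le_of_dvd h3 h
    linarith

/-- The conditions on an element of `𝔰𝔬(2n,1,ℂ)` that put it into `𝔤_0 ⊕ 𝔤_1`. -/
structure IsPrimitiveElement (α : Matrix (Fin (2 * n + 1)) (Fin (2 * n + 1)) ℂ) : Prop where
  skew : IsSkew α
  pp : ∀ k l, k < n → l < n → ¬ (k = 0 ∧ l = 0) → form (Ep n k) (α *ᵥ Ep n l) = 0
  mp : ∀ k l, 1 ≤ k → k < n → l < n → k ≠ l → k ≠ l + 1 → form (Em n k) (α *ᵥ Ep n l) = 0
  lp : ∀ k l, (k = 2 * n ∨ k = 2 * n + 1) → l + 1 < n → form (stdVec n ℂ k) (α *ᵥ Ep n l) = 0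
  mm : ∀ k l, 1 ≤ k → 1 ≤ l → k < n → l < n → form (Em n k) (α *ᵥ Em n l) = 0
  lm : ∀ k l, (k = 2 * n ∨ k = 2 * n + 1) → 1 ≤ l → l < n →
    form (stdVec n ℂ k) (α *ᵥ Em n l) = 0

/-- In each listed pair the sum of the weights is congruent to neither 0 nor -1 modulo 2n, so
neither graded component contributes. -/
theorem isPrimitiveElement_add (hn : 1 ≤ n)
    {A₀ A₁ : Matrix (Fin (2 * n + 1)) (Fin (2 * n + 1)) ℂ} (h₀ : InGraded n 0 A₀)
    (h₁ : InGraded n 1 A₁) : IsPrimitiveElement (A₀ + A₁) := by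
  rw [inGraded_iff hn] at h₀ h₁
  have key : ∀ m x, IsBasisEig n m x → ∀ k y, IsBasisEig n k y → m + k ≠ 0 → m + k + 1 ≠ 0 →
      -(2 * n : ℤ) < m + k → m + k + 1 < 2 * n → form x ((A₀ + A₁) *ᵥ y) = 0 := by
    intro m x hx k y hy a1 a2 a3 a4
    rw [add_mulVec, form_add_right, (h₀.2 m x hx k y hy).resolve_right,
      (h₁.2 m x hx k y hy).resolve_right, add_zero]
    · exact not_dvd_of_lt (by push_cast; omega) (by push_cast; omega) (by push_cast; omega)
    · exact not_dvd_of_lt (by push_cast; omega) (by push_cast; omega) (by push_cast; omega)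
  refine ⟨h₀.1.add h₁.1, ?_, ?_, ?_, ?_, ?_⟩
  · intro k l hk hl h
    exact key _ _ (isBasisEig_Ep hk) _ _ (isBasisEig_Ep hl) (by omega) (by omega) (by omega)
      (by omega)
  · intro k l h1 hk hl h2 h3
    exact key _ _ (isBasisEig_Em h1 hk) _ _ (isBasisEig_Ep hl) (by omega) (by omega) (by omega)
      (by omega)
  · intro k l hk hl
    exact key _ _ (isBasisEig_last hk) _ _ (isBasisEig_Ep (by omega)) (by omega) (by omega)
      (by omega) (by omega)
  · intro k l h1 h2 hk hl
    by_cases h : k = l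
    · subst h
      have := (h₀.1.add h₁.1).apply (Em n k) (Em n k)
      linear_combination (1 / 2) * this
    · exact key _ _ (isBasisEig_Em h1 hk) _ _ (isBasisEig_Em h2 hl) (by omega) (by omega)
        (by omega) (by omega)
  · intro k l hk h1 hl
    exact key _ _ (isBasisEig_last hk) _ _ (isBasisEig_Em h1 hl) (by omega) (by omega)
      (by omega) (by omega)

theorem form_last_mulVec_Ep_top (hn : 1 ≤ n) (c : ℕ → ℂ) :
    form (stdVec n ℂ (2 * n)) (rootSum n c *ᵥ Ep n (n - 1)) = loc (n - 1) * (c n + c 0) ∧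
    form (stdVec n ℂ (2 * n + 1)) (rootSum n c *ᵥ Ep n (n - 1)) =
      -(loc (n - 1) * (rsign n * (c 0 - c n))) := by
  rw [rootSum_mulVec_Ep_top hn]
  simp only [form_smul_right, form_add_right]
  rw [form_std, form_std, form_std, form_std,
    if_pos (show 2 * n = 2 * n ∧ 1 ≤ 2 * n ∧ 2 * n ≤ 2 * n + 1 by omega),
    if_neg (show ¬ (2 * n = 2 * n + 1) by omega),
    if_neg (show ¬ (2 * n = 2 * n + 1 ∧ 1 ≤ 2 * n ∧ 2 * n ≤ 2 * n + 1) by omega),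
    if_neg (show ¬ (2 * n + 1 = 2 * n ∧ 1 ≤ 2 * n + 1 ∧ 2 * n + 1 ≤ 2 * n + 1) by omega),
    if_pos (show 2 * n + 1 = 2 * n + 1 ∧ 1 ≤ 2 * n + 1 ∧ 2 * n + 1 ≤ 2 * n + 1 by omega),
    if_pos rfl]
  constructor <;> ring

theorem form_Em_rootSum (c : ℕ → ℂ) {l : ℕ} (hl : l + 1 < n) :
    form (Em n (l + 1)) (rootSum n c *ᵥ Ep n l) = 2 * (loc l * c (l + 1)) := by
  rw [rootSum_mulVec_Ep c hl, form_smul_right, form_Em_Ep hl (by omega), if_pos rfl, mul_comm]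

theorem IsPrimitiveElement.exists_rootSum (hn : 1 ≤ n)
    {α : Matrix (Fin (2 * n + 1)) (Fin (2 * n + 1)) ℂ} (h : IsPrimitiveElement α) :
    ∃ c : ℕ → ℂ, InGraded n 0 (α - rootSum n c) := by
  -- a and b are the values that c_n + c_0 and c_0 - c_n must take, read off from the e_{2n} and
  -- e_{2n+1} components. The minus sign in b comes from the timelike vector e_{2n+1}.
  set a := form (stdVec n ℂ (2 * n)) (α *ᵥ Ep n (n - 1)) / loc (n - 1) with ha
  set b := -(rsign n * form (stdVec n ℂ (2 * n + 1)) (α *ᵥ Ep n (n - 1))) / loc (n - 1) with hb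
  have hl := loc_ne_zero (n - 1)
  set c : ℕ → ℂ := fun k => if k = 0 then (a + b) / 2 else if k = n then (a - b) / 2 else
    form (Em n k) (α *ᵥ Ep n (k - 1)) / (2 * loc (k - 1)) with hc
  have c0 : c 0 = (a + b) / 2 := by rw [hc]; simp only [if_true]
  have cn : c n = (a - b) / 2 := by
    rw [hc]; simp only [if_true]; rw [if_neg (by omega)]
  refine ⟨c, (inGraded_iff hn 0 _).mpr ?_⟩
  have hs := (inGraded_iff hn 1 _).mp (inGraded_one_rootSum hn c)
  have hsk : IsSkew (α - rootSum n c) := h.skew.sub hs.1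
  have key : ∀ m x, IsBasisEig n m x → ∀ k y, IsBasisEig n k y → m + k + 1 ≠ 0 →
      -(2 * n : ℤ) < m + k + 1 → m + k + 1 < 2 * n → form x (α *ᵥ y) = 0 →
      form x ((α - rootSum n c) *ᵥ y) = 0 := by
    intro m x hx k y hy a1 a2 a3 a4
    rw [sub_mulVec, form_sub_right, a4, (hs.2 m x hx k y hy).resolve_right, sub_zero]
    exact not_dvd_of_lt (by push_cast; omega) (by push_cast; omega) (by push_cast; omega)
  have hEp : ∀ m x, IsBasisEig n m x → ∀ l < n,
      form x ((α - rootSum n c) *ᵥ Ep n l) = 0 ∨ (2 * n : ℤ) ∣ m + l := by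
    rintro m x hx l hl
    rcases hx with ⟨k, hk, rfl, rfl⟩ | ⟨k, h1, hk, rfl, rfl⟩ | ⟨hx, rfl⟩
    · by_cases h0 : k = 0 ∧ l = 0
      · right; rw [h0.1, h0.2]; simp
      · exact Or.inl (key _ _ (isBasisEig_Ep hk) _ _ (isBasisEig_Ep hl) (by omega) (by omega)
          (by omega) (h.pp k l hk hl h0))
    · by_cases h2 : k = l
      · right; rw [h2]; simp
      left
      by_cases h3 : k = l + 1
      · subst h3
        rw [sub_mulVec, form_sub_right, form_Em_rootSum c hk, hc]
        simp only
        rw [if_neg (by omega), if_neg (by omega), add_tsub_cancel_right]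
        have := loc_ne_zero l
        field_simp
        ring
      · exact key _ _ (isBasisEig_Em h1 hk) _ _ (isBasisEig_Ep hl) (by omega) (by omega)
          (by omega) (h.mp k l h1 hk hl h2 h3)
    · left
      by_cases h2 : l = n - 1
      · subst h2
        obtain ⟨e1, e2⟩ := form_last_mulVec_Ep_top hn c
        rcases hx with rfl | rfl
        · rw [sub_mulVec, form_sub_right, e1, c0, cn, ha]
          field_simp
          ring
        · rw [sub_mulVec, form_sub_right, e2, c0, cn, hb]
          have h3 := rsign_mul_self (n := n)
          field_simp
          linear_combination (-2 * form (stdVec n ℂ (2 * n + 1)) (α *ᵥ Ep n (n - 1))) * h3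
      · rcases hx with rfl | rfl
        · exact key _ _ (isBasisEig_last (Or.inl rfl)) _ _ (isBasisEig_Ep hl) (by omega)
            (by omega) (by omega) (h.lp _ l (Or.inl rfl) (by omega))
        · exact key _ _ (isBasisEig_last (Or.inr rfl)) _ _ (isBasisEig_Ep hl) (by omega)
            (by omega) (by omega) (h.lp _ l (Or.inr rfl) (by omega))
  have hlast : ∀ k, (k = 2 * n ∨ k = 2 * n + 1) → ∀ l, 1 ≤ l → l < n →
      form (stdVec n ℂ k) ((α - rootSum n c) *ᵥ Em n l) = 0 := fun k hk l h1 hl =>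
    key _ _ (isBasisEig_last hk) _ _ (isBasisEig_Em h1 hl) (by omega) (by omega) (by omega)
      (h.lm k l hk h1 hl)
  refine ⟨hsk, fun m x hx k y hy => ?_⟩
  rw [Nat.cast_zero, add_zero]
  rcases hy with ⟨l, hl, rfl, rfl⟩ | ⟨l, h1, hl, rfl, rfl⟩ | ⟨hy, rfl⟩
  · exact hEp m x hx l hl
  · rcases hx with ⟨k, hk, rfl, rfl⟩ | ⟨k, h2, hk, rfl, rfl⟩ | ⟨hx, rfl⟩
    · rw [hsk.apply, neg_eq_zero, add_comm (k : ℤ)]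
      exact hEp _ _ (isBasisEig_Em h1 hl) k hk
    · exact Or.inl (key _ _ (isBasisEig_Em h2 hk) _ _ (isBasisEig_Em h1 hl) (by omega)
        (by omega) (by omega) (h.mm k l h2 h1 hk hl))
    · left
      rcases hx with rfl | rfl
      · exact hlast _ (Or.inl rfl) l h1 hl
      · exact hlast _ (Or.inr rfl) l h1 hl
  · rcases hx with ⟨k, hk, rfl, rfl⟩ | ⟨k, h2, hk, rfl, rfl⟩ | ⟨hx, rfl⟩
    · rw [hsk.apply, neg_eq_zero, add_comm (k : ℤ)]
      exact hEp _ _ (Or.inr (Or.inr ⟨hy, rfl⟩)) k hk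
    · left
      rw [hsk.apply, neg_eq_zero]
      rcases hy with rfl | rfl
      · exact hlast _ (Or.inl rfl) k h2 hk
      · exact hlast _ (Or.inr rfl) k h2 hk
    · exact Or.inr ⟨1, by ring⟩

/-- The action of an element of `𝔤_0` on the eigenvectors of positive weight. -/
theorem mulVec_Ep_of_inGraded_zero {β : Matrix (Fin (2 * n + 1)) (Fin (2 * n + 1)) ℂ}
    (h : InGraded n 0 β) {l : ℕ} (hl : l < n) :
    β *ᵥ Ep n l = (if l = 0 then 0 else form (Em n l) (β *ᵥ Ep n l) / 2) • Ep n l := by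
  obtain ⟨hs, h⟩ := (inGraded_iff (by omega) 0 β).mp h
  rw [← sub_eq_zero]
  refine eq_zero_of_basisEig fun m x hx => ?_
  rw [form_sub_right, form_smul_right]
  have h0 := h m x hx _ _ (isBasisEig_Ep hl)
  rw [Nat.cast_zero, add_zero] at h0
  rcases hx with ⟨k, hk, rfl, rfl⟩ | ⟨k, h1, hk, rfl, rfl⟩ | ⟨hx, rfl⟩
  · by_cases h2 : k = 0 ∧ l = 0
    · rw [if_pos h2.2, zero_mul, sub_zero, h2.1, h2.2]
      have := hs.apply (Ep n 0) (Ep n 0)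
      linear_combination (1 / 2) * this
    · rw [form_Ep_Ep hk h2, mul_zero, sub_zero]
      exact h0.resolve_right (not_dvd_of_lt (by omega) (by omega) (by omega))
  · rw [form_Em_Ep hk h1]
    by_cases h2 : k = l
    · subst h2
      rw [if_neg (by omega), if_pos rfl]
      ring
    · rw [if_neg h2, mul_zero, sub_zero]
      exact h0.resolve_right (not_dvd_of_lt (by omega) (by omega) (by omega))
  · have h3 := h0.resolve_right (not_dvd_of_lt (by omega) (by omega) (by omega))
    rw [h3]
    rcases hx with rfl | rfl
    · rw [form_last_Ep hl (Or.inl rfl)]; ring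
    · rw [form_last_Ep hl (Or.inr rfl)]; ring

theorem rootCoeff_eq {α : Matrix (Fin (2 * n + 1)) (Fin (2 * n + 1)) ℂ} {c : ℕ → ℂ}
    (h : InGraded n 0 (α - rootSum n c)) {l : ℕ} (hl : l + 1 < n) :
    form (Em n (l + 1)) (α *ᵥ Ep n l) = 2 * (loc l * c (l + 1)) := by
  have h1 := ((inGraded_iff (by omega) 0 _).mp h).2 _ _ (isBasisEig_Em (by omega) hl) _ _
    (isBasisEig_Ep (show l < n by omega))
  have h2 := h1.resolve_right (not_dvd_of_lt (by push_cast; omega) (by push_cast; omega)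
    (by push_cast; omega))
  rw [sub_mulVec, form_sub_right, form_Em_rootSum c hl] at h2
  exact sub_eq_zero.mp h2

theorem rootCoeff_top_eq (hn : 1 ≤ n) {α : Matrix (Fin (2 * n + 1)) (Fin (2 * n + 1)) ℂ}
    {c : ℕ → ℂ} (h : InGraded n 0 (α - rootSum n c)) :
    form (stdVec n ℂ (2 * n)) (α *ᵥ Ep n (n - 1)) = loc (n - 1) * (c n + c 0) ∧
    form (stdVec n ℂ (2 * n + 1)) (α *ᵥ Ep n (n - 1)) =
      -(loc (n - 1) * (rsign n * (c 0 - c n))) := by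
  obtain ⟨e1, e2⟩ := form_last_mulVec_Ep_top hn c
  have key : ∀ k, (k = 2 * n ∨ k = 2 * n + 1) → form (stdVec n ℂ k) (α *ᵥ Ep n (n - 1)) =
      form (stdVec n ℂ k) (rootSum n c *ᵥ Ep n (n - 1)) := fun k hk => by
    have h1 := ((inGraded_iff hn 0 _).mp h).2 _ _ (isBasisEig_last hk) _ _
      (isBasisEig_Ep (show n - 1 < n by omega))
    have h2 := h1.resolve_right (not_dvd_of_lt (by push_cast; omega) (by push_cast; omega)
      (by push_cast; omega))
    rw [sub_mulVec, form_sub_right] at h2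
    exact sub_eq_zero.mp h2
  exact ⟨(key _ (Or.inl rfl)).trans e1, (key _ (Or.inr rfl)).trans e2⟩

/-- The coefficients can be recovered from matrix coefficients of α to which 𝔤_0 does not
contribute. -/
theorem rootCoeff_unique (hn : 1 ≤ n) {α : Matrix (Fin (2 * n + 1)) (Fin (2 * n + 1)) ℂ}
    {c c' : ℕ → ℂ} (h : InGraded n 0 (α - rootSum n c)) (h' : InGraded n 0 (α - rootSum n c'))
    {k : ℕ} (hk : k ≤ n) : c k = c' k := by
  have hl := loc_ne_zero (n - 1)
  have hr : rsign n ≠ 0 := fun h0 => by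
    have := rsign_mul_self (n := n)
    rw [h0] at this
    simp at this
  obtain ⟨a1, a2⟩ := rootCoeff_top_eq hn h
  obtain ⟨b1, b2⟩ := rootCoeff_top_eq hn h'
  rw [a1] at b1
  rw [a2] at b2
  have b3 := mul_left_cancel₀ hl b1
  have b4 := mul_left_cancel₀ hr (mul_left_cancel₀ hl (neg_injective b2))
  rcases Nat.eq_zero_or_pos k with rfl | h0
  · linear_combination (1 / 2) * b3 + (1 / 2) * b4
  · rcases hk.lt_or_eq with h1 | rfl
    · obtain ⟨l, rfl⟩ : ∃ l, k = l + 1 := ⟨k - 1, by omega⟩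
      have e := (rootCoeff_eq h h1).symm.trans (rootCoeff_eq h' h1)
      exact mul_left_cancel₀ (loc_ne_zero l) (mul_left_cancel₀ two_ne_zero e)
    · linear_combination (1 / 2) * b3 - (1 / 2) * b4

end RootVectors

/-! ### Completion of an orthonormal family -/

section CrossProduct

open Matrix

variable {n : ℕ} {R : Type*} [CommRing R]

theorem upsilon_det_mul_self : (upsilon n R).det * (upsilon n R).det = 1 := by
  rw [← det_mul, upsilon_mul_upsilon, det_one]

theorem transpose_mul_upsilon_mul_apply (M N : Matrix (Fin (2 * n + 1)) (Fin (2 * n + 1)) R)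
    (j k : Fin (2 * n + 1)) : (Mᵀ * upsilon n R * N) j k = form (M.col j) (N.col k) := by
  rw [mul_assoc]
  rfl

/-- The generalized cross product of the columns of `M` other than the column `p`. -/
def cross (M : Matrix (Fin (2 * n + 1)) (Fin (2 * n + 1)) R) (p : Fin (2 * n + 1)) :
    Fin (2 * n + 1) → R := upsilon n R *ᵥ M.adjugate p

theorem form_cross (M : Matrix (Fin (2 * n + 1)) (Fin (2 * n + 1)) R) (p : Fin (2 * n + 1))
    (y : Fin (2 * n + 1) → R) : form (cross M p) y = (M.updateCol p y).det := by
  rw [form_comm, form, cross, mulVec_mulVec, upsilon_mul_upsilon, one_mulVec, dotProduct_comm,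
    ← cramer_apply, cramer_eq_adjugate_mulVec]
  rfl

theorem vmap_cross {S : Type*} [CommRing S] (φ : R →+* S)
    (M : Matrix (Fin (2 * n + 1)) (Fin (2 * n + 1)) R) (p : Fin (2 * n + 1)) :
    vmap φ (cross M p) = cross (φ.mapMatrix M) p := by
  funext i
  have h := congrFun (congrFun (RingHom.map_adjugate φ M) p) i
  rw [RingHom.mapMatrix_apply, map_apply] at h
  simp only [cross, vmap_apply, upsilon, mulVec_diagonal, map_mul, h]
  split_ifs <;> simp

/-- The columns of `M` other than the column `p` are orthonormal. -/
def OrthonormalOff (M : Matrix (Fin (2 * n + 1)) (Fin (2 * n + 1)) R) (p : Fin (2 * n + 1)) :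
    Prop := ∀ j k, j ≠ p → k ≠ p → form (M.col j) (M.col k) = upsilon n R j k

variable {M : Matrix (Fin (2 * n + 1)) (Fin (2 * n + 1)) R} {p : Fin (2 * n + 1)}

theorem form_cross_col {k : Fin (2 * n + 1)} (hk : k ≠ p) : form (cross M p) (M.col k) = 0 := by
  rw [form_cross]
  refine det_zero_of_column_eq hk fun i => ?_
  rw [updateCol_ne hk, updateCol_self]
  rfl

theorem updateCol_isometry (hM : OrthonormalOff M p) (hp : p ≠ Fin.last (2 * n))
    {y : Fin (2 * n + 1) → R} (hy : ∀ k, k ≠ p → form y (M.col k) = 0) :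
    (M.updateCol p y)ᵀ * upsilon n R * M.updateCol p y =
      upsilon n R * diagonal fun k => if k = p then form y y else 1 := by
  have hc : ∀ k, k ≠ p → (M.updateCol p y).col k = M.col k := fun k hk => funext fun i => by
    simp [hk]
  have hp' : (M.updateCol p y).col p = y := funext fun i => by simp
  ext j k
  rw [transpose_mul_upsilon_mul_apply, mul_diagonal]
  by_cases hj : j = p
  · by_cases hk : k = p
    · subst hj hk
      rw [hp', upsilon, diagonal_apply_eq, if_neg hp, if_pos rfl, one_mul]
    · subst hj
      rw [hp', hc k hk, hy k hk, upsilon, diagonal_apply_ne _ (Ne.symm hk), zero_mul]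
  · by_cases hk : k = p
    · subst hk
      rw [hp', hc j hj, form_comm, hy j hj, upsilon, diagonal_apply_ne _ hj, zero_mul]
    · rw [hc k hk, hc j hj, hM j k hj hk, if_neg hk, mul_one]

/-- The Gram matrix of the columns is υ times a diagonal matrix with one entry ⟨y, y⟩. The
determinant of υ squares to 1 and can be cancelled over any commutative ring. -/
theorem det_updateCol_sq (hM : OrthonormalOff M p) (hp : p ≠ Fin.last (2 * n))
    {y : Fin (2 * n + 1) → R} (hy : ∀ k, k ≠ p → form y (M.col k) = 0) :
    (M.updateCol p y).det ^ 2 = form y y := by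
  have h := congrArg Matrix.det (updateCol_isometry hM hp hy)
  rw [det_mul, det_mul, det_mul, det_transpose, det_diagonal, Finset.prod_ite_eq' Finset.univ p,
    if_pos (Finset.mem_univ p)] at h
  have h2 := upsilon_det_mul_self (n := n) (R := R)
  linear_combination (upsilon n R).det * h -
    ((M.updateCol p y).det ^ 2 - form y y) * h2

theorem upsilon_apply_mul_self (k : Fin (2 * n + 1)) : upsilon n R k k * upsilon n R k k = 1 := by
  rw [upsilon, diagonal_apply_eq]
  split_ifs <;> ring

theorem form_single (y : Fin (2 * n + 1) → R) (i : Fin (2 * n + 1)) :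
    form y (Pi.single i 1) = upsilon n R i i * y i := by
  rw [form, upsilon, mulVec_single_one]
  rw [dotProduct, Finset.sum_eq_single i]
  · rw [col_apply, mul_comm]
  · intro b _ hb
    rw [col_apply, diagonal_apply_ne _ hb, mul_zero]
  · simp

/-- Let y be the i-th coordinate vector minus its projection to the given columns. Pairing the cross
product with y gives a determinant and also, up to sign, the i-th coordinate of the cross product.
By `det_updateCol_sq` its square is ⟨y, y⟩. -/
theorem cross_apply_sq (hM : OrthonormalOff M p) (hp : p ≠ Fin.last (2 * n))
    (i : Fin (2 * n + 1)) : cross M p i ^ 2 =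
      upsilon n R i i - ∑ k ∈ Finset.univ.erase p, upsilon n R k k * M i k ^ 2 := by
  set e : Fin (2 * n + 1) → R := Pi.single i 1
  set a : Fin (2 * n + 1) → R := fun k => upsilon n R k k * form (M.col k) e
  set y := e - ∑ k ∈ Finset.univ.erase p, a k • M.col k with hy
  have ha : ∀ k, a k * form (M.col k) e = upsilon n R k k * M i k ^ 2 := fun k => by
    have h := upsilon_apply_mul_self (R := R) i
    simp only [a, e, form_single, col_apply]
    linear_combination (upsilon n R k k * M i k ^ 2) * h
  have hyk : ∀ k, k ≠ p → form y (M.col k) = 0 := fun k hk => by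
    rw [hy, form_sub_left, form_sum_left, Finset.sum_eq_single k]
    · rw [form_smul_left, hM k k hk hk, form_comm]
      have h := upsilon_apply_mul_self (R := R) k
      simp only [a]
      linear_combination (-form (M.col k) e) * h
    · intro b hb hbk
      rw [form_smul_left, hM b k (Finset.ne_of_mem_erase hb) hk, upsilon,
        diagonal_apply_ne _ hbk, mul_zero]
    · exact fun h => absurd (Finset.mem_erase.mpr ⟨hk, Finset.mem_univ k⟩) h
  have h1 := det_updateCol_sq hM hp hyk
  have h2 : form (cross M p) y = upsilon n R i i * cross M p i := by
    rw [hy, form_sub_right, form_sum_right, Finset.sum_eq_zero, sub_zero, form_single]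
    intro k hk
    rw [form_smul_right, form_cross_col (Finset.ne_of_mem_erase hk), mul_zero]
  have h3 : form y y = form y e := by
    conv_lhs => rw [hy, form_sub_right]
    rw [← hy, form_sum_right, Finset.sum_eq_zero, sub_zero]
    intro k hk
    rw [form_smul_right, hyk k (Finset.ne_of_mem_erase hk), mul_zero]
  have h4 : form y e = upsilon n R i i -
      ∑ k ∈ Finset.univ.erase p, upsilon n R k k * M i k ^ 2 := by
    have he : e i = 1 := Pi.single_eq_same _ _
    rw [hy, form_sub_left, form_sum_left, form_single, he, mul_one]
    congr 1
    exact Finset.sum_congr rfl fun k _ => by rw [form_smul_left, ha]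
  rw [← h4, ← h3, ← h1, ← form_cross, h2]
  have h := upsilon_apply_mul_self (R := R) i
  linear_combination (-cross M p i ^ 2) * h

theorem form_eq_sum_upsilon (x y : Fin (2 * n + 1) → R) :
    form x y = ∑ i, upsilon n R i i * (x i * y i) := by
  rw [form_apply]
  exact Finset.sum_congr rfl fun i _ => by rw [upsilon, diagonal_apply_eq]

/-- Summing `cross_apply_sq` with signs over i gives 2n + 1, minus 1 for each of the 2n normalized
columns. -/
theorem form_cross_self (hM : OrthonormalOff M p) (hp : p ≠ Fin.last (2 * n)) :
    form (cross M p) (cross M p) = 1 := by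
  have h1 : ∀ i, upsilon n R i i * (cross M p i * cross M p i) =
      1 - ∑ k ∈ Finset.univ.erase p, upsilon n R k k * (upsilon n R i i * (M i k * M i k)) := by
    intro i
    have h := upsilon_apply_mul_self (R := R) i
    rw [← pow_two, cross_apply_sq hM hp, mul_sub, h, Finset.mul_sum]
    congr 1
    exact Finset.sum_congr rfl fun k _ => by ring
  have h2 : ∀ k ∈ Finset.univ.erase p,
      ∑ i, upsilon n R k k * (upsilon n R i i * (M i k * M i k)) = 1 := fun k hk => by
    rw [← Finset.mul_sum]
    have h := form_eq_sum_upsilon (M.col k) (M.col k)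
    simp only [col_apply] at h
    rw [← h, hM k k (Finset.ne_of_mem_erase hk) (Finset.ne_of_mem_erase hk),
      upsilon_apply_mul_self]
  rw [form_eq_sum_upsilon, Finset.sum_congr rfl fun i _ => h1 i, Finset.sum_sub_distrib,
    Finset.sum_comm, Finset.sum_congr rfl h2, Finset.sum_const, Finset.sum_const,
    Finset.card_erase_of_mem (Finset.mem_univ p), Finset.card_univ, Fintype.card_fin]
  simp

theorem det_updateCol_cross (hM : OrthonormalOff M p) (hp : p ≠ Fin.last (2 * n)) :
    (M.updateCol p (cross M p)).det = 1 := by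
  rw [← form_cross, form_cross_self hM hp]

theorem updateCol_cross_isometry (hM : OrthonormalOff M p) (hp : p ≠ Fin.last (2 * n)) :
    (M.updateCol p (cross M p))ᵀ * upsilon n R * M.updateCol p (cross M p) = upsilon n R := by
  rw [updateCol_isometry hM hp fun k hk => form_cross_col hk, form_cross_self hM hp]
  simp

end CrossProduct

namespace SmoothFn

open Matrix

variable {n : ℕ}

theorem exists_inv_sqrt {g : SmoothFn} (hg : conj g = g) (hpos : ∀ z, 0 < ((g : ℂ → ℂ) z).re) :
    ∃ u : SmoothFn, conj u = u ∧ u * u * g = 1 := by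
  have hs : ContDiff ℝ ∞ fun z => (((√((g : ℂ → ℂ) z).re)⁻¹ : ℝ) : ℂ) := by
    refine Complex.ofRealCLM.contDiff.comp ?_
    exact ((Complex.reCLM.contDiff.comp g.contDiff).sqrt fun z => (hpos z).ne').inv fun z =>
      (Real.sqrt_pos.mpr (hpos z)).ne'
  refine ⟨⟨_, hs⟩, ext_eval fun z => Complex.conj_ofReal _, ext_eval fun z => ?_⟩
  have h1 : (g : ℂ → ℂ) z = (((g : ℂ → ℂ) z).re : ℂ) := by
    have h := congrArg (eval z) hg
    exact (Complex.conj_eq_iff_re.mp h).symm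
  show (((√((g : ℂ → ℂ) z).re)⁻¹ : ℝ) : ℂ) * (((√((g : ℂ → ℂ) z).re)⁻¹ : ℝ) : ℂ) *
    (g : ℂ → ℂ) z = 1
  rw [h1, ← Complex.ofReal_mul, ← Complex.ofReal_mul, Complex.ofReal_re, ← mul_inv,
    Real.mul_self_sqrt (hpos z).le, inv_mul_cancel₀ (hpos z).ne', Complex.ofReal_one]

/-- A smooth orthonormal family of `2n - 1` spacelike vectors extends to a smooth frame. -/
theorem exists_frame_matrix (hn : 1 ≤ n) (x : Fin (2 * n + 1) → Fin (2 * n + 1) → SmoothFn)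
    (hr : ∀ k, cj (x k) = x k)
    (ho : ∀ j k : Fin (2 * n + 1), j.val < 2 * n - 1 → k.val < 2 * n - 1 →
      form (x j) (x k) = if j = k then 1 else 0) :
    ∃ G : Matrix (Fin (2 * n + 1)) (Fin (2 * n + 1)) SmoothFn,
      (∀ a b, conj (G a b) = G a b) ∧ Gᵀ * upsilon n SmoothFn * G = upsilon n SmoothFn ∧
      G.det = 1 ∧ ∀ k : Fin (2 * n + 1), k.val < 2 * n - 1 → G.col k = x k := by
  set S : Finset (Fin (2 * n + 1)) := Finset.univ.filter fun k => k.val < 2 * n - 1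
  have hS : ∀ {k}, k ∈ S ↔ k.val < 2 * n - 1 := by simp [S]
  set e : Fin (2 * n + 1) → SmoothFn := Pi.single (Fin.last (2 * n)) 1 with he
  have hlast : upsilon n SmoothFn (Fin.last (2 * n)) (Fin.last (2 * n)) = -1 := by
    rw [upsilon, diagonal_apply_eq, if_pos rfl]
  have hxe : ∀ k, form (x k) e = -x k (Fin.last (2 * n)) := fun k => by
    rw [he, form_single, hlast, neg_one_mul]
  -- Removing from e_{2n+1} its components along the spacelike x k leaves a vector with -⟨t₀, t₀⟩ =
  -- 1 + ∑ (x k)_{2n+1}². This is timelike at every point and can be normalized globally.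
  set t₀ := e - ∑ k ∈ S, form (x k) e • x k with ht₀
  have htx : ∀ k ∈ S, form t₀ (x k) = 0 := fun k hk => by
    rw [ht₀, form_sub_left, form_sum_left, Finset.sum_eq_single k]
    · rw [form_smul_left, ho k k (hS.mp hk) (hS.mp hk), if_pos rfl, mul_one, form_comm, sub_self]
    · intro b hb hbk
      rw [form_smul_left, ho b k (hS.mp hb) (hS.mp hk), if_neg hbk, mul_zero]
    · exact fun h => absurd hk h
  have htt : -form t₀ t₀ = 1 + ∑ k ∈ S, x k (Fin.last (2 * n)) ^ 2 := by
    have h1 : form t₀ t₀ = form t₀ e := by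
      conv_lhs => rw [ht₀, form_sub_right]
      rw [← ht₀, form_sum_right, Finset.sum_eq_zero, sub_zero]
      intro k hk
      rw [form_smul_right, htx k hk, mul_zero]
    have h2 : form e e = -1 := by
      conv_lhs => rw [he, form_single, hlast, Pi.single_eq_same, mul_one]
    rw [h1, ht₀, form_sub_left, form_sum_left, h2]
    have h3 : ∀ k ∈ S, form (form (x k) e • x k) e = x k (Fin.last (2 * n)) ^ 2 := fun k _ => by
      rw [form_smul_left, hxe]; ring
    rw [Finset.sum_congr rfl h3]
    ring
  have hcje : cj e = e := by
    funext i
    rw [vmap_apply, he]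
    by_cases hi : i = Fin.last (2 * n)
    · rw [hi, Pi.single_eq_same, map_one]
    · rw [Pi.single_eq_of_ne hi, map_zero]
  have hct : cj t₀ = t₀ := by
    rw [ht₀, map_sub, map_sum, hcje]
    congr 1
    exact Finset.sum_congr rfl fun k _ => by rw [vmap_smul, conj_form, hr, hcje]
  obtain ⟨u, hu, hu1⟩ := exists_inv_sqrt (g := -form t₀ t₀)
    (by rw [map_neg, conj_form, hct]) fun z => by
      have hre : ∀ k, ((x k (Fin.last (2 * n)) : ℂ → ℂ) z).im = 0 := fun k =>
        Complex.conj_eq_iff_im.mp (congrArg (eval z) (congrFun (hr k) (Fin.last (2 * n))))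
      rw [htt, ← eval_apply, map_add, map_one, map_sum, Complex.add_re, Complex.one_re,
        Complex.re_sum]
      refine add_pos_of_pos_of_nonneg one_pos (Finset.sum_nonneg fun k _ => ?_)
      rw [map_pow, pow_two, Complex.mul_re, eval_apply, hre k, mul_zero, sub_zero]
      exact mul_self_nonneg _
  set p : Fin (2 * n + 1) := ⟨2 * n - 1, by omega⟩ with hp
  have hpl : p ≠ Fin.last (2 * n) := fun h => by
    have := congrArg Fin.val h
    simp only [hp, Fin.val_last] at this
    omega
  set M : Matrix (Fin (2 * n + 1)) (Fin (2 * n + 1)) SmoothFn :=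
    Matrix.of fun a k => if k.val < 2 * n - 1 then x k a else u * t₀ a with hM
  have hM1 : ∀ k : Fin (2 * n + 1), k.val < 2 * n - 1 → M.col k = x k := fun k hk =>
    funext fun a => by rw [col_apply, hM, of_apply, if_pos hk]
  have hM2 : ∀ k : Fin (2 * n + 1), ¬ k.val < 2 * n - 1 → M.col k = u • t₀ := fun k hk =>
    funext fun a => by rw [col_apply, hM, of_apply, if_neg hk]; rfl
  have hcase : ∀ k, k ≠ p → k.val < 2 * n - 1 ∨ k = Fin.last (2 * n) := fun k hk => by
    have h1 : k.val ≠ 2 * n - 1 := fun h => hk (Fin.ext h)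
    have h2 := k.isLt
    rcases Nat.lt_or_ge k.val (2 * n - 1) with h | h
    · exact Or.inl h
    · exact Or.inr (Fin.ext (by rw [Fin.val_last]; omega))
  have hll : ¬ (Fin.last (2 * n)).val < 2 * n - 1 := by rw [Fin.val_last]; omega
  have hoff : OrthonormalOff M p := by
    intro j k hj hk
    rcases hcase j hj with h1 | rfl <;> rcases hcase k hk with h2 | rfl
    · rw [hM1 j h1, hM1 k h2, ho j k h1 h2, upsilon, diagonal_apply]
      split_ifs with h3 h4
      · rw [h4] at h1; exact absurd h1 hll
      · rfl
      · rfl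
    · rw [hM1 j h1, hM2 _ hll, form_smul_right, form_comm, htx j (hS.mpr h1), mul_zero, upsilon,
        diagonal_apply_ne]
      rintro rfl
      exact hll h1
    · rw [hM1 k h2, hM2 _ hll, form_smul_left, htx k (hS.mpr h2), mul_zero, upsilon,
        diagonal_apply_ne]
      rintro rfl
      exact hll h2
    · rw [hM2 _ hll, form_smul_left, form_smul_right, hlast]
      linear_combination -hu1
  have hMr : conj.mapMatrix M = M := by
    ext1 a b
    rw [RingHom.mapMatrix_apply, map_apply, hM, of_apply]
    split_ifs
    · exact congrFun (hr b) a
    · rw [map_mul, hu]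
      congr 1
      exact congrFun hct a
  refine ⟨M.updateCol p (cross M p), fun a b => ?_, updateCol_cross_isometry hoff hpl,
    det_updateCol_cross hoff hpl, fun k hk => ?_⟩
  · by_cases hb : b = p
    · subst hb
      rw [updateCol_self]
      have h := congrFun (vmap_cross conj M p) a
      rwa [hMr] at h
    · rw [updateCol_ne hb]
      exact congrFun (congrFun hMr a) b
  · have hkp : k ≠ p := fun h => by
      rw [h] at hk
      simp only [hp] at hk
      omega
    rw [← hM1 k hk]
    funext a
    simp [hkp]

end SmoothFn

/-! ### Smooth frames -/

namespace SmoothFn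

open Matrix

section Scalars

variable {n : ℕ}

theorem form_csmul_left (c : ℂ) (x y : Fin (2 * n + 1) → SmoothFn) :
    form (c • x) y = c • form x y := by
  rw [← algebraMap_smul SmoothFn c x, form_smul_left, ← smul_eq_mul, algebraMap_smul]

theorem form_csmul_right (c : ℂ) (x y : Fin (2 * n + 1) → SmoothFn) :
    form x (c • y) = c • form x y := by
  rw [form_comm, form_csmul_left, form_comm]

theorem cj_csmul {ι : Type*} (c : ℂ) (x : ι → SmoothFn) :
    cj (c • x) = starRingEnd ℂ c • cj x := funext fun i => conj_smul c (x i)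

theorem hsq_csmul (c : ℂ) (x : Fin (2 * n + 1) → SmoothFn) :
    hsq (c • x) = (c * starRingEnd ℂ c) • hsq x := by
  rw [hsq, cj_csmul, form_csmul_left, form_csmul_right, smul_smul, hsq]

end Scalars

variable {n : ℕ} {F : ℂ → SO n}

theorem cmat_one : cmat (1 : SO n) = 1 := by
  rw [cmat, mat_one]
  exact map_one Complex.ofRealHom.mapMatrix

theorem cmat_mul (g h : SO n) : cmat (g * h) = cmat g * cmat h := by
  rw [cmat, mat_mul]
  exact map_mul Complex.ofRealHom.mapMatrix _ _

theorem cmat_mul_inv (g : SO n) : cmat g * cmat g⁻¹ = 1 := by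
  rw [← cmat_mul, mul_inv_cancel, cmat_one]

theorem upsilon_map {R S : Type*} [CommRing R] [CommRing S] (φ : R →+* S) :
    φ.mapMatrix (upsilon n R) = upsilon n S := by
  rw [RingHom.mapMatrix_apply, upsilon, upsilon, diagonal_map (map_zero φ)]
  congr 1
  funext i
  rcases eq_or_ne i (Fin.last (2 * n)) with h | h <;> simp [h]

theorem cmat_isometry (g : SO n) : (cmat g)ᵀ * upsilon n ℂ * cmat g = upsilon n ℂ := by
  have h : (mat g)ᵀ * upsilon n ℝ * mat g = upsilon n ℝ := g.2
  have h1 := congrArg Complex.ofRealHom.mapMatrix h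
  rwa [map_mul, map_mul, upsilon_map] at h1

theorem form_cmat_mulVec (g : SO n) (x y : Fin (2 * n + 1) → ℂ) :
    form (cmat g *ᵥ x) (cmat g *ᵥ y) = form x y := by
  rw [form_mulVec_mulVec, mul_assoc, mul_assoc, ← mul_assoc _ (upsilon n ℂ), cmat_isometry,
    upsilon_mul_upsilon, one_mulVec]

/-- The entries of a smooth frame. -/
def frameEntry (hF : IsSmoothFrame F) (a b : Fin (2 * n + 1)) : SmoothFn :=
  ⟨fun z => cmat (F z) a b, Complex.ofRealCLM.contDiff.comp (hF a b)⟩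

/-- The vector with constant coordinates `x` in a smooth frame. -/
def frameVec (hF : IsSmoothFrame F) :
    (Fin (2 * n + 1) → ℂ) →ₗ[ℂ] (Fin (2 * n + 1) → SmoothFn) where
  toFun x a := ∑ b, x b • frameEntry hF a b
  map_add' x y := funext fun a => by simp [add_smul, Finset.sum_add_distrib]
  map_smul' c x := funext fun a => by simp [Finset.smul_sum, smul_smul]

theorem frameVec_apply (hF : IsSmoothFrame F) (x : Fin (2 * n + 1) → ℂ) (a : Fin (2 * n + 1)) :
    frameVec hF x a = ∑ b, x b • frameEntry hF a b := rfl

theorem eval_csmul (z c : ℂ) (g : SmoothFn) : eval z (c • g) = c * eval z g := rfl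

theorem eval_frameVec (hF : IsSmoothFrame F) (x : Fin (2 * n + 1) → ℂ) (z : ℂ) :
    vmap (eval z) (frameVec hF x) = cmat (F z) *ᵥ x := by
  funext a
  rw [vmap_apply, frameVec_apply, map_sum, mulVec, dotProduct]
  exact Finset.sum_congr rfl fun b _ => mul_comm _ _

theorem eval_dv_frameVec (hF : IsSmoothFrame F) (x : Fin (2 * n + 1) → ℂ) (z : ℂ) :
    vmap (eval z) (dv (frameVec hF x)) = cmat (F z) *ᵥ (maurerCartan F z *ᵥ x) := by
  rw [maurerCartan, mulVec_mulVec, ← mul_assoc, cmat_mul_inv, one_mul]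
  funext a
  rw [vmap_apply, vder_apply, frameVec_apply, map_sum, map_sum, mulVec, dotProduct]
  refine Finset.sum_congr rfl fun b _ => ?_
  rw [Derivation.map_smul, eval_csmul, mul_comm]
  rfl

theorem ext_vmap_eval {ι : Type*} {x y : ι → SmoothFn}
    (h : ∀ z, vmap (eval z) x = vmap (eval z) y) : x = y :=
  funext fun i => ext_eval fun z => congrFun (h z) i

theorem form_frameVec (hF : IsSmoothFrame F) (x y : Fin (2 * n + 1) → ℂ) :
    form (frameVec hF x) (frameVec hF y) = algebraMap ℂ SmoothFn (form x y) :=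
  ext_eval fun z => by
    rw [← eval_apply, map_form, eval_frameVec, eval_frameVec, form_cmat_mulVec]
    rfl

theorem cj_frameVec (hF : IsSmoothFrame F) (x : Fin (2 * n + 1) → ℂ) :
    cj (frameVec hF x) = frameVec hF (star x) := funext fun a => by
  rw [vmap_apply, frameVec_apply, frameVec_apply, map_sum]
  refine Finset.sum_congr rfl fun b _ => ?_
  rw [conj_smul]
  congr 1
  exact ext_eval fun z => Complex.conj_ofReal _

/-- F is an isometry, so a matrix coefficient of F⁻¹F_z is the product of a frame vector with the
derivative of another. Algebraic conditions on F⁻¹F_z thereby become relations in `SmoothFn`. -/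
theorem form_maurerCartan (hF : IsSmoothFrame F) (x y : Fin (2 * n + 1) → ℂ) (z : ℂ) :
    form x (maurerCartan F z *ᵥ y) = eval z (form (frameVec hF x) (dv (frameVec hF y))) := by
  rw [map_form, eval_frameVec, eval_dv_frameVec, form_cmat_mulVec]

theorem form_dv_frameVec (hF : IsSmoothFrame F) (x y : Fin (2 * n + 1) → ℂ) :
    form (frameVec hF x) (dv (frameVec hF y)) = -form (dv (frameVec hF x)) (frameVec hF y) := by
  have h := derivation_form D (frameVec hF x) (frameVec hF y)
  rw [form_frameVec, Derivation.map_algebraMap] at h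
  linear_combination -h

theorem isSkew_maurerCartan (hF : IsSmoothFrame F) (z : ℂ) : IsSkew (maurerCartan F z) :=
  isSkew_iff.mpr fun x y => by
    rw [form_maurerCartan hF, form_comm (maurerCartan F z *ᵥ x), form_maurerCartan hF, form_dv_frameVec, map_neg,
      form_comm (dv _)]

theorem exists_frame_of_matrix {G : Matrix (Fin (2 * n + 1)) (Fin (2 * n + 1)) SmoothFn}
    (hr : ∀ a b, conj (G a b) = G a b)
    (hi : Gᵀ * upsilon n SmoothFn * G = upsilon n SmoothFn) (hd : G.det = 1) :
    ∃ (F : ℂ → SO n) (hF : IsSmoothFrame F), ∀ k : Fin (2 * n + 1),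
      frameVec hF (stdVec n ℂ (k.val + 1)) = G.col k := by
  set g : ℂ → Matrix (Fin (2 * n + 1)) (Fin (2 * n + 1)) ℝ :=
    fun z => Matrix.of fun a b => ((G a b : ℂ → ℂ) z).re with hg
  have hgG : ∀ z, Complex.ofRealHom.mapMatrix (g z) = (eval z).mapMatrix G := fun z => by
    ext a b
    exact Complex.conj_eq_iff_re.mp (congrArg (eval z) (hr a b))
  have hinj : Function.Injective (Complex.ofRealHom.mapMatrix
      (m := Fin (2 * n + 1))) := fun A B h => by
    ext a b
    exact Complex.ofReal_injective (congrFun (congrFun h a) b)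
  have hdet : ∀ z, (g z).det = 1 := fun z => by
    refine Complex.ofReal_injective ?_
    have h1 := RingHom.map_det Complex.ofRealHom (g z)
    rw [hgG, ← RingHom.map_det, hd, map_one] at h1
    exact h1.trans Complex.ofReal_one.symm
  have hiso : ∀ z, (g z)ᵀ * upsilon n ℝ * g z = upsilon n ℝ := fun z => by
    refine hinj ?_
    have h1 := congrArg (eval z).mapMatrix hi
    rw [map_mul, map_mul, upsilon_map] at h1 ⊢
    rw [hgG]
    have h2 : Complex.ofRealHom.mapMatrix (g z)ᵀ = (eval z).mapMatrix Gᵀ :=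
      congrArg transpose (hgG z)
    rw [h2, h1]
  have hex : ∀ z, ∃ h : SO n, mat h = g z := fun z => ⟨⟨⟨g z, hdet z⟩, hiso z⟩, rfl⟩
  choose F hFg using hex
  have hF : IsSmoothFrame F := fun a b => by
    simp only [hFg]
    exact Complex.reCLM.contDiff.comp (G a b).contDiff
  refine ⟨F, hF, fun k => ext_vmap_eval fun z => ?_⟩
  rw [eval_frameVec, cmat, hFg]
  funext a
  rw [mulVec, dotProduct, Finset.sum_eq_single k]
  · simp only [stdVec, if_true, mul_one]
    exact congrFun (congrFun (hgG z) a) k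
  · intro b _ hb
    have : ¬ (b.val + 1 = k.val + 1) := fun h => hb (Fin.ext (by omega))
    simp only [stdVec, if_neg this, mul_zero]
  · simp

end SmoothFn

/-! ### The frame of a superconformal harmonic map -/

/-- For a complex null vector v_{2n+1}² is the sum of the other squares, and the triangle inequality
gives |v_{2n+1}|² ≤ ∑ |v_i|². This is why the isotropic entries are spacelike where they are not
null. -/
theorem hnorm_nonneg_of_null {n : ℕ} {v : Fin (2 * n + 1) → ℂ} (h : form v v = 0) :
    0 ≤ hnorm v := by
  rw [form_apply, Fin.sum_univ_castSucc] at h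
  rw [hnorm, form_apply, Fin.sum_univ_castSucc, Complex.add_re, Complex.re_sum]
  have hne : ∀ i : Fin (2 * n), i.castSucc ≠ Fin.last (2 * n) := fun i =>
    (Fin.castSucc_lt_last i).ne
  simp only [hne, if_false, if_true, one_mul, Pi.star_apply, RCLike.star_def, Complex.mul_conj,
    Complex.ofReal_re, neg_mul, Complex.neg_re] at h ⊢
  have h1 : v (Fin.last (2 * n)) * v (Fin.last (2 * n)) =
      ∑ i : Fin (2 * n), v i.castSucc * v i.castSucc := by linear_combination -h
  have h2 : Complex.normSq (v (Fin.last (2 * n))) ≤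
      ∑ i : Fin (2 * n), Complex.normSq (v i.castSucc) := by
    calc Complex.normSq (v (Fin.last (2 * n)))
        = ‖v (Fin.last (2 * n)) * v (Fin.last (2 * n))‖ := by
          rw [norm_mul, Complex.normSq_eq_norm_sq, pow_two]
      _ ≤ ∑ i : Fin (2 * n), ‖v i.castSucc * v i.castSucc‖ := by
          rw [h1]; exact norm_sum_le _ _
      _ = _ := Finset.sum_congr rfl fun i _ => by
          rw [norm_mul, Complex.normSq_eq_norm_sq, pow_two]
  linarith

namespace SmoothFn

open Matrix

variable {n : ℕ} {f : Fin (2 * n + 1) → SmoothFn} {s : ℕ → Fin (2 * n + 1) → SmoothFn}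

theorem hsq_apply (x : Fin (2 * n + 1) → SmoothFn) (z : ℂ) :
    (hsq x : ℂ → ℂ) z = (hnorm fun i => (x i : ℂ → ℂ) z : ℂ) := by
  have h : (hsq x : ℂ → ℂ) z = form (fun i => (x i : ℂ → ℂ) z)
      (star fun i => (x i : ℂ → ℂ) z) := map_form (eval z) _ _
  have h1 : ((hsq x : ℂ → ℂ) z).re = hnorm fun i => (x i : ℂ → ℂ) z := by rw [h]; rfl
  rw [← h1]
  exact (Complex.conj_eq_iff_re.mp (congrArg (eval z) (conj_hsq x))).symm

theorem smul_form_eq_zero {c c' : SmoothFn} (hc : c ∈ nonZeroDivisors SmoothFn)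
    (hc' : c' ∈ nonZeroDivisors SmoothFn) {x y : Fin (2 * n + 1) → SmoothFn}
    (h : form (c • x) (c' • y) = 0) : form x y = 0 := by
  rw [form_smul_left, form_smul_right] at h
  exact mul_eq_zero_cancel hc' (mul_eq_zero_cancel hc h)

/-- A normalization `V` of the harmonic sequence `s`. -/
structure IsNormalization (s : ℕ → Fin (2 * n + 1) → SmoothFn) (c : ℕ → SmoothFn)
    (V : ℕ → Fin (2 * n + 1) → SmoothFn) : Prop where
  eq : ∀ l < n, s l = c l • V l
  regular : ∀ l < n, c l ∈ nonZeroDivisors SmoothFn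
  pp : ∀ k l, k < n → l < n → ¬ (k = 0 ∧ l = 0) → form (V k) (V l) = 0
  mp : ∀ k l, k < n → l < n → k ≠ l → form (cj (V k)) (V l) = 0
  hsq : ∀ l, 1 ≤ l → l < n → hsq (V l) = algebraMap ℂ SmoothFn 2

theorem exists_normalized_level (hn : 1 ≤ n) (hf : IsHarmonicVec f) (hi : IsIsotropicVec f)
    (ht : topSquare f ≠ 0) (hs : IsHarmonicSeq f s) (l : ℕ) (h1 : 1 ≤ l) (hl : l < n) :
    ∃ c V, s l = c • V ∧ c ∈ nonZeroDivisors SmoothFn ∧ hsq V = algebraMap ℂ SmoothFn 2 := by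
  obtain ⟨c, g, h⟩ := exists_isLevel hn hf hi ht hs l hl
  have hc := h.holo.mem_nonZeroDivisors
  have hgg : form g g = 0 := smul_form_eq_zero hc hc (by
    rw [← h.eq]; exact form_seq_seq hn hf hi hs hl.le hl.le (by omega) (by omega))
  obtain ⟨u, hu, hu1⟩ := exists_inv_sqrt (conj_hsq g) fun z => by
    have h2 := h.ne z
    rw [hsq_apply] at h2 ⊢
    rw [Complex.ofReal_re]
    refine lt_of_le_of_ne (hnorm_nonneg_of_null ?_) (Complex.ofReal_ne_zero.mp h2).symm
    exact (map_form (eval z) g g).symm.trans (by rw [hgg, map_zero])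
  have h2 : ((√2 : ℝ) : ℂ) * ((√2 : ℝ) : ℂ) = 2 := by
    rw [← Complex.ofReal_mul, Real.mul_self_sqrt zero_le_two, Complex.ofReal_ofNat]
  have h20 : ((√2 : ℝ) : ℂ) ≠ 0 := fun h0 => by rw [h0] at h2; norm_num at h2
  have hunit : IsUnit (u * hsq g) := IsUnit.of_mul_eq_one u (by linear_combination hu1)
  -- As u² · hsq g = 1, the inverse of u is u · hsq g. It moves into the scalar factor when g is
  -- rescaled. The length 2 is that of e_{2l} + i e_{2l+1}.
  refine ⟨(((√2 : ℝ) : ℂ)⁻¹) • (c * (u * hsq g)), ((√2 : ℝ) : ℂ) • (u • g), ?_, ?_, ?_⟩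
  · rw [smul_smul_smul_comm, smul_eq_mul, inv_mul_cancel₀ h20, one_smul, smul_smul, h.eq]
    congr 1
    linear_combination (-c) * hu1
  · rw [← algebraMap_smul SmoothFn, smul_eq_mul]
    exact mul_mem (IsUnit.mem_nonZeroDivisors
      ((IsUnit.mk0 _ (inv_ne_zero h20)).map (algebraMap ℂ SmoothFn)))
      (mul_mem hc hunit.mem_nonZeroDivisors)
  · rw [hsq_csmul, Complex.conj_ofReal, h2, hsq_smul, hu, hu1, Algebra.algebraMap_eq_smul_one]

theorem exists_normalization (hn : 1 ≤ n) (hf : IsHarmonicVec f) (hi : IsIsotropicVec f)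
    (ht : topSquare f ≠ 0) (hs : IsHarmonicSeq f s) :
    ∃ c V, IsNormalization s c V ∧ V 0 = Complex.I • f := by
  have h : ∀ l, ∃ c V, l < n → (s l = c • V ∧ c ∈ nonZeroDivisors SmoothFn ∧
      (1 ≤ l → hsq V = algebraMap ℂ SmoothFn 2) ∧ (l = 0 → V = Complex.I • f)) := by
    intro l
    by_cases hl : l < n
    · rcases Nat.eq_zero_or_pos l with rfl | h1
      · refine ⟨algebraMap ℂ SmoothFn (-Complex.I), Complex.I • f, fun _ => ⟨?_, ?_, ?_, fun _ => rfl⟩⟩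
        · rw [algebraMap_smul, smul_smul, neg_mul, Complex.I_mul_I, neg_neg, one_smul, hs.zero]
        · exact IsUnit.mem_nonZeroDivisors
            ((IsUnit.mk0 _ (neg_ne_zero.mpr Complex.I_ne_zero)).map (algebraMap ℂ SmoothFn))
        · intro h; omega
      · obtain ⟨c, V, h2, h3, h4⟩ := exists_normalized_level hn hf hi ht hs l h1 hl
        exact ⟨c, V, fun _ => ⟨h2, h3, fun _ => h4, fun h => by omega⟩⟩
    · exact ⟨0, 0, fun h => absurd h hl⟩
  choose c V h using h
  have hmp : ∀ k l, k < n → l < n → l < k → form (V k) (cj (V l)) = 0 := fun k l hk hl hlk => by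
    refine smul_form_eq_zero (h k hk).2.1 (conj_mem_nonZeroDivisors (h l hl).2.1) ?_
    rw [← vmap_smul, ← (h k hk).1, ← (h l hl).1]
    exact (seq_orthogonal hn hf hi hs k hk.le).1 l hlk
  refine ⟨c, V, ⟨fun l hl => (h l hl).1, fun l hl => (h l hl).2.1, fun k l hk hl h0 => ?_,
    fun k l hk hl hkl => ?_, fun l h1 hl => (h l hl).2.2.1 h1⟩, (h 0 hn).2.2.2 rfl⟩
  · refine smul_form_eq_zero (h k hk).2.1 (h l hl).2.1 ?_
    rw [← (h k hk).1, ← (h l hl).1]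
    exact form_seq_seq hn hf hi hs hk.le hl.le (by omega) (by omega)
  · rcases hkl.lt_or_gt with h1 | h1
    · rw [form_comm]; exact hmp l k hl hk h1
    · have := congrArg conj (hmp k l hk hl h1)
      rwa [conj_form, cj_cj, map_zero] at this

namespace IsNormalization

variable {c : ℕ → SmoothFn} {V : ℕ → Fin (2 * n + 1) → SmoothFn}

/-- Up to regular factors ∂ (V l) is a combination of V l and V (l + 1). The next lemma is the
counterpart for ∂̄ (V (l + 1)). -/
theorem form_dv_eq_zero (hs : IsHarmonicSeq f s) (hV : IsNormalization s c V)
    {x : Fin (2 * n + 1) → SmoothFn} {l : ℕ} (hl : l + 1 < n) (h0 : form x (V l) = 0)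
    (h1 : form x (V (l + 1)) = 0) : form x (dv (V l)) = 0 := by
  have e := congrArg (form x) (hs.succ l (by omega))
  rw [hV.eq (l + 1) hl, hV.eq l (by omega), form_sub_right, form_smul_right, form_smul_right,
    form_smul_right, form_smul_right, form_smul_right, h0, h1, vder_smul, form_add_right,
    form_smul_right, form_smul_right, h0, ← hV.eq l (by omega)] at e
  refine mul_eq_zero_cancel (hV.regular l (by omega))
    (mul_eq_zero_cancel (hs.regular l (by omega)) ?_)
  linear_combination -e

theorem form_dbv_eq_zero (hn : 1 ≤ n) (hf : IsHarmonicVec f) (hi : IsIsotropicVec f)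
    (hs : IsHarmonicSeq f s) (hV : IsNormalization s c V)
    {x : Fin (2 * n + 1) → SmoothFn} {l : ℕ} (hl : l + 1 < n) (h0 : form x (V l) = 0)
    (h1 : form x (V (l + 1)) = 0) : form x (dbv (V (l + 1))) = 0 := by
  have e := congrArg (form x) ((seq_orthogonal hn hf hi hs (l + 1) hl.le).2 l rfl)
  rw [form_smul_right, form_smul_right] at e
  have hr := hs.regular l (by omega)
  rw [hV.eq (l + 1) hl, hV.eq l (by omega), form_smul_right, h0, vder_smul, form_add_right,
    form_smul_right, form_smul_right, h1, ← hV.eq l (by omega)] at e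
  refine mul_eq_zero_cancel (hV.regular (l + 1) hl) (mul_eq_zero_cancel hr ?_)
  linear_combination e

end IsNormalization

end SmoothFn

namespace SmoothFn

open Matrix

/-! ### Real orthonormal vectors and the adapted frame -/

section Adapted

variable {n : ℕ} {f : Fin (2 * n + 1) → SmoothFn} {s : ℕ → Fin (2 * n + 1) → SmoothFn}
  {c : ℕ → SmoothFn} {V : ℕ → Fin (2 * n + 1) → SmoothFn}

theorem star_stdVec (k : ℕ) : star (stdVec n ℂ k) = stdVec n ℂ k := by
  funext a
  simp only [Pi.star_apply, stdVec]
  split_ifs <;> simp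

theorem star_Ep (l : ℕ) : star (Ep n l) = Em n l := by
  rw [Ep, Em, star_add, star_smul, star_stdVec, star_stdVec, sub_eq_add_neg, ← neg_smul]
  simp

/-- The frame vectors with real coordinates underlying a normalization: the real part of `V l` at
`2 l - 1`, its imaginary part at `2 l`. -/
def realPart (V : ℕ → Fin (2 * n + 1) → SmoothFn) (k : ℕ) : Fin (2 * n + 1) → SmoothFn :=
  if k % 2 = 1 then (1 / 2 : ℂ) • (V ((k + 1) / 2) + cj (V ((k + 1) / 2)))
  else (-Complex.I / 2 : ℂ) • (V (k / 2) - cj (V (k / 2)))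

theorem cj_realPart (k : ℕ) : cj (realPart V k) = realPart V k := by
  rw [realPart]
  split_ifs
  · rw [cj_csmul, map_add, cj_cj, add_comm (cj _)]
    congr 1
    rw [map_div₀, map_one, map_ofNat]
  · rw [cj_csmul, map_sub, cj_cj, ← neg_sub, smul_neg, ← neg_smul]
    congr 1
    rw [map_div₀, map_neg, Complex.conj_I, map_ofNat]
    ring

theorem form_V_V (hf : IsHarmonicVec f) (h0 : V 0 = Complex.I • f)
    (hV : IsNormalization s c V) {k l : ℕ} (hk : k < n) (hl : l < n) :
    form (V k) (V l) = if k = 0 ∧ l = 0 then -1 else 0 := by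
  split_ifs with h
  · rw [h.1, h.2, h0, form_csmul_left, form_csmul_right, hf.norm, smul_smul, Complex.I_mul_I,
      neg_one_smul]
  · exact hV.pp k l hk hl h

theorem form_cj_V (hf : IsHarmonicVec f) (h0 : V 0 = Complex.I • f)
    (hV : IsNormalization s c V) {k l : ℕ} (hk : k < n) (hl : l < n) :
    form (cj (V k)) (V l) = if k = l then (if k = 0 then 1 else 2) else 0 := by
  split_ifs with h h1
  · rw [← h, h1, form_comm, ← SmoothFn.hsq, h0, hsq_csmul, hf.hsq_eq_one, Complex.conj_I, mul_neg,
      Complex.I_mul_I, neg_neg, one_smul]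
  · rw [← h, form_comm]
    exact (hV.hsq k (by omega) hk).trans (map_ofNat _ 2)
  · exact hV.mp k l hk hl h

theorem form_realPart (hf : IsHarmonicVec f) (h0 : V 0 = Complex.I • f)
    (hV : IsNormalization s c V) {j k : ℕ} (hj : j < 2 * n - 1) (hk : k < 2 * n - 1) :
    form (realPart V j) (realPart V k) = if j = k then 1 else 0 := by
  have e1 : ∀ {a b}, a < n → b < n → form (V a) (V b) = if a = 0 ∧ b = 0 then -1 else 0 :=
    fun ha hb => form_V_V hf h0 hV ha hb
  have e2 : ∀ {a b}, a < n → b < n → form (cj (V a)) (V b) =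
      if a = b then (if a = 0 then 1 else 2) else 0 := fun ha hb => form_cj_V hf h0 hV ha hb
  have e3 : ∀ {a b}, a < n → b < n → form (V a) (cj (V b)) =
      if b = a then (if b = 0 then 1 else 2) else 0 := fun ha hb => by
    rw [form_comm, e2 hb ha]
  have e4 : ∀ {a b}, a < n → b < n → form (cj (V a)) (cj (V b)) =
      if a = 0 ∧ b = 0 then -1 else 0 := fun ha hb => by
    rw [← conj_form, e1 ha hb]
    split_ifs <;> simp
  have h2 : (1 / 2 * (1 / 2) : ℂ) • (4 : SmoothFn) = 1 := by
    rw [show (4 : SmoothFn) = algebraMap ℂ SmoothFn 4 from (map_ofNat _ 4).symm,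
      Algebra.algebraMap_eq_smul_one, smul_smul]
    norm_num
  have h3 : (-Complex.I / 2 * (-Complex.I / 2) : ℂ) • (-4 : SmoothFn) = 1 := by
    rw [smul_neg, ← neg_smul, ← h2]
    congr 1
    linear_combination (-1 / 4) * Complex.I_sq
  have hex : ∀ i, i < 2 * n - 1 → (i % 2 = 1 ∧ (i + 1) / 2 < n ∧ (i + 1) / 2 ≠ 0) ∨
      (i % 2 ≠ 1 ∧ i / 2 < n) := fun i hi => by omega
  rcases hex j hj with ⟨a1, a2, a3⟩ | ⟨a1, a2⟩ <;> rcases hex k hk with ⟨b1, b2, b3⟩ | ⟨b1, b2⟩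
  · rw [realPart, if_pos a1, realPart, if_pos b1, form_csmul_left, form_csmul_right, form_add_left,
      form_add_right, form_add_right, e1 a2 b2, e2 a2 b2, e3 a2 b2, e4 a2 b2, smul_smul,
      if_neg (fun h => a3 h.1)]
    by_cases h : (j + 1) / 2 = (k + 1) / 2
    · rw [if_pos h.symm, if_pos h, if_neg b3, if_neg a3, if_pos (show j = k by omega), ← h2]
      congr 1
      ring
    · rw [if_neg (Ne.symm h), if_neg h, if_neg (show ¬ j = k by omega)]
      simp
  · rw [realPart, if_pos a1, realPart, if_neg b1, form_csmul_left, form_csmul_right, form_add_left,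
      form_sub_right, form_sub_right, e1 a2 b2, e2 a2 b2, e3 a2 b2, e4 a2 b2, smul_smul,
      if_neg (fun h => a3 h.1), if_neg (show ¬ j = k by omega)]
    by_cases h : (j + 1) / 2 = k / 2
    · rw [if_pos h.symm, if_pos h, ← h]
      simp
    · rw [if_neg (Ne.symm h), if_neg h]
      simp
  · rw [realPart, if_neg a1, realPart, if_pos b1, form_csmul_left, form_csmul_right, form_sub_left,
      form_add_right, form_add_right, e1 a2 b2, e2 a2 b2, e3 a2 b2, e4 a2 b2, smul_smul,
      if_neg (fun h => b3 h.2), if_neg (show ¬ j = k by omega)]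
    by_cases h : j / 2 = (k + 1) / 2
    · rw [if_pos h.symm, if_pos h, ← h]
      simp
    · rw [if_neg (Ne.symm h), if_neg h]
      simp
  · rw [realPart, if_neg a1, realPart, if_neg b1, form_csmul_left, form_csmul_right, form_sub_left,
      form_sub_right, form_sub_right, e1 a2 b2, e2 a2 b2, e3 a2 b2, e4 a2 b2, smul_smul]
    by_cases h : j / 2 = k / 2
    · rw [if_pos h.symm, if_pos h, ← h, if_pos (show j = k by omega)]
      refine Eq.trans ?_ h3
      congr 1
      by_cases h4 : j / 2 = 0
      · rw [if_pos ⟨h4, h4⟩, if_pos h4]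
        norm_num
      · rw [if_neg fun h5 => h4 h5.1, if_neg h4]
        norm_num
    · rw [if_neg (Ne.symm h), if_neg h, if_neg (show ¬ j = k by omega),
        if_neg (show ¬ (j / 2 = 0 ∧ k / 2 = 0) by omega)]
      simp

/-- The imaginary part f of V 0 together with the real and imaginary parts of V 1, …, V (n - 1) are
2n - 1 orthonormal real vectors. The real part of V 0 is zero, in accordance with e_0 being the zero
vector in `Ep n 0`. -/
theorem exists_adapted_frame (hn : 1 ≤ n) (hf : IsHarmonicVec f) (h0 : V 0 = Complex.I • f)
    (hV : IsNormalization s c V) :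
    ∃ (F : ℂ → SO n) (hF : IsSmoothFrame F), ∀ l < n, frameVec hF (Ep n l) = V l := by
  obtain ⟨G, hr, hi, hd, hG⟩ := exists_frame_matrix hn (fun k => realPart V k.val)
    (fun k => cj_realPart _) fun j k hj hk => by
      rw [form_realPart hf h0 hV hj hk]
      simp only [Fin.ext_iff]
  obtain ⟨F, hF, hFG⟩ := exists_frame_of_matrix hr hi hd
  have key : ∀ k, k < 2 * n - 1 → frameVec hF (stdVec n ℂ (k + 1)) = realPart V k :=
    fun k hk => (hFG ⟨k, by omega⟩).trans (hG ⟨k, by omega⟩ hk)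
  refine ⟨F, hF, fun l hl => ?_⟩
  have e2 : frameVec hF (stdVec n ℂ (2 * l + 1)) = (-Complex.I / 2 : ℂ) • (V l - cj (V l)) := by
    rw [key _ (by omega), realPart, if_neg (by omega), show 2 * l / 2 = l by omega]
  have h4 : (1 / 2 : ℂ) + Complex.I * (-Complex.I / 2) = 1 := by
    linear_combination (-1 / 2) * Complex.I_sq
  have h5 : (1 / 2 : ℂ) - Complex.I * (-Complex.I / 2) = 0 := by
    linear_combination (1 / 2) * Complex.I_sq
  have e1 : frameVec hF (stdVec n ℂ (2 * l)) = (1 / 2 : ℂ) • (V l + cj (V l)) := by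
    rcases Nat.eq_zero_or_pos l with rfl | h1
    · rw [mul_zero, stdVec_zero, map_zero, h0, cj_csmul, hf.real, Complex.conj_I, neg_smul,
        add_neg_cancel, smul_zero]
    · rw [show 2 * l = 2 * l - 1 + 1 by omega, key _ (by omega), realPart, if_pos (by omega),
        show (2 * l - 1 + 1) / 2 = l by omega]
  rw [Ep, map_add, map_smul, e1, e2, smul_smul]
  calc _ = ((1 / 2 : ℂ) + Complex.I * (-Complex.I / 2)) • V l +
        ((1 / 2 : ℂ) - Complex.I * (-Complex.I / 2)) • cj (V l) := by module
    _ = V l := by rw [h4, h5, one_smul, zero_smul, add_zero]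

variable {F : ℂ → SO n}

/-- ∂ (V l) involves only V l and V (l + 1), while ∂̄ (V l) involves only V l and V (l - 1), so the
forbidden matrix coefficients vanish by orthogonality. At l = n - 1, where no next V exists,
skew-symmetry moves the derivative to the other argument. -/
theorem isPrimitiveElement_maurerCartan (hn : 1 ≤ n) (hf : IsHarmonicVec f)
    (hi : IsIsotropicVec f) (hs : IsHarmonicSeq f s) (hV : IsNormalization s c V)
    (hF : IsSmoothFrame F) (hFV : ∀ l < n, frameVec hF (Ep n l) = V l) (z : ℂ) :
    IsPrimitiveElement (maurerCartan F z) := by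
  have hm : ∀ l < n, frameVec hF (Em n l) = cj (V l) := fun l hl => by
    rw [← star_Ep, ← cj_frameVec, hFV l hl]
  have pm : ∀ k l, k < n → l < n → k ≠ l → form (V k) (cj (V l)) = 0 := fun k l hk hl h => by
    rw [form_comm]; exact hV.mp l k hl hk h.symm
  have lp : ∀ k l, (k = 2 * n ∨ k = 2 * n + 1) → l < n →
      form (frameVec hF (stdVec n ℂ k)) (V l) = 0 := fun k l hk hl => by
    rw [← hFV l hl, form_frameVec, form_last_Ep hl hk, map_zero]
  have hdm : ∀ x l, form x (dv (cj (V l))) = conj (form (cj x) (dbv (V l))) := fun x l => by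
    rw [conj_form, cj_cj, cj_dbv]
  have hdb : ∀ x l, 1 ≤ l → l < n → form x (V l) = 0 → form x (V (l - 1)) = 0 →
      form x (dbv (V l)) = 0 := fun x l h1 hl h2 h3 => by
    obtain ⟨m, rfl⟩ : ∃ m, l = m + 1 := ⟨l - 1, by omega⟩
    exact hV.form_dbv_eq_zero hn hf hi hs hl h3 h2
  refine ⟨isSkew_maurerCartan hF z, fun k l hk hl h => ?_, fun k l h1 hk hl h2 h3 => ?_,
    fun k l hk hl => ?_, fun k l h1 h2 hk hl => ?_, fun k l hk h1 hl => ?_⟩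
  · rw [form_maurerCartan hF]
    suffices h' : form (frameVec hF (Ep n k)) (dv (frameVec hF (Ep n l))) = 0 by rw [h', map_zero]
    rcases Nat.lt_or_ge (l + 1) n with h1 | h1
    · rw [hFV k hk, hFV l hl]
      exact hV.form_dv_eq_zero hs h1 (hV.pp k l hk hl h) (hV.pp k (l + 1) hk h1 (by omega))
    · rcases Nat.lt_or_ge (k + 1) n with h2 | h2
      · rw [form_dv_frameVec, form_comm, hFV k hk, hFV l hl, neg_eq_zero]
        exact hV.form_dv_eq_zero hs h2 (hV.pp l k hl hk (by omega))
          (hV.pp l (k + 1) hl h2 (by omega))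
      · obtain rfl : k = l := by omega
        have h3 := form_dv_frameVec hF (Ep n k) (Ep n k)
        rw [form_comm (dv _)] at h3
        have h4 : (2 : ℂ) • form (frameVec hF (Ep n k)) (dv (frameVec hF (Ep n k))) = 0 := by
          rw [two_smul]
          linear_combination h3
        exact (smul_eq_zero.mp h4).resolve_left two_ne_zero
  · rw [form_maurerCartan hF]
    suffices h' : form (frameVec hF (Em n k)) (dv (frameVec hF (Ep n l))) = 0 by rw [h', map_zero]
    rcases Nat.lt_or_ge (l + 1) n with h4 | h4
    · rw [hm k hk, hFV l hl]
      exact hV.form_dv_eq_zero hs h4 (hV.mp k l hk hl h2) (hV.mp k (l + 1) hk h4 h3)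
    · rw [form_dv_frameVec, form_comm, hm k hk, hFV l hl, hdm, neg_eq_zero,
        hdb _ k h1 hk (hV.mp l k hl hk (Ne.symm h2)) (hV.mp l (k - 1) hl (by omega) (by omega)),
        map_zero]
  · rw [form_maurerCartan hF, hFV l (by omega), hV.form_dv_eq_zero hs hl (lp k l hk (by omega))
      (lp k (l + 1) hk hl), map_zero]
  · rw [form_maurerCartan hF, hm k hk, hm l hl, hdm, cj_cj, hdb _ l h2 hl
      (hV.pp k l hk hl (by omega)) (hV.pp k (l - 1) hk (by omega) (by omega)), map_zero, map_zero]
  · rw [form_maurerCartan hF, hm l hl, hdm, cj_frameVec, star_stdVec, hdb _ l h1 hl (lp k l hk hl)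
      (lp k (l - 1) hk (by omega)), map_zero, map_zero]

end Adapted

end SmoothFn

/-! ### The map framed by a primitive frame -/

namespace SmoothFn

open Matrix

variable {n : ℕ} {F : ℂ → SO n}

/-- The coefficient of `∂_z (F (Ep l))` along `F (Ep l)`. -/
def frameDiag (hF : IsSmoothFrame F) (l : ℕ) : SmoothFn :=
  if l = 0 then 0
  else (1 / 2 : ℂ) • form (frameVec hF (Em n l)) (dv (frameVec hF (Ep n l)))

/-- Root coefficients are constant combinations of the smooth products ⟨F x, ∂ (F y)⟩. Beyond index
n they are arbitrary, which is the reason for the bound. -/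
theorem exists_smooth_rootCoeff (hn : 1 ≤ n) (hF : IsSmoothFrame F) {c : ℕ → ℂ → ℂ}
    (hc : ∀ z, InGraded n 0 (maurerCartan F z - rootSum n fun k => c k z)) :
    ∃ C : ℕ → SmoothFn, ∀ k ≤ n, ∀ z, (C k : ℂ → ℂ) z = c k z := by
  have hl := loc_ne_zero (n - 1)
  have hr := rsign_mul_self (n := n)
  have h : ∀ k, ∃ C : SmoothFn, k ≤ n → ∀ z, (C : ℂ → ℂ) z = c k z := by
    intro k
    set X := form (frameVec hF (stdVec n ℂ (2 * n))) (dv (frameVec hF (Ep n (n - 1))))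
    set Y := form (frameVec hF (stdVec n ℂ (2 * n + 1))) (dv (frameVec hF (Ep n (n - 1))))
    have hX : ∀ z, eval z X = loc (n - 1) * (c n z + c 0 z) := fun z => by
      rw [← form_maurerCartan, (rootCoeff_top_eq hn (hc z)).1]
    have hY : ∀ z, eval z Y = -(loc (n - 1) * (rsign n * (c 0 z - c n z))) := fun z => by
      rw [← form_maurerCartan, (rootCoeff_top_eq hn (hc z)).2]
    rcases Nat.eq_zero_or_pos k with rfl | h0
    · refine ⟨(1 / (2 * loc (n - 1))) • (X - rsign n • Y), fun _ z => ?_⟩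
      rw [← eval_apply, eval_csmul, map_sub, eval_csmul, hX, hY]
      field_simp
      linear_combination (c 0 z - c n z) * hr
    · rcases Nat.lt_or_ge k n with hk | hk
      · obtain ⟨l, rfl⟩ : ∃ l, k = l + 1 := ⟨k - 1, by omega⟩
        refine ⟨(1 / (2 * loc l)) •
          form (frameVec hF (Em n (l + 1))) (dv (frameVec hF (Ep n l))), fun _ z => ?_⟩
        rw [← eval_apply, eval_csmul, ← form_maurerCartan, rootCoeff_eq (hc z) hk]
        have := loc_ne_zero l
        field_simp
      · refine ⟨(1 / (2 * loc (n - 1))) • (X + rsign n • Y), fun hk' z => ?_⟩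
        obtain rfl : k = n := le_antisymm hk' hk
        rw [← eval_apply, eval_csmul, map_add, eval_csmul, hX, hY]
        field_simp
        linear_combination (c k z - c 0 z) * hr
  choose C hC using h
  exact ⟨C, hC⟩

theorem maurerCartan_mulVec_Ep {z : ℂ} (hF : IsSmoothFrame F) {c : ℕ → ℂ}
    (hc : InGraded n 0 (maurerCartan F z - rootSum n c)) {l : ℕ} (hl : l < n) :
    maurerCartan F z *ᵥ Ep n l = eval z (frameDiag hF l) • Ep n l + rootSum n c *ᵥ Ep n l := by
  have h := mulVec_Ep_of_inGraded_zero hc hl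
  have h1 : (if l = 0 then 0 else
      form (Em n l) ((maurerCartan F z - rootSum n c) *ᵥ Ep n l) / 2) =
      eval z (frameDiag hF l) := by
    rw [frameDiag]
    split_ifs with h0
    · rw [map_zero]
    · rw [eval_csmul, ← form_maurerCartan, sub_mulVec, form_sub_right,
        show form (Em n l) (rootSum n c *ᵥ Ep n l) = 0 from ?_]
      · ring
      rcases Nat.lt_or_ge (l + 1) n with h1 | h1
      · rw [rootSum_mulVec_Ep c h1, form_smul_right, form_Em_Ep hl (by omega), if_neg (by omega),
          mul_zero]
      · obtain rfl : l = n - 1 := by omega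
        rw [rootSum_mulVec_Ep_top (by omega), form_smul_right, form_add_right, form_smul_right,
          form_smul_right, form_comm, form_last_Em hl (Or.inl rfl), form_comm,
          form_last_Em hl (Or.inr rfl)]
        ring
  rw [← h1, ← h, sub_mulVec, sub_add_cancel]

/-- The structure equations of a primitive frame. -/
structure IsPrimitiveSystem (V : ℕ → Fin (2 * n + 1) → SmoothFn)
    (W : Fin (2 * n + 1) → SmoothFn) (C P : ℕ → SmoothFn) : Prop where
  P_zero : P 0 = 0
  succ : ∀ l, l + 1 < n → dv (V l) = P l • V l + loc l • (C (l + 1) • V (l + 1))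
  top : dv (V (n - 1)) = P (n - 1) • V (n - 1) + W
  pp : ∀ k l, k < n → l < n → ¬ (k = 0 ∧ l = 0) → form (V k) (V l) = 0
  mp : ∀ k l, k < n → l < n → k ≠ l → form (cj (V k)) (V l) = 0
  hsq : ∀ l < n, hsq (V l) = algebraMap ℂ SmoothFn (if l = 0 then 1 else 2)
  Wp : ∀ l < n, form W (V l) = 0
  Wm : ∀ l < n, form W (cj (V l)) = 0
  WW : form W W = (4 * loc (n - 1) ^ 2) • (C n * C 0)

theorem isPrimitiveSystem (hn : 1 ≤ n) (hF : IsSmoothFrame F) {c : ℕ → ℂ → ℂ}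
    (hc : ∀ z, InGraded n 0 (maurerCartan F z - rootSum n fun k => c k z))
    {C : ℕ → SmoothFn} (hC : ∀ k ≤ n, ∀ z, (C k : ℂ → ℂ) z = c k z) :
    IsPrimitiveSystem (fun l => frameVec hF (Ep n l))
      (loc (n - 1) • ((C n + C 0) • frameVec hF (stdVec n ℂ (2 * n)) +
        (rsign n • (C 0 - C n)) • frameVec hF (stdVec n ℂ (2 * n + 1)))) C (frameDiag hF) := by
  have hE : ∀ x z, cmat (F z) *ᵥ x = vmap (eval z) (frameVec hF x) := fun x z =>
    (eval_frameVec hF x z).symm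
  have hvs : ∀ (z a : ℂ) (x : Fin (2 * n + 1) → SmoothFn),
      vmap (eval z) (a • x) = a • vmap (eval z) x := fun z a x => rfl
  have hcj : ∀ l, cj (frameVec hF (Ep n l)) = frameVec hF (Em n l) := fun l => by
    rw [cj_frameVec, star_Ep]
  have h1 : ∀ j k, form (frameVec hF (stdVec n ℂ j)) (frameVec hF (stdVec n ℂ k)) =
      algebraMap ℂ SmoothFn (if j = k ∧ 1 ≤ j ∧ j ≤ 2 * n + 1 then
        (if k = 2 * n + 1 then -1 else 1) else 0) := fun j k => by rw [form_frameVec, form_std]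
  refine ⟨if_pos rfl, fun l hl => ext_vmap_eval fun z => ?_, ext_vmap_eval fun z => ?_,
    fun k l hk hl h => ?_, fun k l hk hl h => ?_, fun l hl => ?_, fun l hl => ?_, fun l hl => ?_, ?_⟩
  · rw [eval_dv_frameVec, maurerCartan_mulVec_Ep hF (hc z) (by omega), rootSum_mulVec_Ep _ hl,
      mulVec_add, mulVec_smul, mulVec_smul, hE, hE, map_add, vmap_smul, hvs, vmap_smul, smul_smul,
      eval_apply z (C (l + 1)), hC (l + 1) (by omega)]
  · rw [eval_dv_frameVec, maurerCartan_mulVec_Ep hF (hc z) (by omega), rootSum_mulVec_Ep_top hn,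
      mulVec_add, mulVec_smul, mulVec_smul, mulVec_add, mulVec_smul, mulVec_smul, hE, hE, hE,
      map_add, vmap_smul, hvs, map_add, vmap_smul, vmap_smul, eval_csmul, map_add, map_sub,
      eval_apply z (C n), eval_apply z (C 0), hC n le_rfl, hC 0 (by omega)]
  · rw [form_frameVec, form_Ep_Ep hk h, map_zero]
  · rcases Nat.eq_zero_or_pos k with rfl | h1
    · rw [hcj, form_frameVec, Em, mul_zero, stdVec_zero, zero_sub, ← neg_one_smul ℂ, zero_add,
        ← Ep_zero, form_smul_left, form_Ep_Ep hk (by omega), mul_zero, map_zero]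
    · rw [hcj, form_frameVec, form_Em_Ep hk h1, if_neg h, map_zero]
  · rw [SmoothFn.hsq, hcj, form_frameVec, form_comm]
    congr 1
    split_ifs with h0
    · rw [h0, Em, mul_zero, stdVec_zero, zero_sub, ← neg_one_smul ℂ, zero_add, ← Ep_zero,
        form_smul_left, Ep_zero, form_smul_left, form_smul_right, form_std, if_pos (by omega),
        if_neg (by omega)]
      linear_combination (-1) * Complex.I_sq
    · rw [form_Em_Ep hl (by omega), if_pos rfl]
  · rw [form_csmul_left, form_add_left, form_smul_left, form_smul_left, form_frameVec,
      form_frameVec, form_last_Ep hl (Or.inl rfl), form_last_Ep hl (Or.inr rfl), map_zero]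
    simp
  · rw [hcj, form_csmul_left, form_add_left, form_smul_left, form_smul_left, form_frameVec,
      form_frameVec, form_last_Em hl (Or.inl rfl), form_last_Em hl (Or.inr rfl), map_zero]
    simp
  -- The vectors e_{2n} and e_{2n+1} have opposite signs, so the square of W is `loc (n - 1) ^ 2`
  -- times (c_n + c_0)² - (c_0 - c_n)² = 4 c_n c_0.
  · rw [form_csmul_left, form_csmul_right, smul_smul, form_add_left, form_add_right,
      form_add_right, form_smul_left, form_smul_left, form_smul_left, form_smul_left,
      form_smul_right, form_smul_right, form_smul_right, form_smul_right, h1, h1, h1, h1,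
      if_pos (show 2 * n = 2 * n ∧ 1 ≤ 2 * n ∧ 2 * n ≤ 2 * n + 1 by omega),
      if_neg (show ¬ (2 * n = 2 * n + 1) by omega),
      if_neg (show ¬ (2 * n = 2 * n + 1 ∧ 1 ≤ 2 * n ∧ 2 * n ≤ 2 * n + 1) by omega),
      if_neg (show ¬ (2 * n + 1 = 2 * n ∧ 1 ≤ 2 * n + 1 ∧ 2 * n + 1 ≤ 2 * n + 1) by omega),
      if_pos (show 2 * n + 1 = 2 * n + 1 ∧ 1 ≤ 2 * n + 1 ∧ 2 * n + 1 ≤ 2 * n + 1 by omega),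
      if_pos rfl, map_zero, map_one, map_neg, map_one]
    refine ext_eval fun z => ?_
    simp only [← eval_apply, eval_csmul, map_add, map_sub, map_mul, map_neg, map_one, map_zero]
    linear_combination (-loc (n - 1) ^ 2 * (eval z (C 0) - eval z (C n)) ^ 2) *
      rsign_mul_self (n := n)

namespace IsPrimitiveSystem

variable {V : ℕ → Fin (2 * n + 1) → SmoothFn} {W : Fin (2 * n + 1) → SmoothFn}
  {C P : ℕ → SmoothFn}

/-- The factors `-i, c₁, 2c₁c₂, 4c₁c₂c₃, …` of the harmonic sequence. -/
def factor (C : ℕ → SmoothFn) : ℕ → SmoothFn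
  | 0 => algebraMap ℂ SmoothFn (-Complex.I)
  | l + 1 => loc l • (factor C l * C (l + 1))

/-- The harmonic sequence of a primitive frame. -/
def seq (V : ℕ → Fin (2 * n + 1) → SmoothFn) (W : Fin (2 * n + 1) → SmoothFn)
    (C : ℕ → SmoothFn) (l : ℕ) : Fin (2 * n + 1) → SmoothFn :=
  if l < n then factor C l • V l else factor C (n - 1) • W

theorem seq_of_lt {l : ℕ} (hl : l < n) : seq V W C l = factor C l • V l := if_pos hl

theorem seq_self : seq V W C n = factor C (n - 1) • W := if_neg (lt_irrefl n)

theorem dv_seq (h : IsPrimitiveSystem V W C P) {l : ℕ} (hl : l < n) :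
    dv (seq V W C l) = (factor C l * P l + D (factor C l)) • V l + seq V W C (l + 1) := by
  rw [seq_of_lt hl, vder_smul]
  rcases Nat.lt_or_ge (l + 1) n with h1 | h1
  · rw [seq_of_lt h1, h.succ l h1, factor, smul_add, add_smul, mul_smul,
      smul_comm (factor C l) (loc l), smul_assoc (loc l), mul_smul, smul_comm (factor C l) (P l)]
    abel
  · obtain rfl : n = l + 1 := by omega
    have h2 := h.top
    rw [add_tsub_cancel_right] at h2
    rw [seq_self, h2, add_tsub_cancel_right, smul_add, add_smul, mul_smul]
    abel

theorem form_seq_succ_cj (h : IsPrimitiveSystem V W C P) {l : ℕ} (hl : l < n) :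
    form (seq V W C (l + 1)) (cj (V l)) = 0 := by
  rcases Nat.lt_or_ge (l + 1) n with h1 | h1
  · rw [seq_of_lt h1, form_smul_left, form_comm, h.mp l (l + 1) hl h1 (by omega), mul_zero]
  · obtain rfl : n = l + 1 := by omega
    rw [seq_self, form_smul_left, h.Wm l hl, mul_zero]

theorem hsq_seq (h : IsPrimitiveSystem V W C P) {l : ℕ} (hl : l < n) :
    SmoothFn.hsq (seq V W C l) = factor C l * conj (factor C l) *
      algebraMap ℂ SmoothFn (if l = 0 then 1 else 2) := by
  rw [seq_of_lt hl, hsq_smul, h.hsq l hl]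

/-- By `dv_seq` the derivative of an entry is a multiple of V l plus the next entry, which is
Hermitian orthogonal to V l. Gram-Schmidt removes exactly the first part. -/
theorem seq_succ (h : IsPrimitiveSystem V W C P) {l : ℕ} (hl : l < n) :
    SmoothFn.hsq (seq V W C l) • seq V W C (l + 1) = SmoothFn.hsq (seq V W C l) •
      dv (seq V W C l) - form (dv (seq V W C l)) (cj (seq V W C l)) • seq V W C l := by
  have h1 : form (dv (seq V W C l)) (cj (seq V W C l)) =
      (factor C l * P l + D (factor C l)) * (conj (factor C l) * SmoothFn.hsq (V l)) := by
    rw [h.dv_seq hl, form_add_left, seq_of_lt hl, vmap_smul, form_smul_right, form_smul_right,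
      h.form_seq_succ_cj hl, form_smul_left, SmoothFn.hsq]
    ring
  rw [h1, h.dv_seq hl, smul_add, seq_of_lt hl, hsq_smul, smul_smul, smul_smul]
  have h2 : factor C l * conj (factor C l) * SmoothFn.hsq (V l) *
      (factor C l * P l + D (factor C l)) = (factor C l * P l + D (factor C l)) *
      (conj (factor C l) * SmoothFn.hsq (V l)) * factor C l := by ring
  rw [h2]
  abel

/-- The span of `V 1, …, V m`. -/
def lowSpan (V : ℕ → Fin (2 * n + 1) → SmoothFn) (m : ℕ) :
    Submodule SmoothFn (Fin (2 * n + 1) → SmoothFn) :=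
  Submodule.span SmoothFn {x | ∃ i, 1 ≤ i ∧ i ≤ m ∧ x = V i}

theorem mem_lowSpan {i m : ℕ} (h1 : 1 ≤ i) (h2 : i ≤ m) : V i ∈ lowSpan V m :=
  Submodule.subset_span ⟨i, h1, h2, rfl⟩

theorem lowSpan_mono {m m' : ℕ} (h : m ≤ m') : lowSpan V m ≤ lowSpan V m' :=
  Submodule.span_mono fun _ ⟨i, h1, h2, h3⟩ => ⟨i, h1, h2.trans h, h3⟩

theorem dv_mem_lowSpan (h : IsPrimitiveSystem V W C P) {m : ℕ} (hm : m + 1 < n)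
    {x : Fin (2 * n + 1) → SmoothFn} (hx : x ∈ lowSpan V m) : dv x ∈ lowSpan V (m + 1) := by
  induction hx using Submodule.span_induction with
  | mem x hx =>
    obtain ⟨i, h1, h2, rfl⟩ := hx
    rw [h.succ i (by omega), ← algebraMap_smul SmoothFn (loc i)]
    exact add_mem (Submodule.smul_mem _ _ (mem_lowSpan h1 (by omega)))
      (Submodule.smul_mem _ _ (Submodule.smul_mem _ _ (mem_lowSpan (by omega) (by omega))))
  | zero => rw [map_zero]; exact zero_mem _
  | add x y _ _ hx hy => rw [map_add]; exact add_mem hx hy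
  | smul a x hx' hx =>
    rw [vder_smul]
    exact add_mem (Submodule.smul_mem _ _ hx)
      (Submodule.smul_mem _ _ (lowSpan_mono (Nat.le_succ m) hx'))

/-- At a = 0 there is no lower term, since P 0 = 0 and `factor C 0` is constant. Each further
derivative adds a multiple of V (a + 1) and raises the old terms by at most one index, so V 0 never
enters. -/
theorem iterate_sub_seq_mem (h : IsPrimitiveSystem V W C P)
    {f : Fin (2 * n + 1) → SmoothFn} (h0 : V 0 = Complex.I • f) (a : ℕ) (ha : a + 1 ≤ n) :
    dv^[a + 1] f - seq V W C (a + 1) ∈ lowSpan V a := by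
  have hf : f = seq V W C 0 := by
    rw [seq_of_lt (by omega), h0, factor, algebraMap_smul, smul_smul, neg_mul, Complex.I_mul_I,
      neg_neg, one_smul]
  induction a with
  | zero =>
    have h2 := h.dv_seq (l := 0) (by omega)
    rw [← hf, h.P_zero, factor, Derivation.map_algebraMap, mul_zero, add_zero, zero_smul,
      zero_add] at h2
    rw [zero_add, Function.iterate_one, h2, sub_self]
    exact zero_mem _
  | succ a ih =>
    specialize ih (by omega)
    have h2 : dv^[a + 1 + 1] f - seq V W C (a + 1 + 1) =
        dv (dv^[a + 1] f - seq V W C (a + 1)) +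
        (factor C (a + 1) * P (a + 1) + D (factor C (a + 1))) • V (a + 1) := by
      rw [map_sub, h.dv_seq (l := a + 1) (by omega), Function.iterate_succ_apply' _ (a + 1)]
      abel
    rw [h2]
    exact add_mem (h.dv_mem_lowSpan (by omega) ih)
      (Submodule.smul_mem _ _ (mem_lowSpan (by omega) le_rfl))

theorem form_lowSpan {x y : Fin (2 * n + 1) → SmoothFn} {m : ℕ}
    (h : ∀ i, 1 ≤ i → i ≤ m → form x (V i) = 0) (hy : y ∈ lowSpan V m) : form x y = 0 := by
  refine form_eq_zero_of_mem_satSpan ?_ (span_le_satSpan _ hy)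
  rintro _ ⟨i, h1, h2, rfl⟩
  exact h i h1 h2

theorem form_iterate_V (h : IsPrimitiveSystem V W C P)
    {f : Fin (2 * n + 1) → SmoothFn} (h0 : V 0 = Complex.I • f) {a i : ℕ} (ha : a ≤ n)
    (hi : i < n) (hai : 1 ≤ a + i) : form (V i) (dv^[a] f) = 0 := by
  rcases Nat.eq_zero_or_pos a with rfl | ha0
  · have h1 := h.pp i 0 hi (by omega) (by omega)
    rw [h0, form_csmul_right] at h1
    exact (smul_eq_zero.mp h1).resolve_left Complex.I_ne_zero
  · obtain ⟨b, rfl⟩ : ∃ b, a = b + 1 := ⟨a - 1, by omega⟩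
    have h1 : form (V i) (dv^[b + 1] f - seq V W C (b + 1)) = 0 :=
      form_lowSpan (fun k _ _ => h.pp i k hi (by omega) (by omega))
        (h.iterate_sub_seq_mem h0 b ha)
    have h2 : form (V i) (seq V W C (b + 1)) = 0 := by
      rcases Nat.lt_or_ge (b + 1) n with h3 | h3
      · rw [seq_of_lt h3, form_smul_right, h.pp i _ hi h3 (by omega), mul_zero]
      · obtain rfl : n = b + 1 := by omega
        rw [seq_self, form_smul_right, form_comm, h.Wp i hi, mul_zero]
    rwa [form_sub_right, h2, sub_zero] at h1

theorem form_iterate_low (h : IsPrimitiveSystem V W C P)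
    {f : Fin (2 * n + 1) → SmoothFn} (h0 : V 0 = Complex.I • f) {a b : ℕ} (ha : a ≤ n)
    (hb : b < n) (hab : 1 ≤ a + b) : form (dv^[a] f) (dv^[b] f) = 0 := by
  rcases Nat.eq_zero_or_pos b with rfl | hb0
  · have h1 := h.form_iterate_V h0 ha (show 0 < n by omega) hab
    rw [h0, form_csmul_left, form_comm] at h1
    exact (smul_eq_zero.mp h1).resolve_left Complex.I_ne_zero
  · obtain ⟨k, rfl⟩ : ∃ k, b = k + 1 := ⟨b - 1, by omega⟩
    have hk : ∀ i, 1 ≤ i → i ≤ k + 1 → form (dv^[a] f) (V i) = 0 := fun i h1 h2 => by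
      rw [form_comm]; exact h.form_iterate_V h0 ha (by omega) (by omega)
    have h1 := form_lowSpan (fun i h1 h2 => hk i h1 (by omega))
      (h.iterate_sub_seq_mem h0 k hb.le)
    rwa [form_sub_right, seq_of_lt hb, form_smul_right, hk (k + 1) (by omega) le_rfl, mul_zero,
      sub_zero] at h1

/-- When one order is at most n and the other is below n, this is `form_iterate_low`. Otherwise
differentiating a product that is already known to vanish moves a derivative from one argument to
the other while the total order stays below 2n. -/
theorem isIsotropicVec (h : IsPrimitiveSystem V W C P)
    {f : Fin (2 * n + 1) → SmoothFn} (h0 : V 0 = Complex.I • f) : IsIsotropicVec f := by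
  have key : ∀ a b, b ≤ n → 1 ≤ a + b → a + b ≤ 2 * n - 1 → form (dv^[a] f) (dv^[b] f) = 0 := by
    intro a
    induction a with
    | zero =>
      intro b hb h1 _
      rw [form_comm]
      exact h.form_iterate_low h0 hb (by omega) (by omega)
    | succ a ih =>
      intro b hb h1 h2
      rcases Nat.lt_or_ge b n with hb' | hb'
      · rcases Nat.lt_or_ge n (a + 1) with ha | ha
        · have h3 := derivation_form D (dv^[a] f) (dv^[b] f)
          rw [ih b hb (by omega) (by omega), map_zero, ← Function.iterate_succ_apply' dv,
            ← Function.iterate_succ_apply' dv, ih (b + 1) (by omega) (by omega) (by omega),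
            add_zero] at h3
          exact h3.symm
        · exact h.form_iterate_low h0 ha hb' (by omega)
      · rw [form_comm]
        exact h.form_iterate_low h0 hb (by omega) (by omega)
  intro a b h1 h2
  rcases Nat.le_total b n with hb | hb
  · exact key a b hb h1 h2
  · rw [form_comm]
    exact key b a (by omega) (by omega) (by omega)

/-- ∂^n f differs from `seq V W C n` by a combination of V 1, …, V (n - 1). That combination is
isotropic and orthogonal to W, so only ⟨W, W⟩ survives. -/
theorem topSquare_eq (hn : 1 ≤ n) (h : IsPrimitiveSystem V W C P)
    {f : Fin (2 * n + 1) → SmoothFn} (h0 : V 0 = Complex.I • f) :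
    topSquare f = (4 * loc (n - 1) ^ 2) • (factor C (n - 1) ^ 2 * (C n * C 0)) := by
  obtain ⟨k, hk⟩ : ∃ k, n = k + 1 := ⟨n - 1, by omega⟩
  have hx := h.iterate_sub_seq_mem h0 k hk.ge
  rw [← hk] at hx
  set x := dv^[n] f - seq V W C n with hxdef
  have e : dv^[n] f = seq V W C n + x := by rw [hxdef]; abel
  have h1 : form (seq V W C n) x = 0 := form_lowSpan (fun i _ hi => by
    rw [seq_self, form_smul_left, h.Wp i (by omega), mul_zero]) hx
  have h2 : form x x = 0 := form_lowSpan (fun i hi1 hi => by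
    rw [form_comm]
    exact form_lowSpan (fun l _ hl => h.pp i l (by omega) (by omega) (by omega)) hx) hx
  rw [topSquare, e, form_add_left, form_add_right, form_add_right, form_comm x, h1, h2, seq_self,
    form_smul_left, form_smul_right, h.WW]
  simp only [add_zero, mul_smul_comm]
  congr 1
  ring

/-- `topSquare f` is holomorphic and non-zero, hence regular. Divisors of a regular element are
regular, and every `factor C l` with l < n divides it. -/
theorem isHarmonicSeq (hn : 1 ≤ n) (h : IsPrimitiveSystem V W C P)
    {f : Fin (2 * n + 1) → SmoothFn} (hf : IsHarmonicVec f) (h0 : V 0 = Complex.I • f)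
    (ht : topSquare f ≠ 0) : IsHarmonicSeq f (seq V W C) := by
  refine ⟨?_, fun j hj => h.seq_succ hj, fun j hj => ?_⟩
  · rw [seq_of_lt hn, h0, factor, algebraMap_smul, smul_smul, neg_mul, Complex.I_mul_I,
      neg_neg, one_smul]
  · have h1 : topSquare f ∈ nonZeroDivisors SmoothFn :=
      SmoothFn.mem_nonZeroDivisors (dense_of_Db (Db_topSquare hn hf (h.isIsotropicVec h0)) ht)
    rw [h.topSquare_eq hn h0, ← algebraMap_smul SmoothFn, smul_eq_mul, pow_two (factor C (n - 1))] at h1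
    have hmul : ∀ {a b : SmoothFn}, a * b ∈ nonZeroDivisors SmoothFn →
        a ∈ nonZeroDivisors SmoothFn ∧ b ∈ nonZeroDivisors SmoothFn := fun {a b} hab =>
      mul_mem_nonZeroDivisors.mp hab
    have h2 := (hmul (hmul (hmul h1).2).1).1
    have h3 : ∀ m, factor C m ∈ nonZeroDivisors SmoothFn → ∀ l ≤ m,
        factor C l ∈ nonZeroDivisors SmoothFn := by
      intro m hm
      induction m with
      | zero => intro l hl; rwa [Nat.le_zero.mp hl]
      | succ m ih =>
        intro l hl
        rcases hl.lt_or_eq with h4 | rfl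
        · refine ih ?_ l (by omega)
          rw [factor, ← algebraMap_smul SmoothFn, smul_eq_mul] at hm
          exact (hmul (hmul hm).2).1
        · exact hm
    have h4 := h3 _ h2 j (by omega)
    rw [h.hsq_seq hj]
    refine mul_mem (mul_mem h4 (conj_mem_nonZeroDivisors h4)) (IsUnit.mem_nonZeroDivisors
      ((IsUnit.mk0 _ ?_).map (algebraMap ℂ SmoothFn)))
    split_ifs <;> norm_num

end IsPrimitiveSystem

theorem IsHarmonicSeq.unique {f : Fin (2 * n + 1) → SmoothFn}
    {s s' : ℕ → Fin (2 * n + 1) → SmoothFn} (h : IsHarmonicSeq f s) (h' : IsHarmonicSeq f s')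
    (j : ℕ) (hj : j ≤ n) : s j = s' j := by
  induction j with
  | zero => rw [h.zero, h'.zero]
  | succ j ih =>
    specialize ih (by omega)
    have h1 := h.succ j hj
    have h2 := h'.succ j hj
    rw [← ih, ← h1] at h2
    exact (smul_vec_cancel (h.regular j hj) h2).symm

end SmoothFn

/-! ### From maps of the plane to the ring of smooth functions -/

namespace SmoothFn

section Translation

variable {ι : Type*}

/-- The map of the plane underlying a vector of smooth functions. -/
def toMap (x : ι → SmoothFn) : ℂ → ι → ℂ := fun z => vmap (eval z) x

theorem toMap_injective : Function.Injective (toMap : (ι → SmoothFn) → ℂ → ι → ℂ) :=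
  fun _ _ h => ext_vmap_eval fun z => congrFun h z

theorem exists_toMap_eq [Fintype ι] {g : ℂ → ι → ℂ} (hg : ContDiff ℝ ∞ g) :
    ∃ x : ι → SmoothFn, toMap x = g :=
  ⟨fun i => ⟨fun z => g z i, contDiff_pi.mp hg i⟩, rfl⟩

theorem contDiff_toMap [Fintype ι] (x : ι → SmoothFn) : ContDiff ℝ ∞ (toMap x) :=
  contDiff_pi.mpr fun i => (x i).contDiff

theorem dzVec_toMap (x : ι → SmoothFn) : dzVec (toMap x) = toMap (dv x) := rfl

theorem iterate_dzVec_toMap (x : ι → SmoothFn) (a : ℕ) :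
    dzVec^[a] (toMap x) = toMap (dv^[a] x) := by
  induction a with
  | zero => rfl
  | succ a ih => rw [Function.iterate_succ_apply', Function.iterate_succ_apply', ih, dzVec_toMap]

theorem star_toMap (x : ι → SmoothFn) (z : ℂ) : star (toMap x z) = toMap (cj x) z := rfl

variable {n : ℕ}

theorem form_toMap (x y : Fin (2 * n + 1) → SmoothFn) (z : ℂ) :
    form (toMap x z) (toMap y z) = eval z (form x y) := (map_form _ _ _).symm

theorem hnorm_toMap (x : Fin (2 * n + 1) → SmoothFn) (z : ℂ) :
    (hnorm (toMap x z) : ℂ) = eval z (hsq x) := (hsq_apply x z).symm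

theorem hnorm_toMap_ne_zero_iff (x : Fin (2 * n + 1) → SmoothFn) (z : ℂ) :
    hnorm (toMap x z) ≠ 0 ↔ (hsq x : ℂ → ℂ) z ≠ 0 := by
  rw [hsq_apply, Complex.ofReal_ne_zero]
  rfl

/-- If p vanished on an open set, a bump function supported in the closure of a ball inside that set
would be a non-zero function annihilated by p. -/
theorem dense_of_mem_nonZeroDivisors {p : SmoothFn} (hp : p ∈ nonZeroDivisors SmoothFn) :
    Dense {z | (p : ℂ → ℂ) z ≠ 0} := by
  rw [← Set.compl_ofPred, ← interior_eq_empty_iff_dense_compl]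
  by_contra hne
  obtain ⟨z, hz⟩ := Set.nonempty_iff_ne_empty.mpr hne
  obtain ⟨r, hr, hb⟩ := Metric.isOpen_iff.mp isOpen_interior z hz
  let b : ContDiffBump z := ⟨r / 2, r, half_pos hr, half_lt_self hr⟩
  set q : SmoothFn := ⟨fun w => (b w : ℂ), Complex.ofRealCLM.contDiff.comp b.contDiff⟩ with hq
  have h1 : p * q = 0 := ext_eval fun w => by
    by_cases hw : w ∈ Metric.ball z r
    · have h2 : w ∈ {a | (p : ℂ → ℂ) a = 0} := interior_subset (hb hw)
      rw [Set.mem_ofPred_eq] at h2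
      show (p : ℂ → ℂ) w * (q : ℂ → ℂ) w = 0
      rw [h2, zero_mul]
    · have h2 : b w = 0 := b.zero_of_le_dist (by simpa using hw)
      show (p : ℂ → ℂ) w * (b w : ℂ) = 0
      rw [h2, Complex.ofReal_zero, mul_zero]
  have h3 := congrArg (eval z) (mul_eq_zero_cancel hp h1)
  rw [map_zero] at h3
  have h4 : b z = 1 := b.one_of_mem_closedBall (Metric.mem_closedBall_self b.rIn_pos.le)
  have h5 : ((b z : ℝ) : ℂ) = 0 := h3
  rw [h4] at h5
  simp at h5

theorem complexify_form (x y : Fin (2 * n + 1) → ℝ) :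
    form (n := n) (fun i => (x i : ℂ)) (fun i => (y i : ℂ)) = ((form x y : ℝ) : ℂ) :=
  (map_form Complex.ofRealHom x y).symm

open Laplacian InnerProductSpace in
theorem four_mul_dv_dbv_apply {f : ℂ → Fin (2 * n + 1) → ℝ} (hf : ContDiff ℝ ∞ f)
    {x : Fin (2 * n + 1) → SmoothFn} (hx : toMap x = complexify f) (z : ℂ)
    (i : Fin (2 * n + 1)) : 4 * toMap (dv (dbv x)) z i = ((Δ f z i : ℝ) : ℂ) := by
  have h1 := four_mul_D_Db_apply (x i) z
  let l : (Fin (2 * n + 1) → ℝ) →L[ℝ] ℂ := Complex.ofRealCLM.comp (ContinuousLinearMap.proj i)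
  have h2 : (x i : ℂ → ℂ) = l ∘ f := funext fun w => congrFun (congrFun hx w) i
  have h3 := ContDiffAt.laplacian_CLM_comp_left (l := l) (hf.contDiffAt (x := z) |>.of_le
    (by exact WithTop.coe_le_coe.mpr le_top))
  rw [← h2, laplacian_eq_iteratedFDeriv_complexPlane] at h3
  simp only [iteratedFDeriv_two_apply, Matrix.cons_val_zero, Matrix.cons_val_one] at h3
  rw [← h1] at h3
  exact h3

/-- Zero tension says that ∂∂̄f is proportional to f, because 4∂∂̄ is the Laplacian. The factor is
found by differentiating ⟨∂̄f, f⟩ = 0. -/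
theorem isHarmonicVec_of_isHarmonicMap {f : ℂ → Fin (2 * n + 1) → ℝ} (hf : IsHarmonicMap f)
    {x : Fin (2 * n + 1) → SmoothFn} (hx : toMap x = complexify f) : IsHarmonicVec x := by
  have hr : cj x = x := toMap_injective (by
    funext z
    rw [← star_toMap, hx]
    exact funext fun i => Complex.conj_ofReal _)
  have hn : form x x = 1 := ext_eval fun z => by
    rw [← eval_apply, ← form_toMap, hx]
    refine (complexify_form (f z) (f z)).trans ?_
    rw [show form (f z) (f z) = 1 from hf.mem_sphere z]
    exact Complex.ofReal_one
  refine ⟨hr, hn, ?_⟩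
  have h1 : dv (dbv x) = form (dv (dbv x)) x • x := by
    have h2 : ∀ z, ∃ m : ℂ, toMap (dv (dbv x)) z = m • toMap x z := fun z => by
      have ht := hf.tension_eq_zero z
      refine ⟨((form (Laplacian.laplacian f z) (f z) : ℝ) : ℂ) / 4, funext fun i => ?_⟩
      have h3 := four_mul_dv_dbv_apply hf.smooth hx z i
      have h4 := congrArg (fun r : ℝ => (r : ℂ)) (congrFun ht i)
      simp only [tension, Pi.sub_apply, Pi.smul_apply, smul_eq_mul, Complex.ofReal_sub,
        Complex.ofReal_mul, Pi.zero_apply, Complex.ofReal_zero] at h4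
      rw [Pi.smul_apply, hx, smul_eq_mul, complexify]
      linear_combination (1 / 4) * h3 + (1 / 4) * h4
    refine ext_vmap_eval fun z => ?_
    obtain ⟨m, hm⟩ := h2 z
    have h5 : eval z (form (dv (dbv x)) x) = m := by
      rw [← form_toMap, hm, form_smul_left, form_toMap, hn, map_one, mul_one]
    rw [vmap_smul, h5]
    exact hm
  have h2 : form (dbv x) x = 0 := by
    have h3 := congrArg conj (form_dv_self hn)
    rwa [conj_form, cj_dv, hr, map_zero] at h3
  have h3 := derivation_form D (dbv x) x
  rw [h2, map_zero] at h3
  have h4 : form (dv (dbv x)) x = -hsq (dv x) := by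
    rw [hsq, cj_dv, hr, form_comm (dv x)]
    linear_combination -h3
  rw [← h4, ← h1]

theorem isSuperconformal_iff (hn : 1 ≤ n) {f : ℂ → Fin (2 * n + 1) → ℝ}
    {x : Fin (2 * n + 1) → SmoothFn} (hx : toMap x = complexify f) :
    IsSuperconformal f ↔ IsIsotropicVec x ∧ topSquare x ≠ 0 := by
  have h : ∀ a b z, form (dzVec^[a] (complexify f) z) (dzVec^[b] (complexify f) z) =
      eval z (form (dv^[a] x) (dv^[b] x)) := fun a b z => by
    rw [← hx, iterate_dzVec_toMap, iterate_dzVec_toMap, form_toMap]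
  rw [IsSuperconformal, HasIsotropyOrder, show 2 * (n - 1) + 1 = 2 * n - 1 by omega,
    show n - 1 + 1 = n by omega]
  refine and_congr ?_ ?_
  · constructor
    · exact fun h' a b h1 h2 => ext_eval fun z => (h a b z).symm.trans (h' a b h1 h2 z)
    · exact fun h' a b h1 h2 z => by rw [h, h' a b h1 h2, map_zero]
  · simp only [h]
    constructor
    · rintro ⟨z, hz⟩ h0
      exact hz (by rw [topSquare] at h0; rw [h0, map_zero])
    · intro h'
      by_contra! h0
      exact h' (ext_eval h0)

theorem IsHarmonicSeq.isHarmonicSequence {f : ℂ → Fin (2 * n + 1) → ℝ}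
    {x : Fin (2 * n + 1) → SmoothFn} (hx : toMap x = complexify f)
    {s : ℕ → Fin (2 * n + 1) → SmoothFn} (hs : IsHarmonicSeq x s)
    (h0 : ∀ j < n, ∀ z, (hsq (s j) : ℂ → ℂ) z = 0 → toMap (s j) z = 0) :
    IsHarmonicSequence f n fun j => toMap (s j) := by
  refine ⟨by rw [hs.zero, hx], fun j _ => contDiff_toMap _, fun j hj z hz => ?_,
    fun j hj z hz => ?_, fun j hj => ?_⟩
  · have h := congrArg (vmap (eval z)) (hs.succ j hj)
    rw [map_sub, vmap_smul, vmap_smul, vmap_smul, ← form_toMap, ← star_toMap, ← hnorm_toMap] at h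
    have hz' := Complex.ofReal_ne_zero.mpr hz
    rw [dzVec_toMap, div_eq_inv_mul, mul_smul]
    have h1 := congrArg (fun v => (hnorm (toMap (s j) z) : ℂ)⁻¹ • v) h
    simp only [smul_sub, inv_smul_smul₀ hz'] at h1
    exact h1
  · refine h0 j hj z ?_
    rw [hsq_apply, Complex.ofReal_eq_zero]
    exact hz
  · simp only [hnorm_toMap_ne_zero_iff]
    exact dense_of_mem_nonZeroDivisors (hs.regular j hj)

theorem exists_isHarmonicSeq {f : ℂ → Fin (2 * n + 1) → ℝ}
    {x : Fin (2 * n + 1) → SmoothFn} (hx : toMap x = complexify f)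
    {s : ℕ → ℂ → Fin (2 * n + 1) → ℂ} (hs : IsHarmonicSequence f n s) :
    ∃ t : ℕ → Fin (2 * n + 1) → SmoothFn, IsHarmonicSeq x t ∧ ∀ j ≤ n, toMap (t j) = s j := by
  have h : ∀ j, ∃ y : Fin (2 * n + 1) → SmoothFn, j ≤ n → toMap y = s j := fun j => by
    by_cases hj : j ≤ n
    · exact (exists_toMap_eq (hs.smooth j hj)).imp fun _ h _ => h
    · exact ⟨0, fun h => absurd h hj⟩
  choose t ht using h
  refine ⟨t, ⟨toMap_injective (by rw [ht 0 (Nat.zero_le n), hs.zero, hx]), fun j hj => ?_,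
    fun j hj => SmoothFn.mem_nonZeroDivisors ?_⟩, ht⟩
  · refine ext_vmap_eval fun z => ?_
    have h1 := ht j hj.le
    have h2 := ht (j + 1) hj
    rw [map_sub, vmap_smul, vmap_smul, vmap_smul, ← form_toMap, ← star_toMap, ← hnorm_toMap]
    show (hnorm (toMap (t j) z) : ℂ) • toMap (t (j + 1)) z =
      (hnorm (toMap (t j) z) : ℂ) • dzVec (toMap (t j)) z -
        form (dzVec (toMap (t j)) z) (star (toMap (t j) z)) • toMap (t j) z
    rw [h1, h2]
    by_cases hz : hnorm (s j z) = 0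
    · rw [hs.eq_zero_of_null j hj z hz, smul_zero, sub_zero,
        show hnorm (0 : Fin (2 * n + 1) → ℂ) = 0 by simp [hnorm], Complex.ofReal_zero, zero_smul,
        zero_smul]
    · have hz' := Complex.ofReal_ne_zero.mpr hz
      rw [hs.succ j hj z hz, smul_sub, smul_smul, mul_div_cancel₀ _ hz']
  · have h := hs.dense j hj
    rw [← ht j hj.le] at h
    simpa only [hnorm_toMap_ne_zero_iff] using h

end Translation

end SmoothFn

/-! ### Cyclic primitive frames -/

namespace SmoothFn

open Matrix IsPrimitiveSystem

section Main

variable {n : ℕ} {F : ℂ → SO n} {f : ℂ → Fin (2 * n + 1) → ℝ} {x : Fin (2 * n + 1) → SmoothFn}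

theorem _root_.DeSitter.IsPrimitiveFrame.exists_isRootCoeff (hn : 1 ≤ n)
    (hF : IsPrimitiveFrame F) : ∃ c, IsRootCoeff F c := by
  have h : ∀ z, ∃ c : ℕ → ℂ, InGraded n 0 (maurerCartan F z - rootSum n c) := fun z => by
    obtain ⟨A₀, A₁, h₀, h₁, h⟩ := hF.graded z
    rw [h]
    exact (isPrimitiveElement_add hn h₀ h₁).exists_rootSum hn
  choose c hc using h
  exact ⟨fun k z => c z k, hc⟩

theorem frameVec_stdVec_one (hF : IsSmoothFrame F) (hFf : IsFrameOf F f)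
    (hx : toMap x = complexify f) : frameVec hF (stdVec n ℂ 1) = x := by
  refine ext_vmap_eval fun z => ?_
  rw [eval_frameVec, show vmap (eval z) x = complexify f z from congrFun hx z]
  have h : complexify f z = fun i => (((mat (F z)) *ᵥ stdVec n ℝ 1) i : ℂ) := by
    rw [hFf z]; rfl
  rw [h]
  funext i
  rw [mulVec, dotProduct, mulVec, dotProduct, Complex.ofReal_sum]
  refine Finset.sum_congr rfl fun b _ => ?_
  rw [Complex.ofReal_mul]
  congr 1
  simp only [stdVec]
  split_ifs <;> simp

theorem frameVec_Ep_zero (hF : IsSmoothFrame F) (hFf : IsFrameOf F f)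
    (hx : toMap x = complexify f) : frameVec hF (Ep n 0) = Complex.I • x := by
  rw [Ep_zero, map_smul, frameVec_stdVec_one hF hFf hx]

theorem isFrameOf_of_frameVec (hF : IsSmoothFrame F) (hx : toMap x = complexify f)
    (h : frameVec hF (Ep n 0) = Complex.I • x) : IsFrameOf F f := by
  rw [Ep_zero, map_smul] at h
  have h1 := smul_right_injective _ Complex.I_ne_zero h
  intro z
  have h2 := congrArg (vmap (eval z)) h1
  rw [eval_frameVec, show vmap (eval z) x = complexify f z from congrFun hx z] at h2
  funext i
  refine Complex.ofReal_injective ((Eq.symm ?_).trans (congrFun h2 i))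
  rw [mulVec, dotProduct, mulVec, dotProduct, Complex.ofReal_sum]
  refine Finset.sum_congr rfl fun b _ => ?_
  rw [Complex.ofReal_mul]
  congr 1
  simp only [stdVec]
  split_ifs <;> simp

theorem factor_apply {C : ℕ → SmoothFn} {c : ℕ → ℂ → ℂ} {m : ℕ}
    (hC : ∀ k ≤ m, ∀ z, (C k : ℂ → ℂ) z = c k z) (z : ℂ) {j : ℕ} (h1 : 1 ≤ j) (hj : j ≤ m) :
    eval z (factor C j) = 2 ^ (j - 1) * ∏ k ∈ Finset.Icc 1 j, c k z := by
  induction j with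
  | zero => omega
  | succ j ih =>
    rw [factor, eval_csmul, map_mul, eval_apply z (C (j + 1)), hC (j + 1) hj, add_tsub_cancel_right,
      Finset.prod_Icc_succ_top (by omega)]
    rcases Nat.eq_zero_or_pos j with rfl | h0
    · rw [factor, loc, if_pos rfl]
      have : eval z (algebraMap ℂ SmoothFn (-Complex.I)) = -Complex.I := rfl
      rw [this, Finset.Icc_eq_empty (by omega), Finset.prod_empty]
      linear_combination (-c 1 z) * Complex.I_sq
    · rw [ih h0 (by omega), loc, if_neg (by omega)]
      obtain ⟨i, rfl⟩ : ∃ i, j = i + 1 := ⟨j - 1, by omega⟩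
      rw [add_tsub_cancel_right]
      ring

/-- For n ≥ 2 the power of two is 4 · 2² · 2^(2(n-2)). For n = 1 the values `loc 0` = i and `factor
C 0` = -i have squares with product 1, so only 4 remains. -/
theorem top_factor_apply (hn : 1 ≤ n) {C : ℕ → SmoothFn} {c : ℕ → ℂ → ℂ}
    (hC : ∀ k ≤ n, ∀ z, (C k : ℂ → ℂ) z = c k z) (z : ℂ) :
    eval z ((4 * loc (n - 1) ^ 2) • (factor C (n - 1) ^ 2 * (C n * C 0))) =
      2 ^ (2 * n) * (∏ k ∈ Finset.Icc 1 (n - 1), c k z ^ 2) * c n z * c 0 z := by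
  rw [eval_csmul, map_mul, map_mul, map_pow, eval_apply z (C n), eval_apply z (C 0), hC n le_rfl,
    hC 0 (by omega), Finset.prod_pow]
  rcases Nat.lt_or_ge 1 n with h | h
  · rw [factor_apply hC z (by omega) (by omega), loc, if_neg (by omega)]
    obtain ⟨i, rfl⟩ : ∃ i, n = i + 2 := ⟨n - 2, by omega⟩
    rw [show i + 2 - 1 - 1 = i by omega]
    ring
  · obtain rfl : n = 1 := le_antisymm h hn
    have : eval z (algebraMap ℂ SmoothFn (-Complex.I)) = -Complex.I := rfl
    rw [factor, loc, if_pos rfl, this, Finset.Icc_eq_empty (by omega), Finset.prod_empty]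
    linear_combination (4 * c 1 z * c 0 z * (Complex.I ^ 2 - 1)) * Complex.I_sq

/-- The structure equations of a primitive frame of `f`. -/
theorem exists_isPrimitiveSystem (hn : 1 ≤ n) (hF : IsSmoothFrame F) (hFf : IsFrameOf F f)
    (hx : toMap x = complexify f) {c : ℕ → ℂ → ℂ} (hc : IsRootCoeff F c) :
    ∃ V W C P, IsPrimitiveSystem (n := n) V W C P ∧ V 0 = Complex.I • x ∧
      (∀ l, V l = frameVec hF (Ep n l)) ∧ ∀ k ≤ n, ∀ z, (C k : ℂ → ℂ) z = c k z := by
  obtain ⟨C, hC⟩ := exists_smooth_rootCoeff hn hF hc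
  exact ⟨_, _, C, _, isPrimitiveSystem hn hF hc hC, frameVec_Ep_zero hF hFf hx, fun _ => rfl, hC⟩

theorem topSquare_apply (hn : 1 ≤ n) (hF : IsSmoothFrame F) (hFf : IsFrameOf F f)
    (hx : toMap x = complexify f) {c : ℕ → ℂ → ℂ} (hc : IsRootCoeff F c) (z : ℂ) :
    eval z (topSquare x) =
      2 ^ (2 * n) * (∏ k ∈ Finset.Icc 1 (n - 1), c k z ^ 2) * c n z * c 0 z := by
  obtain ⟨V, W, C, P, h, h0, -, hC⟩ := exists_isPrimitiveSystem hn hF hFf hx hc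
  rw [h.topSquare_eq hn h0, top_factor_apply hn hC]

/-- At the cyclic point the given decomposition and the chosen root coefficients agree by
uniqueness, so the product formula has no zero factor there. -/
theorem topSquare_ne_zero_of_cyclic (hn : 1 ≤ n) (hF : IsCyclicPrimitiveFrame F)
    (hFf : IsFrameOf F f) (hx : toMap x = complexify f) : topSquare x ≠ 0 := by
  obtain ⟨c, hc⟩ := hF.toIsPrimitiveFrame.exists_isRootCoeff hn
  obtain ⟨z, A₀, A₁, h₀, ⟨c', hc', rfl⟩, h⟩ := hF.cyclic
  have h' : InGraded n 0 (maurerCartan F z - rootSum n c') := by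
    rw [h, rootSum, add_sub_cancel_right]; exact h₀
  have hne : ∀ k ≤ n, c k z ≠ 0 := fun k hk => by
    rw [rootCoeff_unique hn (hc z) h' hk]
    exact hc' k hk
  intro h0
  have h1 := topSquare_apply hn hF.smooth hFf hx hc z
  rw [h0, map_zero] at h1
  refine mul_ne_zero (mul_ne_zero (mul_ne_zero (pow_ne_zero _ two_ne_zero) ?_) (hne n le_rfl))
    (hne 0 (Nat.zero_le n)) h1.symm
  exact Finset.prod_ne_zero_iff.mpr fun k hk => pow_ne_zero 2 (hne k (by
    have := Finset.mem_Icc.mp hk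
    omega))

/-- The harmonic sequence of the map framed by a cyclic primitive frame. -/
theorem exists_seq_of_cyclic (hn : 1 ≤ n) (hF : IsCyclicPrimitiveFrame F)
    (hFf : IsFrameOf F f) (hx : toMap x = complexify f) (hfx : IsHarmonicVec x)
    {c : ℕ → ℂ → ℂ} (hc : IsRootCoeff F c) :
    IsIsotropicVec x ∧ ∃ t, IsHarmonicSeq x t ∧
      (∀ j < n, ∀ z, (hsq (t j) : ℂ → ℂ) z = 0 → toMap (t j) z = 0) ∧
      ∀ j, 1 ≤ j → j < n → ∀ z, toMap (t j) z =
        (2 ^ (j - 1) * ∏ k ∈ Finset.Icc 1 j, c k z) • cmat (F z) *ᵥ Ep n j := by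
  obtain ⟨V, W, C, P, h, h0, hV, hC⟩ := exists_isPrimitiveSystem hn hF.smooth hFf hx hc
  have ht := topSquare_ne_zero_of_cyclic hn hF hFf hx
  have hseq : ∀ j < n, ∀ z, toMap (seq V W C j) z =
      eval z (factor C j) • cmat (F z) *ᵥ Ep n j := fun j hj z => by
    rw [seq_of_lt hj, toMap, vmap_smul, hV, eval_frameVec]
  refine ⟨h.isIsotropicVec h0, _, h.isHarmonicSeq hn hfx h0 ht, fun j hj z hz => ?_,
    fun j h1 hj z => ?_⟩
  · have h2 : eval z (algebraMap ℂ SmoothFn (if j = 0 then 1 else 2)) ≠ 0 := by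
      show (if j = 0 then 1 else 2 : ℂ) ≠ 0
      split_ifs <;> norm_num
    rw [h.hsq_seq hj, ← eval_apply, map_mul, map_mul] at hz
    have h3 := (mul_eq_zero.mp hz).resolve_right h2
    have h4 : eval z (factor C j) = 0 := (mul_eq_zero.mp h3).elim id fun h5 =>
      (map_eq_zero (starRingEnd ℂ)).mp h5
    rw [hseq j hj, h4, zero_smul]
  · rw [hseq j hj, factor_apply hC z h1 hj.le]

/-- A superconformal harmonic map with an everywhere defined harmonic sequence has a cyclic
primitive frame. -/
theorem exists_isCyclicPrimitiveFrame (hn : 1 ≤ n) (hf : IsHarmonicMap f)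
    (hx : toMap x = complexify f) (hi : IsIsotropicVec x) (ht : topSquare x ≠ 0)
    {s : ℕ → Fin (2 * n + 1) → SmoothFn} (hs : IsHarmonicSeq x s) :
    ∃ F : ℂ → SO n, IsCyclicPrimitiveFrame F ∧ IsFrameOf F f := by
  have hfx := isHarmonicVec_of_isHarmonicMap hf hx
  obtain ⟨d, V, hV, h0⟩ := exists_normalization hn hfx hi ht hs
  obtain ⟨F, hF, hFV⟩ := exists_adapted_frame hn hfx h0 hV
  have hFf : IsFrameOf F f := isFrameOf_of_frameVec hF hx (by rw [hFV 0 hn, h0])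
  have h := fun z => (isPrimitiveElement_maurerCartan hn hfx hi hs hV hF hFV z).exists_rootSum hn
  choose c hc using h
  have hc' : IsRootCoeff F fun k z => c z k := hc
  refine ⟨F, ⟨⟨hF, fun z => ⟨_, _, hc z, inGraded_one_rootSum hn (c z), ?_⟩, fun _ => ?_⟩, ?_⟩, hFf⟩
  · rw [sub_add_cancel]
  · rw [show (fun z => (mat (F z)).mulVec (stdVec n ℝ 1)) = f from funext hFf]
    exact hf
  -- At a point where `topSquare x` is non-zero, the product formula forces all of c_0, …, c_n to be
  -- non-zero.
  · obtain ⟨z, hz⟩ : ∃ z, eval z (topSquare x) ≠ 0 := by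
      by_contra! h1
      exact ht (ext_eval h1)
    rw [topSquare_apply hn hF hFf hx hc'] at hz
    have h1 := left_ne_zero_of_mul hz
    refine ⟨z, _, rootSum n (c z), hc z, ⟨c z, fun k hk => ?_, rfl⟩, by rw [sub_add_cancel]⟩
    rcases Nat.eq_zero_or_pos k with rfl | hk0
    · exact right_ne_zero_of_mul hz
    · rcases hk.lt_or_eq with hk1 | rfl
      · have h2 := right_ne_zero_of_mul (left_ne_zero_of_mul h1)
        exact pow_ne_zero_iff two_ne_zero |>.mp
          (Finset.prod_ne_zero_iff.mp h2 k (Finset.mem_Icc.mpr ⟨hk0, by omega⟩))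
      · exact right_ne_zero_of_mul h1

theorem exists_isCyclicPrimitive_iff (hn : 1 ≤ n) (hf : IsHarmonicMap f) :
    (∃ ψ : ℂ → SO n ⧸ T n, IsCyclicPrimitive ψ ∧ ∀ z, proj n (ψ z) = f z) ↔
      IsSuperconformal f ∧ ∃ s, IsHarmonicSequence f n s := by
  obtain ⟨x, hx⟩ := exists_toMap_eq (g := complexify f)
    (contDiff_pi.mpr fun i => Complex.ofRealCLM.contDiff.comp (contDiff_pi.mp hf.smooth i))
  have hfx := isHarmonicVec_of_isHarmonicMap hf hx
  rw [isSuperconformal_iff hn hx]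
  constructor
  · rintro ⟨ψ, ⟨F, hF, hFψ⟩, hψ⟩
    have hFf : IsFrameOf F f := fun z => by rw [← hψ z, ← hFψ z]; rfl
    obtain ⟨c, hc⟩ := hF.toIsPrimitiveFrame.exists_isRootCoeff hn
    obtain ⟨hi, t, ht, h0, -⟩ := exists_seq_of_cyclic hn hF hFf hx hfx hc
    exact ⟨⟨hi, topSquare_ne_zero_of_cyclic hn hF hFf hx⟩, _, ht.isHarmonicSequence hx h0⟩
  · rintro ⟨⟨hi, ht⟩, s, hs⟩
    obtain ⟨t, hst, -⟩ := exists_isHarmonicSeq hx hs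
    obtain ⟨F, hF, hFf⟩ := exists_isCyclicPrimitiveFrame hn hf hx hi ht hst
    exact ⟨fun z => QuotientGroup.mk (F z), ⟨F, hF, fun _ => rfl⟩, hFf⟩

/-- The entries of index 1, …, n - 1 are complex null vectors, so their Hermitian square is
non-negative, and it is zero only where the entry is zero. Their zeros are those of the scalar c in
a level, which is locally a power of z - a times a unit. -/
theorem isHarmonicSequence_entries (hn : 1 ≤ n) (hf : IsHarmonicMap f) (hsc : IsSuperconformal f)
    {s : ℕ → ℂ → Fin (2 * n + 1) → ℂ} (hs : IsHarmonicSequence f n s) {j : ℕ} (h1 : 1 ≤ j)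
    (hj : j < n) : (∀ z, s j z ≠ 0 → 0 < hnorm (s j z)) ∧
      ∀ z, ∀ᶠ w in nhdsWithin z {z}ᶜ, s j w ≠ 0 := by
  obtain ⟨x, hx⟩ := exists_toMap_eq (g := complexify f)
    (contDiff_pi.mpr fun i => Complex.ofRealCLM.contDiff.comp (contDiff_pi.mp hf.smooth i))
  have hfx := isHarmonicVec_of_isHarmonicMap hf hx
  obtain ⟨hi, ht⟩ := (isSuperconformal_iff hn hx).mp hsc
  obtain ⟨t, hst, hts⟩ := exists_isHarmonicSeq hx hs
  constructor
  · intro z hz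
    refine lt_of_le_of_ne (hnorm_nonneg_of_null ?_)
      fun h => hz (hs.eq_zero_of_null j hj z h.symm)
    rw [← hts j hj.le, form_toMap, form_seq_seq hn hfx hi hst hj.le hj.le (by omega) (by omega),
      map_zero]
  · intro z
    obtain ⟨c, g, h⟩ := exists_isLevel hn hfx hi ht hst j hj
    filter_upwards [h.holo.eventually_ne z] with w hw h0
    rw [← hts j hj.le, h.eq, toMap, vmap_smul] at h0
    refine h.ne w ?_
    rw [← eval_apply, hsq, map_form, (smul_eq_zero.mp h0).resolve_left hw, form_zero_left]

theorem isHarmonicSequence_eq (hn : 1 ≤ n) (hf : IsHarmonicMap f)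
    {s : ℕ → ℂ → Fin (2 * n + 1) → ℂ} (hs : IsHarmonicSequence f n s)
    (hF : IsCyclicPrimitiveFrame F) (hFf : IsFrameOf F f) {c : ℕ → ℂ → ℂ}
    (hc : IsRootCoeff F c) :
    (∀ j, 1 ≤ j → j < n → ∀ z, s j z =
      (2 ^ (j - 1) * ∏ k ∈ Finset.Icc 1 j, c k z) • cmat (F z) *ᵥ Ep n j) ∧
    ∀ z, form (dzVec^[n] (complexify f) z) (dzVec^[n] (complexify f) z) =
      2 ^ (2 * n) * (∏ k ∈ Finset.Icc 1 (n - 1), c k z ^ 2) * c n z * c 0 z := by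
  obtain ⟨x, hx⟩ := exists_toMap_eq (g := complexify f)
    (contDiff_pi.mpr fun i => Complex.ofRealCLM.contDiff.comp (contDiff_pi.mp hf.smooth i))
  have hfx := isHarmonicVec_of_isHarmonicMap hf hx
  obtain ⟨t, hst, hts⟩ := exists_isHarmonicSeq hx hs
  obtain ⟨hi, t', ht', -, h⟩ := exists_seq_of_cyclic hn hF hFf hx hfx hc
  constructor
  · intro j h1 hj z
    rw [← hts j hj.le, hst.unique ht' j hj.le, h j h1 hj z]
  · intro z
    rw [← topSquare_apply hn hF.smooth hFf hx hc, ← hx, iterate_dzVec_toMap, form_toMap]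
    rfl

end Main

end SmoothFn

end DeSitter

end

theorem mainTheorem3 (n : ℕ) (hn : 1 ≤ n) (f : ℂ → Fin (2 * n + 1) → ℝ)
    (hf : DeSitter.IsHarmonicMap f) :
    ((∃ ψ : ℂ → DeSitter.SO n ⧸ DeSitter.T n,
        DeSitter.IsCyclicPrimitive ψ ∧ ∀ z, DeSitter.proj n (ψ z) = f z) ↔
      DeSitter.IsSuperconformal f ∧ ∃ s, DeSitter.IsHarmonicSequence f n s) ∧
    (DeSitter.IsSuperconformal f → ∀ s, DeSitter.IsHarmonicSequence f n s →
      (∀ j, 1 ≤ j → j ≤ n - 1 →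
        (∀ z, s j z ≠ 0 → 0 < DeSitter.hnorm (s j z)) ∧
        (∀ z, ∀ᶠ w in nhdsWithin z {z}ᶜ, s j w ≠ 0)) ∧
      (∀ F : ℂ → DeSitter.SO n, DeSitter.IsCyclicPrimitiveFrame F → DeSitter.IsFrameOf F f →
        (∃ c, DeSitter.IsRootCoeff F c) ∧
        ∀ c, DeSitter.IsRootCoeff F c →
          (∀ j, 1 ≤ j → j ≤ n - 1 → ∀ z,
            s j z = (2 ^ (j - 1) * ∏ k ∈ Finset.Icc 1 j, c k z) •
              (DeSitter.cmat (F z)).mulVec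
                (DeSitter.stdVec n ℂ (2 * j) + Complex.I • DeSitter.stdVec n ℂ (2 * j + 1))) ∧
          (∀ z, DeSitter.form (DeSitter.dzVec^[n] (DeSitter.complexify f) z)
              (DeSitter.dzVec^[n] (DeSitter.complexify f) z) =
            2 ^ (2 * n) * (∏ k ∈ Finset.Icc 1 (n - 1), c k z ^ 2) * c n z * c 0 z))) := by
  refine ⟨DeSitter.SmoothFn.exists_isCyclicPrimitive_iff hn hf, fun hsc s hs =>
    ⟨fun j h1 hj => DeSitter.SmoothFn.isHarmonicSequence_entries hn hf hsc hs h1 (by omega),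
      fun F hF hFf => ⟨hF.toIsPrimitiveFrame.exists_isRootCoeff hn, fun c hc => ?_⟩⟩⟩
  obtain ⟨h1, h2⟩ := DeSitter.SmoothFn.isHarmonicSequence_eq hn hf hs hF hFf hc
  exact ⟨fun j hj1 hj z => h1 j hj1 (by omega) z, h2⟩
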